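/- Let $d\ge 1$ and $H=(H_0,H_1,\dots,H_d)\in(0,1)^{d+1}$ with $$d+\tfrac34<2H_0+\sum_{i=1}^dH_i\le d+1 .$$ *Linear solutions.* For $t\ge 0$, $\xi,r\in\mathbb R$ put $\gamma_t(\xi,r)=e^{\imath\xi t}\int_0^te^{\imath s(r^2-\xi)}\,ds$, for $n\ge1$ put $D_n=\{(\xi,\eta)\in\mathbb R\times\mathbb R^d:\ |\xi|\le 2^{2n},\ |\eta|\le 2^n\}$, and let $$c_H=\prod_{j=0}^d\Big(\int_{\mathbb R}\frac{|e^{\imath\xi}-1|^2}{|\xi|^{2H_j+1}}\,d\xi\Big)^{-1/2}$$ (the normalizing constant in the harmonizable representation of the space-time fractional Brownian motion $B$ of Hurst index $H$). Let $\{\Psi_n(t,x):\ n\ge1,\ t\ge0,\ x\in\mathbb R^d\}$ be the sequence of linear solutions, that is, of solutions of $\imath\partial_t\Psi_n-\Delta\Psi_n=\partial_t\partial_{x_1}\cdots\partial_{x_d}B_n$, $\Psi_n(0,\cdot)=0$, where $B_n$ is $B$ with its frequencies truncated to $D_n$. By definition, this is a (jointly) centered complex Gaussian process, on some probability space, such that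 for all $n,m\ge1$, $s,t\ge0$, $x,y\in\mathbb R^d$, $$\mathbb E\big[\Psi_n(s,x)\overline{\Psi_m(t,y)}\big]=c_H^2\int_{D_n\cap D_m}\frac{1}{|\xi|^{2H_0-1}}\prod_{i=1}^d\frac1{|\eta_i|^{2H_i-1}}\,\gamma_s(\xi,|\eta|)\,\overline{\gamma_t(\xi,|\eta|)}\,e^{\imath\langle\eta,x-y\rangle}\,d\xi\,d\eta,$$ $$\mathbb E\big[\Psi_n(s,x)\Psi_m(t,y)\big]=-c_H^2\int_{D_n\cap D_m}\frac{1}{|\xi|^{2H_0-1}}\prod_{i=1}^d\frac1{|\eta_i|^{2H_i-1}}\,\gamma_s(\xi,|\eta|)\,\gamma_t(-\xi,|\eta|)\,e^{\imath\langle\eta,x-y\rangle}\,d\xi\,d\eta;$$ as usual, a version is taken such that, for every $n$, almost surely $(t,x)\mapsto\Psi_n(t,x)$ is continuous on $[0,\infty)\times\mathbb R^d$. Let $\sigma_n(t)=\mathbb E[|\Psi_n(t,x)|^2]$, which does not depend on $x$. *Sobolev spaces.* For $s\in\mathbb R$ and $1\le p\le\infty$, $\mathcal W^{s,p}(\mathbb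 R^d)$ is the space of tempered distributions $f$ such that $\|f\|_{\mathcal W^{s,p}}=\|\mathcal F^{-1}(\{1+|\cdot|^2\}^{s/2}\mathcal Ff)\|_{L^p(\mathbb R^d)}<\infty$, where $\mathcal Ff(\lambda)=\int_{\mathbb R^d}f(y)e^{-\imath\langle\lambda,y\rangle}\,dy$. *Claim.* Let $T\ge0$ and let $\chi:\mathbb R^d\to\mathbb R$ be smooth and compactly supported. Then, almost surely, there is a limit $L$, a map from $[0,T]$ to the tempered distributions, such that for all $2\le p\le\infty$ and all $$\alpha>d+1-\Big(2H_0+\sum_{i=1}^dH_i\Big),$$ the sequence of functions $t\mapsto\chi^2\,(|\Psi_n(t,\cdot)|^2-\sigma_n(t))$, $n\ge1$, and $L$ belong to $\mathcal C([0,T];\mathcal W^{-2\alpha,p}(\mathbb R^d))$, and the sequence converges to $L$ in this space. -/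

import Mathlib

open MeasureTheory ProbabilityTheory Filter Topology
open scoped SchwartzMap ENNReal NNReal

namespace WickSchrodinger

/-- The Bessel potential operator `(Id - Δ) ^ (s / 2)` on tempered distributions on `ℝ ^ d`:
the Fourier multiplier with symbol `(1 + |λ| ^ 2) ^ (s / 2)` for the convention
`f ↦ ∫ f y * exp (- i ⟨λ, y⟩) dy` of the Fourier transform. Mathlib's Fourier transform has
`exp (- 2 π i ⟨ξ, y⟩)` instead, so that `λ = 2 π ξ`. -/
noncomputable def besselOp (d : ℕ) (s : ℝ) :
    𝓢'(EuclideanSpace ℝ (Fin d), ℂ) →L[ℂ] 𝓢'(EuclideanSpace ℝ (Fin d), ℂ) :=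
  TemperedDistribution.fourierMultiplierCLM ℂ
    (fun ξ : EuclideanSpace ℝ (Fin d) =>
      (((1 + ‖(2 * Real.pi) • ξ‖ ^ 2) ^ (s / 2) : ℝ) : ℂ))

theorem besselSymbol_hasTemperateGrowth (d : ℕ) (s : ℝ) :
    (fun ξ : EuclideanSpace ℝ (Fin d) =>
      (((1 + ‖(2 * Real.pi) • ξ‖ ^ 2) ^ (s / 2) : ℝ) : ℂ)).HasTemperateGrowth := by
  have h := (Function.hasTemperateGrowth_one_add_norm_sq_rpow
    (EuclideanSpace ℝ (Fin d)) (s / 2)).comp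
    (((2 * Real.pi) • ContinuousLinearMap.id ℝ (EuclideanSpace ℝ (Fin d))).hasTemperateGrowth)
  exact (Complex.ofRealCLM.hasTemperateGrowth).comp h

theorem besselOp_neg_besselOp (d : ℕ) (s : ℝ) (f : 𝓢'(EuclideanSpace ℝ (Fin d), ℂ)) :
    besselOp d (-s) (besselOp d s f) = f := by
  unfold besselOp
  rw [TemperedDistribution.fourierMultiplierCLM_fourierMultiplierCLM_apply
    (besselSymbol_hasTemperateGrowth d s) (besselSymbol_hasTemperateGrowth d (-s))]
  have : ((fun ξ : EuclideanSpace ℝ (Fin d) =>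
      (((1 + ‖(2 * Real.pi) • ξ‖ ^ 2) ^ (s / 2) : ℝ) : ℂ)) *
      (fun ξ : EuclideanSpace ℝ (Fin d) =>
      (((1 + ‖(2 * Real.pi) • ξ‖ ^ 2) ^ (-s / 2) : ℝ) : ℂ))) = fun _ => (1 : ℂ) := by
    funext ξ
    have hpos : (0 : ℝ) < 1 + ‖(2 * Real.pi) • ξ‖ ^ 2 := by positivity
    simp only [Pi.mul_apply]
    rw [← Complex.ofReal_mul, ← Real.rpow_add hpos, show s / 2 + -s / 2 = 0 by ring,
      Real.rpow_zero, Complex.ofReal_one]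
  rw [this]
  simp

theorem besselOp_injective (d : ℕ) (s : ℝ) : Function.Injective (besselOp d s) :=
  Function.LeftInverse.injective (besselOp_neg_besselOp d s)

theorem toTemperedDistribution_injective (d : ℕ) (p : ℝ≥0∞) [Fact (1 ≤ p)] :
    Function.Injective
      (Lp.toTemperedDistributionCLM ℂ (volume : Measure (EuclideanSpace ℝ (Fin d))) p) :=
  LinearMap.ker_eq_bot.mp Lp.ker_toTemperedDistributionCLM_eq_bot

/-- The tempered distributions `f` such that `(Id - Δ) ^ (s / 2) f` belongs to `L ^ p`. -/
noncomputable def sobolevSubmodule (d : ℕ) (s : ℝ) (p : ℝ≥0∞) [Fact (1 ≤ p)] :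
    Submodule ℂ 𝓢'(EuclideanSpace ℝ (Fin d), ℂ) :=
  (LinearMap.range (Lp.toTemperedDistributionCLM ℂ
    (volume : Measure (EuclideanSpace ℝ (Fin d))) p).toLinearMap).comap
    (besselOp d s).toLinearMap

/-- The Sobolev space `W ^ {s, p} (ℝ ^ d)`, with the norm of `(Id - Δ) ^ (s / 2) f` in `L ^ p`
(see `SobolevSpace.norm_eq`). It is a type of its own, so that it does not inherit the topology
of the space of tempered distributions. -/
def SobolevSpace (d : ℕ) (s : ℝ) (p : ℝ≥0∞) [Fact (1 ≤ p)] : Type :=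
  sobolevSubmodule d s p

namespace SobolevSpace

variable {d : ℕ} {s : ℝ} {p : ℝ≥0∞} [Fact (1 ≤ p)]

noncomputable instance : AddCommGroup (SobolevSpace d s p) :=
  inferInstanceAs (AddCommGroup (sobolevSubmodule d s p))

noncomputable instance : Module ℂ (SobolevSpace d s p) :=
  inferInstanceAs (Module ℂ (sobolevSubmodule d s p))

/-- An element of the Sobolev space as a tempered distribution. -/
noncomputable def toDistribution :
    SobolevSpace d s p →ₗ[ℂ] 𝓢'(EuclideanSpace ℝ (Fin d), ℂ) :=
  (sobolevSubmodule d s p).subtype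

theorem toDistribution_injective :
    Function.Injective (toDistribution : SobolevSpace d s p → _) :=
  Subtype.val_injective

theorem exists_toLp (f : SobolevSpace d s p) :
    ∃ g : Lp ℂ p (volume : Measure (EuclideanSpace ℝ (Fin d))),
      Lp.toTemperedDistributionCLM ℂ volume p g = besselOp d s f.toDistribution :=
  f.2

/-- The function of class `L ^ p` that represents `(Id - Δ) ^ (s / 2) f`. -/
noncomputable def toLp :
    SobolevSpace d s p →ₗ[ℂ] Lp ℂ p (volume : Measure (EuclideanSpace ℝ (Fin d))) where
  toFun f := (exists_toLp f).choose
  map_add' f g := by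
    apply toTemperedDistribution_injective d p
    refine (exists_toLp (f + g)).choose_spec.trans ?_
    rw [map_add, map_add, map_add]
    exact congrArg₂ (· + ·) (exists_toLp f).choose_spec.symm (exists_toLp g).choose_spec.symm
  map_smul' c f := by
    apply toTemperedDistribution_injective d p
    refine (exists_toLp (c • f)).choose_spec.trans ?_
    rw [map_smul, map_smul, map_smul, RingHom.id_apply]
    exact congrArg (c • ·) (exists_toLp f).choose_spec.symm

theorem toLp_spec (f : SobolevSpace d s p) :
    Lp.toTemperedDistributionCLM ℂ volume p f.toLp = besselOp d s f.toDistribution :=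
  (exists_toLp f).choose_spec

theorem toLp_injective :
    Function.Injective
      (toLp : SobolevSpace d s p →ₗ[ℂ] Lp ℂ p (volume : Measure (EuclideanSpace ℝ (Fin d)))) := by
  intro f g h
  apply toDistribution_injective
  apply besselOp_injective d s
  rw [← toLp_spec f, ← toLp_spec g, h]

noncomputable instance : NormedAddCommGroup (SobolevSpace d s p) :=
  NormedAddCommGroup.induced (SobolevSpace d s p)
    (Lp ℂ p (volume : Measure (EuclideanSpace ℝ (Fin d)))) toLp toLp_injective

theorem norm_eq (f : SobolevSpace d s p)
    (g : Lp ℂ p (volume : Measure (EuclideanSpace ℝ (Fin d))))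
    (h : besselOp d s f.toDistribution = Lp.toTemperedDistributionCLM ℂ volume p g) :
    ‖f‖ = ‖g‖ := by
  have : f.toLp = g := toTemperedDistribution_injective d p (by rw [toLp_spec, h])
  rw [← this]
  rfl

end SobolevSpace

/-- The tempered distribution `u` is (integration against) the function `f`. -/
def IsFunction {d : ℕ} (u : 𝓢'(EuclideanSpace ℝ (Fin d), ℂ))
    (f : EuclideanSpace ℝ (Fin d) → ℂ) : Prop :=
  ∀ φ : 𝓢(EuclideanSpace ℝ (Fin d), ℂ),
    Integrable (fun x => φ x * f x) ∧ u φ = ∫ x, φ x * f x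

/-- The constant `c_H` for which the harmonizable representation
`c_H ∫ ∫ (exp (i t ξ) - 1) / |ξ| ^ (H₀ + 1/2) ∏ (exp (i xᵢ ηᵢ) - 1) / |ηᵢ| ^ (Hᵢ + 1/2) Ŵ(dξ, dη)`
is a space-time fractional Brownian motion of index `H`, that is, has covariance
`∏ (|x| ^ (2 Hⱼ) + |y| ^ (2 Hⱼ) - |x - y| ^ (2 Hⱼ)) / 2`; here `Ŵ` is normalized by
`E |Ŵ(f)| ^ 2 = ∫ |f| ^ 2`. -/
noncomputable def hurstConst {d : ℕ} (H : Fin (d + 1) → ℝ) : ℝ :=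
  ∏ j, (Real.sqrt
    (∫ ξ : ℝ, ‖Complex.exp (Complex.I * ξ) - 1‖ ^ 2 / |ξ| ^ (2 * H j + 1)))⁻¹

/-- `γ_t(ξ, r) = exp (i ξ t) ∫₀ᵗ exp (i s (r² - ξ)) ds`. -/
noncomputable def gammaFun (t ξ r : ℝ) : ℂ :=
  Complex.exp (Complex.I * ξ * t) *
    ∫ s in (0 : ℝ)..t, Complex.exp (Complex.I * s * (r ^ 2 - ξ))

/-- The frequency domain `D_n = {|ξ| ≤ 2 ^ (2n)} × {|η| ≤ 2 ^ n}`. -/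
def freqDomain (d : ℕ) (n : ℕ+) : Set (ℝ × EuclideanSpace ℝ (Fin d)) :=
  {z | |z.1| ≤ 2 ^ (2 * (n : ℕ)) ∧ ‖z.2‖ ≤ 2 ^ (n : ℕ)}

/-- The spectral density `|ξ| ^ (1 - 2 H₀) ∏ |ηᵢ| ^ (1 - 2 Hᵢ)` of the fractional noise, up to
the constant `c_H ^ 2`. -/
noncomputable def spectralWeight {d : ℕ} (H : Fin (d + 1) → ℝ)
    (z : ℝ × EuclideanSpace ℝ (Fin d)) : ℝ :=
  1 / |z.1| ^ (2 * H 0 - 1) * ∏ i : Fin d, 1 / |z.2 i| ^ (2 * H i.succ - 1)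

/-- The sequence of linear solutions, that is, of solutions of `i ∂ₜ Ψₙ - Δ Ψₙ = ∂ₜ ∂₁ ⋯ ∂_d Bₙ`,
`Ψₙ(0, ·) = 0`, where `Bₙ` is the harmonizable fractional sheet of Hurst index `H` truncated to
the frequencies in `D_n`: a centered complex Gaussian process, indexed jointly by `n ≥ 1`, `t ≥ 0`
and `x`, with prescribed covariance and pseudo-covariance. -/
structure IsLinearSolution {d : ℕ} (H : Fin (d + 1) → ℝ) {Ω : Type*} [MeasurableSpace Ω]
    (P : Measure Ω) (Ψ : ℕ+ → ℝ≥0 → EuclideanSpace ℝ (Fin d) → Ω → ℂ) : Prop where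
  gaussian : IsGaussianProcess
    (fun i : ℕ+ × ℝ≥0 × EuclideanSpace ℝ (Fin d) => Ψ i.1 i.2.1 i.2.2) P
  centered : ∀ n t x, ∫ ω, Ψ n t x ω ∂P = 0
  covariance : ∀ (n m : ℕ+) (s t : ℝ≥0) (x y : EuclideanSpace ℝ (Fin d)),
    ∫ ω, Ψ n s x ω * (starRingEnd ℂ) (Ψ m t y ω) ∂P =
      (hurstConst H : ℂ) ^ 2 * ∫ z in freqDomain d n ∩ freqDomain d m,
        (spectralWeight H z : ℂ) * gammaFun s z.1 ‖z.2‖ *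
          (starRingEnd ℂ) (gammaFun t z.1 ‖z.2‖) *
          Complex.exp (Complex.I * (inner ℝ z.2 (x - y) : ℝ))
  pseudoCovariance : ∀ (n m : ℕ+) (s t : ℝ≥0) (x y : EuclideanSpace ℝ (Fin d)),
    ∫ ω, Ψ n s x ω * Ψ m t y ω ∂P =
      -(hurstConst H : ℂ) ^ 2 * ∫ z in freqDomain d n ∩ freqDomain d m,
        (spectralWeight H z : ℂ) * gammaFun s z.1 ‖z.2‖ * gammaFun t (-z.1) ‖z.2‖ *
          Complex.exp (Complex.I * (inner ℝ z.2 (x - y) : ℝ))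

/-- The Wick square `|Ψₙ(t, x)| ^ 2 - E |Ψₙ(t, x)| ^ 2`. -/
noncomputable def wickSquare {d : ℕ} {Ω : Type*} [MeasurableSpace Ω] (P : Measure Ω)
    (Ψ : ℕ+ → ℝ≥0 → EuclideanSpace ℝ (Fin d) → Ω → ℂ)
    (n : ℕ+) (t : ℝ≥0) (x : EuclideanSpace ℝ (Fin d)) (ω : Ω) : ℝ :=
  ‖Ψ n t x ω‖ ^ 2 - ∫ ω', ‖Ψ n t x ω'‖ ^ 2 ∂P

end WickSchrodinger

/-! The operator (1 - Δ)^(-α) is averaging against a probability measure J_α with characteristic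
function (1 + |t|²)^(-α) (`besselMeasure`, `charFun_besselMeasure`). The norm of order -2α of a
continuous compactly supported function is thus the L^p norm of its J_α-average, and the objects to
control are the averages of χ² (W_{n+1}(t) - W_n(t)), where W_n is the Wick square (`fieldPot`,
`wickIncr`).

By Wick's formula (`integral_norm_sq_sub_mul`) the covariance of Wick squares is the sum of the
squared moduli of the covariance and of the pseudo-covariance of Ψ, which are Fourier integrals K(x
- y). Since J_α is positive, the cutoff leaves the estimate through its supremum and its integral,
and what remains is the mean of |K(u - u')|² under J_α × J_α. Expanding the square, this is at most
the energy ∫∫ |f(z)| |f(w)| (1 + |η - η'|²)^(-2α) of the spectral density f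
(`lintegral_enorm_waveKernel_sq_le`).

Oscillation of γ_t gives |f| ≲ spectral weight / (1 + (|η|² - |ξ|)²). Integrating out ξ puts |ξ| at
|η|²; the powers of |η| and of |η - η'| are then shared among the coordinates, and each coordinate
is a one-dimensional integral settled by scaling (`lintegral_energyKernel_lt_top`). The energy is
finite for d + 1 - (2H₀ + ∑ Hᵢ) < α < 1/4, with a small power of the frequency to spare
(`exists_lintegral_energy_lt_top`). The spare power makes the second moments of the smoothed
increments decay geometrically in n. The lower bound on 2H₀ + ∑ Hᵢ is what makes such α exist;
larger α only smooth more.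

In time, a crude Lipschitz bound with a constant growing exponentially in n suffices: interpolated
with the geometric decay it gives a bound 2^(-θn) |t - s|^θ
(`exists_uniformMeanBound_fieldPot_sub`). Hypercontractivity, proved by rotating two independent
copies of a Gaussian vector, raises this to all moments (`lintegral_pow_le_of_orthogonal_norm_sq`).
Chaining along dyadic times then yields almost sure geometric decay, uniformly in time, in every
L^(2k) (`ae_exists_eLpNorm_le_of_moments`). Finally a little extra smoothing turns L^(2k) into L^∞,
so that the sequence is Cauchy for every 2 ≤ p ≤ ∞ (`exists_tendsto_sobolevSpace`), and all limits
coincide as distributions (`exists_limit_sobolevSpace`). -/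

namespace WickSchrodinger

/-! ### One-dimensional integrals: power weights and the energy kernel. -/

theorem lintegral_comp_abs {f : ℝ → ℝ≥0∞} (hf : Measurable f) :
    ∫⁻ x : ℝ, f |x| = 2 * ∫⁻ x in Set.Ioi 0, f x := by
  have h1 : ∫⁻ x in Set.Ioi (0 : ℝ), f |x| = ∫⁻ x in Set.Ioi 0, f x :=
    setLIntegral_congr_fun measurableSet_Ioi fun x hx => by
      rw [abs_of_pos (Set.mem_Ioi.mp hx)]
  have h2 : ∫⁻ x in Set.Iic (0 : ℝ), f |x| = ∫⁻ x in Set.Ioi 0, f x := by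
    rw [setLIntegral_congr (Iio_ae_eq_Iic (a := (0 : ℝ))).symm]
    have hmp := (Measure.measurePreserving_neg (volume : Measure ℝ)).setLIntegral_comp_preimage
      (measurableSet_Iio (a := (0 : ℝ))) (f := fun x => f |x|) (by fun_prop)
    rw [← hmp, ← h1]
    simp
  rw [← lintegral_add_compl _ (measurableSet_Ioi (a := (0 : ℝ))), Set.compl_Ioi, h1, h2, two_mul]

theorem rpow_le_two_rpow_abs {v : ℝ} (h1 : 1 / 2 ≤ v) (h2 : v ≤ 2) (e : ℝ) :
    v ^ e ≤ 2 ^ |e| := by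
  have hv : 0 < v := by linarith
  rcases le_total 0 e with he | he
  · rw [abs_of_nonneg he]; exact Real.rpow_le_rpow hv.le h2 he
  · rw [abs_of_nonpos he, show e = - -e by ring, Real.rpow_neg hv.le, ← Real.inv_rpow hv.le, neg_neg]
    refine Real.rpow_le_rpow (by positivity) ?_ (by linarith)
    rw [inv_le_comm₀ hv (by norm_num)]; linarith

theorem lintegral_Ioc_rpow_lt_top {s : ℝ} (hs : -1 < s) (b : ℝ) :
    ∫⁻ x in Set.Ioc 0 b, ENNReal.ofReal (x ^ s) < ⊤ := by
  rcases le_total b 0 with hb | hb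
  · simp [Set.Ioc_eq_empty (not_lt.mpr hb)]
  have h := (intervalIntegral.intervalIntegrable_rpow' hs (a := 0) (b := b))
  rw [intervalIntegrable_iff_integrableOn_Ioc_of_le hb] at h
  exact h.setLIntegral_lt_top

theorem lintegral_Ioi_rpow_lt_top {s c : ℝ} (hs : s < -1) (hc : 0 < c) :
    ∫⁻ x in Set.Ioi c, ENNReal.ofReal (x ^ s) < ⊤ :=
  (integrableOn_Ioi_rpow_of_lt hs hc).setLIntegral_lt_top

theorem lintegral_abs_rpow_mul_lt_top {s e : ℝ} (hs : -1 < s) (he : s - e < -1) :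
    ∫⁻ x : ℝ, ENNReal.ofReal (|x| ^ s * (1 + |x|) ^ (-e)) < ⊤ := by
  rw [lintegral_comp_abs (f := fun x => ENNReal.ofReal (x ^ s * (1 + x) ^ (-e))) (by fun_prop)]
  refine ENNReal.mul_lt_top (by simp) ?_
  rw [← Set.Ioc_union_Ioi_eq_Ioi (zero_le_one (α := ℝ))]
  refine (lintegral_union_le _ _ _).trans_lt (ENNReal.add_lt_top.mpr ⟨?_, ?_⟩)
  · refine lt_of_le_of_lt (setLIntegral_mono (g := fun x => ENNReal.ofReal (2 ^ |e|) * ENNReal.ofReal (x ^ s))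
      (by fun_prop) fun x hx => ?_) ?_
    · rw [← ENNReal.ofReal_mul (by positivity)]
      refine ENNReal.ofReal_le_ofReal ?_
      rw [mul_comm]
      have := rpow_le_two_rpow_abs (v := 1 + x) (by linarith [hx.1]) (by linarith [hx.2]) (-e)
      rw [abs_neg] at this
      exact mul_le_mul_of_nonneg_right this (Real.rpow_nonneg hx.1.le _)
    · rw [lintegral_const_mul _ (by fun_prop)]
      exact ENNReal.mul_lt_top (by simp) (lintegral_Ioc_rpow_lt_top hs 1)
  · refine lt_of_le_of_lt (setLIntegral_mono
      (g := fun x => ENNReal.ofReal (2 ^ |e|) * ENNReal.ofReal (x ^ (s - e)))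
      (by fun_prop) fun x hx => ?_) ?_
    · have hx : (1 : ℝ) < x := hx
      have hx0 : 0 < x := by linarith
      rw [← ENNReal.ofReal_mul (by positivity)]
      refine ENNReal.ofReal_le_ofReal ?_
      have h1 : (1 + x) = (1 + 1 / x) * x := by field_simp; ring
      have hxi : 1 / x ≤ 1 := by rw [div_le_one hx0]; exact hx.le
      have hxi0 : 0 ≤ 1 / x := by positivity
      have := rpow_le_two_rpow_abs (v := 1 + 1 / x) (by linarith) (by linarith) (-e)
      rw [abs_neg] at this
      rw [h1, Real.mul_rpow (by positivity) hx0.le, sub_eq_add_neg, Real.rpow_add hx0]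
      have hp : 0 ≤ x ^ s * x ^ (-e) := by positivity
      nlinarith
    · rw [lintegral_const_mul _ (by fun_prop)]
      exact ENNReal.mul_lt_top (by simp) (lintegral_Ioi_rpow_lt_top he one_pos)

theorem lintegral_ball_rpow_lt_top {s : ℝ} (hs : -1 < s) (b : ℝ) :
    ∫⁻ x : ℝ in {x | |x| ≤ b}, ENNReal.ofReal (|x| ^ s) < ⊤ := by
  have hm : MeasurableSet {x : ℝ | |x| ≤ b} := measurableSet_le (by fun_prop) (by fun_prop)
  rw [← lintegral_indicator hm]
  have := lintegral_comp_abs (f := (Set.Iic b).indicator fun x => ENNReal.ofReal (x ^ s))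
    (Measurable.indicator (by fun_prop) measurableSet_Iic)
  have h2 : ∀ x : ℝ, ({x : ℝ | |x| ≤ b}).indicator (fun x => ENNReal.ofReal (|x| ^ s)) x =
    (Set.Iic b).indicator (fun x => ENNReal.ofReal (x ^ s)) |x| := by
    intro x; simp [Set.indicator_apply]
  simp_rw [h2, this]
  refine ENNReal.mul_lt_top (by simp) ?_
  rw [setLIntegral_indicator measurableSet_Iic, Set.inter_comm, Set.Ioi_inter_Iic]
  exact lintegral_Ioc_rpow_lt_top hs b

/-- The singularities at 0 and at 1 do not interact: on each side of |u| = 1/2 one of the two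
factors is bounded. Here u is the ratio y / x of the two variables of the energy kernel. -/
theorem lintegral_ball_rpow_mul_rpow_lt_top {p c : ℝ} (hp : p < 1) (hc0 : 0 ≤ c) (hc : c < 1) :
    ∫⁻ u : ℝ in {u | |u| ≤ 1}, ENNReal.ofReal (|u| ^ (-p) * |1 - u| ^ (-c)) < ⊤ := by
  have hm : MeasurableSet {x : ℝ | |x| ≤ 1} := measurableSet_le (by fun_prop) (by fun_prop)
  refine lt_of_le_of_lt (setLIntegral_mono' (g := fun u => ENNReal.ofReal (2 ^ c) *
      ENNReal.ofReal (|u| ^ (-p)) + ENNReal.ofReal (2 ^ |p|) * ENNReal.ofReal (|1 - u| ^ (-c))) hm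
      fun u hu => ?_) ?_
  · rw [← ENNReal.ofReal_mul (by positivity), ← ENNReal.ofReal_mul (by positivity),
      ← ENNReal.ofReal_add (by positivity) (by positivity)]
    refine ENNReal.ofReal_le_ofReal ?_
    have hu : |u| ≤ 1 := hu
    have hP : 0 ≤ |u| ^ (-p) := by positivity
    have hC : 0 ≤ |1 - u| ^ (-c) := by positivity
    have h2c : (0 : ℝ) ≤ 2 ^ c := by positivity
    have h2p : (0 : ℝ) ≤ 2 ^ |p| := by positivity
    rcases le_total |u| (1 / 2) with h | h
    · have h1 : 1 / 2 ≤ |1 - u| := by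
        have := abs_sub_abs_le_abs_sub 1 u
        rw [abs_one] at this; linarith
      have h3 : |1 - u| ≤ 2 := by
        have := abs_sub 1 u
        rw [abs_one] at this; linarith
      have := rpow_le_two_rpow_abs h1 h3 (-c)
      rw [abs_neg, abs_of_nonneg hc0] at this
      nlinarith
    · have := rpow_le_two_rpow_abs h (by linarith) (-p)
      rw [abs_neg] at this
      nlinarith
  · rw [lintegral_add_left (by fun_prop), lintegral_const_mul _ (by fun_prop),
      lintegral_const_mul _ (by fun_prop)]
    refine ENNReal.add_lt_top.mpr ⟨ENNReal.mul_lt_top (by simp)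
      (lintegral_ball_rpow_lt_top (by linarith) 1), ENNReal.mul_lt_top (by simp) ?_⟩
    have hmp := (Measure.measurePreserving_sub_left (volume : Measure ℝ) 1).setLIntegral_comp_preimage
      (s := {x | |x| ≤ 2}) (measurableSet_le (by fun_prop) (by fun_prop))
      (f := fun x => ENNReal.ofReal (|x| ^ (-c))) (by fun_prop)
    refine lt_of_le_of_lt (lintegral_mono_set ?_) (hmp.trans_lt
      (lintegral_ball_rpow_lt_top (by linarith) 2))
    intro u hu
    have hu : |u| ≤ 1 := hu
    have := abs_sub 1 u
    rw [abs_one] at this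
    change |1 - u| ≤ 2
    linarith

/-- The one-dimensional factor of the energy integral. -/
noncomputable def energyKernel (H b b' c x y : ℝ) : ℝ :=
  |x| ^ (1 - 2 * H) * |y| ^ (1 - 2 * H) * (1 + |x|) ^ (-b) * (1 + |y|) ^ (-b') *
    (1 + |x - y|) ^ (-c)

theorem energyKernel_nonneg (H b b' c x y : ℝ) : 0 ≤ energyKernel H b b' c x y := by
  unfold energyKernel; positivity

theorem energyKernel_symm (H b b' c x y : ℝ) :
    energyKernel H b b' c x y = energyKernel H b' b c y x := by
  unfold energyKernel; rw [abs_sub_comm x y]; ring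

@[fun_prop]
theorem measurable_energyKernel (H b b' c : ℝ) :
    Measurable fun z : ℝ × ℝ => energyKernel H b b' c z.1 z.2 := by
  unfold energyKernel; fun_prop

/-- Pointwise form of the substitution y = x u, the factor |x| being its Jacobian. For b' ≥ 0 one
uses 1 + |xu| ≥ (1 + |x|) |u|, for b' ≤ 0 merely |xu| ≤ |x|; this is the origin of `max b' 0`. The
difference is handled by 1 + |x| |1 - u| ≥ (1 + |x|) |1 - u| / 2. -/
theorem abs_mul_energyKernel_le {H b b' c x u : ℝ} (hc0 : 0 ≤ c)
    (hx : x ≠ 0) (hu0 : u ≠ 0) (hu1 : u ≠ 1) (hu : |u| ≤ 1) :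
    |x| * energyKernel H b b' c x (x * u) ≤
      (2 ^ c * (|x| ^ (3 - 4 * H) * (1 + |x|) ^ (-(b + b' + c)))) *
        (|u| ^ (-(2 * H - 1 + max b' 0)) * |1 - u| ^ (-c)) := by
  have hx' : 0 < |x| := abs_pos.mpr hx
  have hu' : 0 < |u| := abs_pos.mpr hu0
  have h1u : 0 < |1 - u| := abs_pos.mpr (sub_ne_zero.mpr hu1.symm)
  have h1 : (1 + |x * u|) ^ (-b') ≤ (1 + |x|) ^ (-b') * |u| ^ (-max b' 0) := by
    rcases le_total 0 b' with hb | hb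
    · rw [max_eq_left hb, ← Real.mul_rpow (by positivity) hu'.le]
      refine Real.rpow_le_rpow_of_nonpos (by positivity) ?_ (by linarith)
      rw [abs_mul]; nlinarith
    · rw [max_eq_right hb]
      simp only [neg_zero, Real.rpow_zero, mul_one]
      refine Real.rpow_le_rpow (by positivity) ?_ (by linarith)
      rw [abs_mul]; nlinarith
  have h2 : (1 + |x - x * u|) ^ (-c) ≤ 2 ^ c * ((1 + |x|) ^ (-c) * |1 - u| ^ (-c)) := by
    have h3 : |1 - u| ≤ 2 := by
      have := abs_sub 1 u
      rw [abs_one] at this; linarith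
    have : (2 : ℝ) ^ c = (2⁻¹ : ℝ) ^ (-c) := by
      rw [Real.rpow_neg (by norm_num), Real.inv_rpow (by norm_num), inv_inv]
    rw [this, ← Real.mul_rpow (by positivity) (by positivity),
      ← Real.mul_rpow (by positivity) (by positivity)]
    refine Real.rpow_le_rpow_of_nonpos (by positivity) ?_ (by linarith)
    rw [show x - x * u = x * (1 - u) by ring, abs_mul]; nlinarith
  have hxs : |x| * (|x| ^ (1 - 2 * H) * |x| ^ (1 - 2 * H)) = |x| ^ (3 - 4 * H) := by
    rw [← Real.rpow_add hx']
    nth_rw 1 [← Real.rpow_one |x|]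
    rw [← Real.rpow_add hx']; ring_nf
  have hus : |u| ^ (1 - 2 * H) * |u| ^ (-max b' 0) = |u| ^ (-(2 * H - 1 + max b' 0)) := by
    rw [← Real.rpow_add hu']; ring_nf
  have hxe : (1 + |x|) ^ (-b) * ((1 + |x|) ^ (-b') * (1 + |x|) ^ (-c)) =
      (1 + |x|) ^ (-(b + b' + c)) := by
    rw [← Real.rpow_add (by positivity), ← Real.rpow_add (by positivity)]; ring_nf
  unfold energyKernel
  calc |x| * (|x| ^ (1 - 2 * H) * |x * u| ^ (1 - 2 * H) * (1 + |x|) ^ (-b) *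
          (1 + |x * u|) ^ (-b') * (1 + |x - x * u|) ^ (-c))
      ≤ |x| * (|x| ^ (1 - 2 * H) * |x * u| ^ (1 - 2 * H) * (1 + |x|) ^ (-b) *
          ((1 + |x|) ^ (-b') * |u| ^ (-max b' 0)) *
          (2 ^ c * ((1 + |x|) ^ (-c) * |1 - u| ^ (-c)))) := by gcongr
    _ = _ := by
      rw [abs_mul, Real.mul_rpow hx'.le hu'.le, ← hxs, ← hus, ← hxe]; ring

/-- After y = x u the variables separate. In x the integrand has exponent 3 - 4H > -1 at the origin
and exponent 3 - 4H - b - b' - c < -1 at infinity; in u the conditions b' < 2 - 2H and c < 1 make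
both singularities integrable. -/
theorem lintegral_energyKernel_half_lt_top {H b b' c : ℝ} (hH : H < 1) (hb' : b' < 2 - 2 * H)
    (hc0 : 0 ≤ c) (hc : c < 1) (h : 4 - 4 * H - b - b' - c < 0) :
    ∫⁻ x : ℝ, ∫⁻ y : ℝ in {y | |y| ≤ |x|}, ENNReal.ofReal (energyKernel H b b' c x y) < ⊤ := by
  have hm : MeasurableSet {x : ℝ | |x| ≤ 1} := measurableSet_le (by fun_prop) (by fun_prop)
  set J := ∫⁻ u : ℝ in {u | |u| ≤ 1},
    ENNReal.ofReal (|u| ^ (-(2 * H - 1 + max b' 0)) * |1 - u| ^ (-c)) with hJ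
  have hJt : J < ⊤ := lintegral_ball_rpow_mul_rpow_lt_top
    (by rcases max_cases b' 0 with h | h <;> linarith) hc0 hc
  have key : ∀ x : ℝ, x ≠ 0 →
      ∫⁻ y : ℝ in {y | |y| ≤ |x|}, ENNReal.ofReal (energyKernel H b b' c x y) ≤
      ENNReal.ofReal (2 ^ c) * ENNReal.ofReal (|x| ^ (3 - 4 * H) * (1 + |x|) ^ (-(b + b' + c))) * J := by
    intro x hx
    have hx' : 0 < |x| := abs_pos.mpr hx
    have hmx : MeasurableSet {y : ℝ | |y| ≤ |x|} := measurableSet_le (by fun_prop) (by fun_prop)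
    have hg : Measurable fun y : ℝ => ({y : ℝ | |y| ≤ |x|}).indicator
      (fun y => ENNReal.ofReal (energyKernel H b b' c x y)) y :=
      Measurable.indicator (by unfold energyKernel; fun_prop) hmx
    rw [← lintegral_indicator hmx]
    have hmap := Real.smul_map_volume_mul_left hx
    rw [← hmap, lintegral_smul_measure, lintegral_map hg (by fun_prop), smul_eq_mul]
    change ENNReal.ofReal |x| * ∫⁻ a : ℝ, ((fun y : ℝ => ({y : ℝ | |y| ≤ |x|}).indicator
      (fun y => ENNReal.ofReal (energyKernel H b b' c x y)) y) ∘ (fun u => x * u)) a ≤ _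
    rw [← lintegral_const_mul _ (hg.comp (measurable_const_mul x)), hJ, ← lintegral_indicator hm,
      ← ENNReal.ofReal_mul (by positivity), ← lintegral_const_mul _
        (Measurable.indicator (by fun_prop) hm)]
    refine lintegral_mono_ae ?_
    filter_upwards [compl_mem_ae_iff.mpr (measure_singleton (μ := volume) (0 : ℝ)),
      compl_mem_ae_iff.mpr (measure_singleton (μ := volume) (1 : ℝ))] with u hu0 hu1
    simp only [Function.comp_apply]
    by_cases hu : |u| ≤ 1
    · have hxu : |x * u| ≤ |x| := by rw [abs_mul]; nlinarith
      rw [Set.indicator_of_mem (show x * u ∈ {y : ℝ | |y| ≤ |x|} from hxu),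
        Set.indicator_of_mem (show u ∈ {y : ℝ | |y| ≤ 1} from hu),
        ← ENNReal.ofReal_mul (by positivity), ← ENNReal.ofReal_mul (by positivity)]
      exact ENNReal.ofReal_le_ofReal (abs_mul_energyKernel_le hc0 hx hu0 hu1 hu)
    · have hxu : ¬ |x * u| ≤ |x| := by rw [abs_mul]; nlinarith
      rw [Set.indicator_of_notMem (show x * u ∉ {y : ℝ | |y| ≤ |x|} from hxu)]
      simp
  refine lt_of_le_of_lt (lintegral_mono_ae (g := fun x => ENNReal.ofReal (2 ^ c) *
    ENNReal.ofReal (|x| ^ (3 - 4 * H) * (1 + |x|) ^ (-(b + b' + c))) * J) ?_) ?_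
  · filter_upwards [compl_mem_ae_iff.mpr (measure_singleton (μ := volume) (0 : ℝ))] with x hx
    exact key x hx
  · rw [lintegral_mul_const _ (by fun_prop), lintegral_const_mul _ (by fun_prop)]
    exact ENNReal.mul_lt_top (ENNReal.mul_lt_top (by simp)
      (lintegral_abs_rpow_mul_lt_top (by linarith) (by linarith))) hJt

/-- The part |y| > |x| is brought back to the half already treated by Tonelli and the symmetry that
swaps `b` and `b'`; this is why both are bounded by 2 - 2H. -/
theorem lintegral_energyKernel_lt_top {H b b' c : ℝ} (hH : H < 1) (hb : b < 2 - 2 * H)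
    (hb' : b' < 2 - 2 * H) (hc0 : 0 ≤ c) (hc : c < 1) (h : 4 - 4 * H - b - b' - c < 0) :
    ∫⁻ x : ℝ, ∫⁻ y : ℝ, ENNReal.ofReal (energyKernel H b b' c x y) < ⊤ := by
  have hm : ∀ x : ℝ, MeasurableSet {y : ℝ | |y| ≤ |x|} := fun x =>
    measurableSet_le (by fun_prop) (by fun_prop)
  have hs : MeasurableSet {z : ℝ × ℝ | |z.1| ≤ |z.2|} :=
    measurableSet_le (by fun_prop) (by fun_prop)
  have hle : ∀ x : ℝ, ∫⁻ y : ℝ, ENNReal.ofReal (energyKernel H b b' c x y) ≤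
      (∫⁻ y : ℝ in {y | |y| ≤ |x|}, ENNReal.ofReal (energyKernel H b b' c x y)) +
      ∫⁻ y : ℝ, ({z : ℝ × ℝ | |z.1| ≤ |z.2|}).indicator
        (fun z => ENNReal.ofReal (energyKernel H b b' c z.1 z.2)) (x, y) := by
    intro x
    rw [← lintegral_add_compl _ (hm x)]
    refine add_le_add_right ?_ _
    rw [← lintegral_indicator (hm x).compl]
    refine lintegral_mono fun y => ?_
    by_cases hy : |y| ≤ |x|
    · simp [Set.indicator_apply, hy]
    · have : |x| ≤ |y| := (not_le.mp hy).le
      simp [hy, this]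
  have hmeas : Measurable fun z : ℝ × ℝ => ({z : ℝ × ℝ | |z.1| ≤ |z.2|}).indicator
        (fun z => ENNReal.ofReal (energyKernel H b b' c z.1 z.2)) z :=
    Measurable.indicator (by fun_prop) hs
  refine (lintegral_mono hle).trans_lt ?_
  rw [lintegral_add_right _ hmeas.lintegral_prod_right']
  refine ENNReal.add_lt_top.mpr ⟨lintegral_energyKernel_half_lt_top hH hb' hc0 hc h, ?_⟩
  rw [lintegral_lintegral_swap (f := fun x y => ({z : ℝ × ℝ | |z.1| ≤ |z.2|}).indicator
        (fun z => ENNReal.ofReal (energyKernel H b b' c z.1 z.2)) (x, y)) hmeas.aemeasurable]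
  refine lt_of_eq_of_lt (lintegral_congr fun y => ?_)
    (lintegral_energyKernel_half_lt_top (b := b') (b' := b) hH hb hc0 hc (by linarith))
  rw [← lintegral_indicator (hm y)]
  refine lintegral_congr fun x => ?_
  simp only [Set.indicator_apply, Set.mem_ofPred_eq]
  rw [energyKernel_symm]

/-! ### Energy of the momentum weight on the whole space. -/

theorem lintegral_pi_prod {X : Type*} [MeasurableSpace X] (μ : Measure X) [SigmaFinite μ] :
    ∀ (n : ℕ) (f : Fin n → X → ℝ≥0∞), (∀ i, Measurable (f i)) →
      ∫⁻ x, ∏ i, f i (x i) ∂(Measure.pi fun _ : Fin n => μ) = ∏ i, ∫⁻ x, f i x ∂μ := by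
  intro n
  induction n with
  | zero =>
    intro f _
    simp
  | succ n ih =>
    intro f hf
    have hmp := measurePreserving_piFinSuccAbove (fun _ : Fin (n + 1) => μ) 0
    have hmeas : Measurable fun z : X × (Fin n → X) => f 0 z.1 * ∏ i : Fin n, f i.succ (z.2 i) := by
      have := hf
      fun_prop
    have h := hmp.lintegral_comp hmeas
    rw [Fin.prod_univ_succ, ← ih (fun i => f i.succ) (fun i => hf _)]
    have h2 := lintegral_prod_mul (μ := μ) (ν := Measure.pi fun _ : Fin n => μ)
      (f := f 0) (g := fun x => ∏ i : Fin n, f i.succ (x i)) (hf 0).aemeasurable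
      (Measurable.aemeasurable (Finset.measurable_prod _ fun i _ =>
        (hf i.succ).comp (measurable_pi_apply i)))
    rw [← h2, ← h]
    refine lintegral_congr fun x => ?_
    rw [Fin.prod_univ_succ]
    rfl

theorem lintegral_lintegral_pi_prod {X : Type*} [MeasurableSpace X] (μ : Measure X) [SigmaFinite μ]
    (n : ℕ) (f : Fin n → X × X → ℝ≥0∞) (hf : ∀ i, Measurable (f i)) :
    ∫⁻ x, ∫⁻ y, ∏ i, f i (x i, y i) ∂(Measure.pi fun _ : Fin n => μ)
      ∂(Measure.pi fun _ : Fin n => μ) = ∏ i, ∫⁻ x, ∫⁻ y, f i (x, y) ∂μ ∂μ := by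
  have hmp := measurePreserving_arrowProdEquivProdArrow X X (Fin n) (fun _ => μ) (fun _ => μ)
  have hmeas : Measurable fun z : (Fin n → X) × (Fin n → X) => ∏ i, f i (z.1 i, z.2 i) := by
    have := hf
    fun_prop
  rw [← lintegral_prod (f := fun z : (Fin n → X) × (Fin n → X) => ∏ i, f i (z.1 i, z.2 i))
    hmeas.aemeasurable, ← hmp.lintegral_comp hmeas]
  have := lintegral_pi_prod (μ.prod μ) n f hf
  simp_rw [← lintegral_prod _ (hf _).aemeasurable, ← this]
  rfl

theorem lintegral_euclidean {d : ℕ} {f : EuclideanSpace ℝ (Fin d) → ℝ≥0∞} (hf : Measurable f) :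
    ∫⁻ x, f x = ∫⁻ x : Fin d → ℝ, f (WithLp.toLp 2 x) :=
  ((PiLp.volume_preserving_toLp (Fin d)).lintegral_comp hf).symm

theorem lintegral_prod_energyKernel_lt_top {d : ℕ} {H b b' c : Fin d → ℝ} (hH : ∀ i, H i < 1)
    (hb : ∀ i, b i < 2 - 2 * H i) (hb' : ∀ i, b' i < 2 - 2 * H i) (hc0 : ∀ i, 0 ≤ c i)
    (hc : ∀ i, c i < 1) (h : ∀ i, 4 - 4 * H i - b i - b' i - c i < 0) :
    ∫⁻ x : EuclideanSpace ℝ (Fin d), ∫⁻ y : EuclideanSpace ℝ (Fin d), ENNReal.ofReal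
      (∏ i, energyKernel (H i) (b i) (b' i) (c i) (x i) (y i)) < ⊤ := by
  have hm : Measurable fun z : EuclideanSpace ℝ (Fin d) × EuclideanSpace ℝ (Fin d) =>
      ENNReal.ofReal (∏ i, energyKernel (H i) (b i) (b' i) (c i) (z.1 i) (z.2 i)) := by
    unfold energyKernel; fun_prop
  rw [lintegral_euclidean hm.lintegral_prod_right']
  have h1 : ∀ x : Fin d → ℝ, ∫⁻ y : EuclideanSpace ℝ (Fin d), ENNReal.ofReal
      (∏ i, energyKernel (H i) (b i) (b' i) (c i) (WithLp.toLp 2 x i) (y i)) =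
      ∫⁻ y : Fin d → ℝ, ∏ i, ENNReal.ofReal (energyKernel (H i) (b i) (b' i) (c i) (x i) (y i)) := by
    intro x
    rw [lintegral_euclidean (by unfold energyKernel; fun_prop)]
    refine lintegral_congr fun y => ?_
    rw [ENNReal.ofReal_prod_of_nonneg fun i _ => energyKernel_nonneg _ _ _ _ _ _]
  simp_rw [h1]
  have := lintegral_lintegral_pi_prod (volume : Measure ℝ) d
    (fun i z => ENNReal.ofReal (energyKernel (H i) (b i) (b' i) (c i) z.1 z.2)) (by fun_prop)
  rw [volume_pi, this]
  exact ENNReal.prod_lt_top fun i _ =>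
    lintegral_energyKernel_lt_top (hH i) (hb i) (hb' i) (hc0 i) (hc i) (h i)

theorem abs_apply_le_norm {d : ℕ} (x : EuclideanSpace ℝ (Fin d)) (i : Fin d) : |x i| ≤ ‖x‖ := by
  simpa using PiLp.norm_apply_le x i

theorem norm_le_sum_abs {d : ℕ} (x : EuclideanSpace ℝ (Fin d)) : ‖x‖ ≤ ∑ i, |x i| := by
  rw [EuclideanSpace.norm_eq]
  refine Real.sqrt_le_iff.mpr ⟨Finset.sum_nonneg fun _ _ => abs_nonneg _, ?_⟩
  exact Finset.sum_sq_le_sq_sum_of_nonneg fun _ _ => norm_nonneg _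

/-- The weight `∏ |ηᵢ| ^ (1 - 2 Hᵢ) * (1 + ‖η‖) ^ (2 - 4 h)`. -/
noncomputable def momentumWeight {d : ℕ} (H : Fin d → ℝ) (h : ℝ) (η : EuclideanSpace ℝ (Fin d)) :
    ℝ :=
  (∏ i, |η i| ^ (1 - 2 * H i)) * (1 + ‖η‖) ^ (2 - 4 * h)

theorem momentumWeight_nonneg {d : ℕ} (H : Fin d → ℝ) (h : ℝ) (η : EuclideanSpace ℝ (Fin d)) :
    0 ≤ momentumWeight H h η := by
  unfold momentumWeight; positivity

/-- Since |xᵢ| ≤ ‖x‖, a negative power of 1 + ‖x‖ may be shared among the coordinates in any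
proportion. -/
theorem one_add_sq_rpow_le_prod {d : ℕ} {c : Fin d → ℝ} (hc0 : ∀ i, 0 ≤ c i) {α : ℝ} (hα : 0 ≤ α)
    (hc : ∑ i, c i ≤ 4 * α) (x : EuclideanSpace ℝ (Fin d)) :
    (1 + ‖x‖ ^ 2) ^ (-(2 * α)) ≤ 2 ^ (2 * α) * ∏ i, (1 + |x i|) ^ (-c i) := by
  have h1 : (1 + ‖x‖ ^ 2) ^ (-(2 * α)) ≤ ((1 + ‖x‖) ^ 2 * 2⁻¹) ^ (-(2 * α)) := by
    refine Real.rpow_le_rpow_of_nonpos (by positivity) ?_ (by linarith)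
    nlinarith [sq_nonneg (1 - ‖x‖)]
  refine h1.trans ?_
  rw [Real.mul_rpow (by positivity) (by positivity), Real.inv_rpow (by norm_num),
    ← Real.rpow_neg (by norm_num), neg_neg, mul_comm]
  gcongr
  rw [← Real.rpow_natCast, ← Real.rpow_mul (by positivity)]
  calc (1 + ‖x‖) ^ (((2 : ℕ) : ℝ) * -(2 * α)) ≤ (1 + ‖x‖) ^ (∑ i, -c i) := by
        refine Real.rpow_le_rpow_of_exponent_le (by linarith [norm_nonneg x]) ?_
        rw [Finset.sum_neg_distrib]; push_cast; linarith
    _ = ∏ i, (1 + ‖x‖) ^ (-c i) := by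
        rw [Real.rpow_sum_of_pos (by positivity)]
    _ ≤ _ := by
        refine Finset.prod_le_prod (fun _ _ => by positivity) fun i _ => ?_
        refine Real.rpow_le_rpow_of_nonpos (by positivity) ?_ (by linarith [hc0 i])
        linarith [abs_apply_le_norm x i]

/-- Decoupling of the coordinates. The anisotropic part is already a product; `hcov` replaces the
isotropic factor by a finite sum of products, and the exponents `c` split the interaction, with a
choice that may depend on the pair of terms. -/
theorem momentumWeight_mul_le {d : ℕ} {K : Type*} [Fintype K] {H : Fin d → ℝ} {h α B : ℝ}
    (hα : 0 ≤ α) (b : K → Fin d → ℝ) (c : K → K → Fin d → ℝ) (hc0 : ∀ k l i, 0 ≤ c k l i)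
    (hcs : ∀ k l, ∑ i, c k l i ≤ 4 * α)
    (hcov : ∀ η : EuclideanSpace ℝ (Fin d),
      (1 + ‖η‖) ^ (2 - 4 * h) ≤ B * ∑ k, ∏ i, (1 + |η i|) ^ (-b k i))
    (x y : EuclideanSpace ℝ (Fin d)) :
    momentumWeight H h x * momentumWeight H h y * (1 + ‖x - y‖ ^ 2) ^ (-(2 * α)) ≤
      ∑ k, ∑ l, B ^ 2 * 2 ^ (2 * α) *
        ∏ i, energyKernel (H i) (b k i) (b l i) (c k l i) (x i) (y i) := by
  set W := (1 + ‖x - y‖ ^ 2) ^ (-(2 * α)) with hW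
  have hW0 : 0 ≤ W := by positivity
  set px := ∏ i, |x i| ^ (1 - 2 * H i) with hpxd
  set py := ∏ i, |y i| ^ (1 - 2 * H i) with hpyd
  have hpx : 0 ≤ px := by positivity
  have hpy : 0 ≤ py := by positivity
  set f : K → ℝ := fun k => ∏ i, (1 + |x i|) ^ (-b k i) with hf
  set g : K → ℝ := fun k => ∏ i, (1 + |y i|) ^ (-b k i) with hg
  have hf0 : ∀ k, 0 ≤ f k := fun k => by simp only [hf]; positivity
  have hg0 : ∀ k, 0 ≤ g k := fun k => by simp only [hg]; positivity
  have e1 : momentumWeight H h x ≤ px * (B * ∑ k, f k) :=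
    mul_le_mul_of_nonneg_left (hcov x) hpx
  have e2 : momentumWeight H h y ≤ py * (B * ∑ k, g k) :=
    mul_le_mul_of_nonneg_left (hcov y) hpy
  have e3 : momentumWeight H h x * momentumWeight H h y * W ≤
      (px * (B * ∑ k, f k)) * (py * (B * ∑ k, g k)) * W :=
    mul_le_mul_of_nonneg_right (mul_le_mul e1 e2 (momentumWeight_nonneg _ _ _)
      ((momentumWeight_nonneg _ _ _).trans e1)) hW0
  refine e3.trans ?_
  have e4 : (px * (B * ∑ k, f k)) * (py * (B * ∑ k, g k)) * W =
      ∑ k, ∑ l, B ^ 2 * (px * py * f k * g l) * W := by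
    calc _ = B ^ 2 * px * py * W * ((∑ k, f k) * ∑ l, g l) := by ring
      _ = _ := by
        rw [Finset.sum_mul_sum, Finset.mul_sum]
        refine Finset.sum_congr rfl fun k _ => ?_
        rw [Finset.mul_sum]
        exact Finset.sum_congr rfl fun l _ => by ring
  rw [e4]
  refine Finset.sum_le_sum fun k _ => Finset.sum_le_sum fun l _ => ?_
  have e5 := one_add_sq_rpow_le_prod (hc0 k l) hα (hcs k l) (x - y)
  rw [← hW] at e5
  have e6 : ∏ i, energyKernel (H i) (b k i) (b l i) (c k l i) (x i) (y i) =
      px * py * f k * g l * ∏ i, (1 + |(x - y) i|) ^ (-c k l i) := by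
    simp only [hpxd, hpyd, hf, hg, energyKernel, Finset.prod_mul_distrib, PiLp.sub_apply]
  rw [e6]
  have hQ : 0 ≤ B ^ 2 * (px * py * f k * g l) :=
    mul_nonneg (sq_nonneg B) (mul_nonneg (mul_nonneg (mul_nonneg hpx hpy) (hf0 k)) (hg0 l))
  refine (mul_le_mul_of_nonneg_left e5 hQ).trans (le_of_eq ?_)
  ring

theorem lintegral_lintegral_sum_sum_lt_top {X K : Type*} [MeasurableSpace X] [Fintype K]
    (μ : Measure X) [SFinite μ] (f : K → K → X × X → ℝ≥0∞) (hf : ∀ k l, Measurable (f k l))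
    (h : ∀ k l, ∫⁻ x, ∫⁻ y, f k l (x, y) ∂μ ∂μ < ⊤) :
    ∫⁻ x, ∫⁻ y, ∑ k, ∑ l, f k l (x, y) ∂μ ∂μ < ⊤ := by
  rw [← lintegral_prod (f := fun z => ∑ k, ∑ l, f k l z) (by fun_prop),
    lintegral_finsetSum _ (by fun_prop)]
  refine ENNReal.sum_lt_top.mpr fun k _ => ?_
  rw [lintegral_finsetSum _ (by fun_prop)]
  refine ENNReal.sum_lt_top.mpr fun l _ => ?_
  rw [lintegral_prod _ (hf k l).aemeasurable]
  exact h k l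

/-- The coordinate i needs `c` larger than 4 - 4Hᵢ - bᵢ - bᵢ' and smaller than 1. These lower bounds
add up to 4(1 - a), while a total of 4α is available: α > 1 - a gives the first condition and 4α < 1
the second. -/
theorem lintegral_momentumWeight_lt_top_of_cover {d : ℕ} {K : Type*} [Fintype K]
    {H : Fin d → ℝ} (hH : ∀ i, H i < 1) {h a α B : ℝ} (hsum : 2 * h + ∑ i, H i = a + d)
    (ha : a < 1) (hα : 1 - a < α) (hα' : α < 1 / 4) (b : K → Fin d → ℝ)
    (hb : ∀ k i, b k i < 2 - 2 * H i) (hbs : ∀ k, ∑ i, b k i = 4 * h - 2)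
    (hcov : ∀ η : EuclideanSpace ℝ (Fin d),
      (1 + ‖η‖) ^ (2 - 4 * h) ≤ B * ∑ k, ∏ i, (1 + |η i|) ^ (-b k i)) :
    ∫⁻ x : EuclideanSpace ℝ (Fin d), ∫⁻ y : EuclideanSpace ℝ (Fin d), ENNReal.ofReal
      (momentumWeight H h x * momentumWeight H h y * (1 + ‖x - y‖ ^ 2) ^ (-(2 * α))) < ⊤ := by
  have h1a : 0 < 1 - a := by linarith
  have hτ : 1 < α / (1 - a) := (one_lt_div h1a).mpr hα
  have hδ : ∀ k l i, 0 < 4 - 4 * H i - b k i - b l i := fun k l i => by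
    linarith [hb k i, hb l i]
  -- The budget 4α is distributed proportionally to the needs, so each need is exceeded by the same
  -- factor α / (1 - a) > 1.
  obtain ⟨c, hcdef⟩ : ∃ c : K → K → Fin d → ℝ, ∀ k l i,
      c k l i = (4 - 4 * H i - b k i - b l i) * (α / (1 - a)) := ⟨_, fun _ _ _ => rfl⟩
  have hc0 : ∀ k l i, 0 ≤ c k l i := fun k l i => by
    rw [hcdef]; exact mul_nonneg (hδ k l i).le (by linarith)
  have hcs : ∀ k l, ∑ i, c k l i = 4 * α := fun k l => by
    simp only [hcdef]
    rw [← Finset.sum_mul, Finset.sum_sub_distrib, Finset.sum_sub_distrib, Finset.sum_sub_distrib,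
      hbs, hbs, ← Finset.mul_sum, Finset.sum_const, Finset.card_univ, Fintype.card_fin, nsmul_eq_mul]
    have : ∑ i, H i = a + d - 2 * h := by linarith
    rw [this]; field_simp; ring
  have hc1 : ∀ k l i, c k l i < 1 := fun k l i => by
    have := Finset.single_le_sum (fun j _ => hc0 k l j) (Finset.mem_univ i)
    rw [hcs] at this; linarith
  have hfin : ∀ k l, ∫⁻ x : EuclideanSpace ℝ (Fin d), ∫⁻ y : EuclideanSpace ℝ (Fin d),
      ENNReal.ofReal (∏ i, energyKernel (H i) (b k i) (b l i) (c k l i) (x i) (y i)) < ⊤ :=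
    fun k l => lintegral_prod_energyKernel_lt_top hH (hb k) (hb l) (hc0 k l) (hc1 k l) fun i => by
      have := hδ k l i
      rw [hcdef]; nlinarith
  have hnn : ∀ k l (z : EuclideanSpace ℝ (Fin d) × EuclideanSpace ℝ (Fin d)), 0 ≤
      ∏ i, energyKernel (H i) (b k i) (b l i) (c k l i) (z.1 i) (z.2 i) := fun k l z =>
    Finset.prod_nonneg fun i _ => energyKernel_nonneg _ _ _ _ _ _
  have hM : (0 : ℝ) ≤ B ^ 2 * 2 ^ (2 * α) := by positivity
  have hm : ∀ k l, Measurable fun z : EuclideanSpace ℝ (Fin d) × EuclideanSpace ℝ (Fin d) =>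
      ENNReal.ofReal (∏ i, energyKernel (H i) (b k i) (b l i) (c k l i) (z.1 i) (z.2 i)) := by
    intro k l
    unfold energyKernel; fun_prop
  refine lt_of_le_of_lt ?_ (lintegral_lintegral_sum_sum_lt_top volume
    (fun k l (z : EuclideanSpace ℝ (Fin d) × EuclideanSpace ℝ (Fin d)) => ENNReal.ofReal (B ^ 2 * 2 ^ (2 * α)) *
      ENNReal.ofReal (∏ i, energyKernel (H i) (b k i) (b l i) (c k l i) (z.1 i) (z.2 i)))
    (fun k l => (hm k l).const_mul _) fun k l => ?_)
  · refine lintegral_mono fun x => lintegral_mono fun y => ?_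
    refine (ENNReal.ofReal_le_ofReal (momentumWeight_mul_le (by linarith) b c hc0
      (fun k l => (hcs k l).le) hcov x y)).trans (le_of_eq ?_)
    rw [ENNReal.ofReal_sum_of_nonneg fun k _ => Finset.sum_nonneg fun l _ =>
      mul_nonneg hM (hnn k l (x, y))]
    refine Finset.sum_congr rfl fun k _ => ?_
    rw [ENNReal.ofReal_sum_of_nonneg fun l _ => mul_nonneg hM (hnn k l (x, y))]
    exact Finset.sum_congr rfl fun l _ => ENNReal.ofReal_mul hM
  · have h1 : ∀ x : EuclideanSpace ℝ (Fin d), ∫⁻ y : EuclideanSpace ℝ (Fin d),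
        ENNReal.ofReal (B ^ 2 * 2 ^ (2 * α)) * ENNReal.ofReal
          (∏ i, energyKernel (H i) (b k i) (b l i) (c k l i) (x i) (y i)) =
        ENNReal.ofReal (B ^ 2 * 2 ^ (2 * α)) * ∫⁻ y : EuclideanSpace ℝ (Fin d), ENNReal.ofReal
          (∏ i, energyKernel (H i) (b k i) (b l i) (c k l i) (x i) (y i)) := fun x =>
      lintegral_const_mul' _ _ (by simp)
    simp_rw [h1]
    rw [lintegral_const_mul' _ _ (by simp)]
    exact ENNReal.mul_lt_top (by simp) (hfin k l)

theorem lintegral_momentumWeight_lt_top {d : ℕ} (hd : 1 ≤ d)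
    {H : Fin d → ℝ} (hH : ∀ i, H i < 1) {h a α : ℝ} (hsum : 2 * h + ∑ i, H i = a + d)
    (ha : a < 1) (hα : 1 - a < α) (hα' : α < 1 / 4) :
    ∫⁻ x : EuclideanSpace ℝ (Fin d), ∫⁻ y : EuclideanSpace ℝ (Fin d), ENNReal.ofReal
      (momentumWeight H h x * momentumWeight H h y * (1 + ‖x - y‖ ^ 2) ^ (-(2 * α))) < ⊤ := by
  have : Nonempty (Fin d) := ⟨⟨0, hd⟩⟩
  rcases le_or_gt (1 / 2) h with hh | hh
  · have hs : ∑ i, (2 - 2 * H i) = 4 * h - 2 * a := by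
      rw [Finset.sum_sub_distrib, ← Finset.mul_sum, Finset.sum_const, Finset.card_univ,
        Fintype.card_fin, nsmul_eq_mul]; linarith
    have hpos : 0 < 4 * h - 2 * a := by
      rw [← hs]; exact Finset.sum_pos (fun i _ => by linarith [hH i]) Finset.univ_nonempty
    have hθ0 : 0 ≤ (4 * h - 2) / (4 * h - 2 * a) := div_nonneg (by linarith) hpos.le
    have hθ1 : (4 * h - 2) / (4 * h - 2 * a) < 1 := by rw [div_lt_one hpos]; linarith
    -- The isotropic factor decays, so one product is enough: the power 4h - 2 is shared
    -- proportionally to 2 - 2Hᵢ. These numbers sum to 4h - 2a > 4h - 2, which keeps each share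
    -- strictly below 2 - 2Hᵢ.
    refine lintegral_momentumWeight_lt_top_of_cover (K := Unit) hH hsum ha hα hα' (B := 1)
      (fun _ i => (4 * h - 2) / (4 * h - 2 * a) * (2 - 2 * H i)) (fun _ i => ?_) (fun _ => ?_)
      fun η => ?_
    · have := hH i
      nlinarith
    · rw [← Finset.mul_sum, hs]; field_simp
    · simp only [Finset.univ_unique, Finset.sum_singleton, one_mul]
      calc (1 + ‖η‖) ^ (2 - 4 * h) =
          (1 + ‖η‖) ^ (∑ i, -((4 * h - 2) / (4 * h - 2 * a) * (2 - 2 * H i))) := by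
            congr 1
            rw [Finset.sum_neg_distrib, ← Finset.mul_sum, hs]; field_simp; ring
        _ = ∏ i, (1 + ‖η‖) ^ (-((4 * h - 2) / (4 * h - 2 * a) * (2 - 2 * H i))) := by
            rw [Real.rpow_sum_of_pos (by positivity)]
        _ ≤ _ := by
            refine Finset.prod_le_prod (fun _ _ => by positivity) fun i _ => ?_
            refine Real.rpow_le_rpow_of_nonpos (by positivity) ?_ ?_
            · linarith [abs_apply_le_norm η i]
            · have := hH i
              have : 0 ≤ (4 * h - 2) / (4 * h - 2 * a) * (2 - 2 * H i) :=
                mul_nonneg hθ0 (by linarith)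
              linarith
  -- Now the isotropic factor grows. It is dominated by the growth in the largest coordinate, hence
  -- by a sum of terms each depending on a single coordinate.
  · refine lintegral_momentumWeight_lt_top_of_cover (K := Fin d) hH hsum ha hα hα'
      (B := (d : ℝ) ^ (2 - 4 * h))
      (fun k i => if i = k then 4 * h - 2 else 0) (fun k i => ?_) (fun k => ?_) fun η => ?_
    · have := hH i
      split_ifs <;> linarith
    · simp
    · obtain ⟨j, hj⟩ := Finite.exists_max fun i => |η i|
      have h1 : 1 + ‖η‖ ≤ d * (1 + |η j|) := by
        have := norm_le_sum_abs η
        have h2 : ∑ i, |η i| ≤ d * |η j| := by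
          refine (Finset.sum_le_card_nsmul _ _ _ fun i _ => hj i).trans ?_
          simp
        have : (1 : ℝ) ≤ d := by exact_mod_cast hd
        linarith
      calc (1 + ‖η‖) ^ (2 - 4 * h) ≤ (d * (1 + |η j|)) ^ (2 - 4 * h) :=
            Real.rpow_le_rpow (by positivity) h1 (by linarith)
        _ = (d : ℝ) ^ (2 - 4 * h) * (1 + |η j|) ^ (2 - 4 * h) := by
            rw [Real.mul_rpow (by positivity) (by positivity)]
        _ ≤ _ := by
            gcongr
            refine le_trans (le_of_eq ?_) (Finset.single_le_sum
              (f := fun k => ∏ i, (1 + |η i|) ^ (-(if i = k then 4 * h - 2 else 0)))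
              (fun k _ => by positivity) (Finset.mem_univ j))
            rw [Finset.prod_eq_single j]
            · simp
            · intro i _ hi
              simp [hi]
            · simp

/-! ### Integration over the time frequency, concentrated near |ξ| = |η|². -/

/-- Peetre's inequality: 1 + x ≤ (1 + A)(1 + |x - A|), read with x and A exchanged when the exponent
is negative. -/
theorem one_add_rpow_le_peetre {x A : ℝ} (hx : 0 ≤ x) (hA : 0 ≤ A) (κ : ℝ) :
    (1 + x) ^ κ ≤ (1 + A) ^ κ * (1 + |x - A|) ^ |κ| := by
  have hv := abs_nonneg (x - A)
  rcases le_total 0 κ with h | h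
  · rw [abs_of_nonneg h, ← Real.mul_rpow (by positivity) (by positivity)]
    refine Real.rpow_le_rpow (by positivity) ?_ h
    have := le_abs_self (x - A)
    nlinarith
  · rw [abs_of_nonpos h]
    have h1 : (1 + A) ^ (-κ) ≤ (1 + x) ^ (-κ) * (1 + |x - A|) ^ (-κ) := by
      rw [← Real.mul_rpow (by positivity) (by positivity)]
      refine Real.rpow_le_rpow (by positivity) ?_ (by linarith)
      have := neg_abs_le (x - A)
      nlinarith
    rw [Real.rpow_neg (by positivity), Real.rpow_neg (by positivity)] at h1
    have hA' : 0 < (1 + A) ^ κ := by positivity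
    have hx' : 0 < (1 + x) ^ κ := by positivity
    rw [inv_mul_eq_div, le_div_iff₀ hx', inv_mul_le_iff₀ hA'] at h1
    exact h1

theorem rpow_le_two_mul_add {x κ : ℝ} (hx : 0 ≤ x) (hκ : |κ| ≤ 1) :
    x ^ κ ≤ 2 * (1 + x) ^ κ + (if x ≤ 1 then x ^ κ else 0) := by
  split_ifs with h
  · have : 0 ≤ (1 + x) ^ κ := by positivity
    linarith
  · push Not at h
    have e : x = (x / (1 + x)) * (1 + x) := by field_simp
    have h1 : 1 / 2 ≤ x / (1 + x) := by rw [le_div_iff₀ (by positivity)]; linarith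
    have h2 : x / (1 + x) ≤ 2 := by rw [div_le_iff₀ (by positivity)]; linarith
    have h3 := rpow_le_two_rpow_abs h1 h2 κ
    have h4 : (2 : ℝ) ^ |κ| ≤ 2 := by
      calc (2 : ℝ) ^ |κ| ≤ 2 ^ (1 : ℝ) := Real.rpow_le_rpow_of_exponent_le (by norm_num) hκ
        _ = 2 := Real.rpow_one 2
    nth_rw 1 [e]
    rw [Real.mul_rpow (by positivity) (by positivity), add_zero]
    gcongr
    linarith

theorem one_add_abs_sq_le (v : ℝ) : (1 + |v|) ^ 2 / 2 ≤ 1 + v ^ 2 := by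
  rw [← sq_abs v]; nlinarith [sq_nonneg (1 - |v|)]

/-- Peetre's inequality moves all weights from x to A at the price of powers of 1 + |x - A|, which
the quadratic denominator absorbs. Only the singularity of x ^ κ at 0 escapes; for x ≤ 1 the
denominator is of order (1 + A)², and (1 + A)^(-2) is at most a constant times (1 + A)^κ because κ ≥
-1. -/
theorem resonance_integrand_le {κ ε x A : ℝ} (hκ : |κ| ≤ 1) (hε0 : 0 ≤ ε) (hε : ε ≤ 1)
    (hx : 0 ≤ x) (hA : 0 ≤ A) :
    x ^ κ * (1 + x + A) ^ ε / (1 + (A - x) ^ 2) ≤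
      (1 + A) ^ (κ + ε) * (8 * (1 + |x - A|) ^ (-(2 - |κ| - ε)) +
        16 * (if x ≤ 1 then x ^ κ else 0)) := by
  have hv := abs_nonneg (x - A)
  set v := |x - A| with hvd
  have h1 := one_add_abs_sq_le (x - A)
  rw [← hvd, show (x - A) ^ 2 = (A - x) ^ 2 by ring] at h1
  have hD : 0 < 1 + (A - x) ^ 2 := by positivity
  have hρ : (1 + x + A) ^ ε ≤ 2 * ((1 + A) ^ ε * (1 + v) ^ ε) := by
    have h2 : (2 : ℝ) ^ ε ≤ 2 := by
      calc (2 : ℝ) ^ ε ≤ 2 ^ (1 : ℝ) := Real.rpow_le_rpow_of_exponent_le (by norm_num) hε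
        _ = 2 := Real.rpow_one 2
    calc (1 + x + A) ^ ε ≤ (2 * ((1 + A) * (1 + v))) ^ ε := by
          refine Real.rpow_le_rpow (by positivity) ?_ hε0
          have := le_abs_self (x - A)
          nlinarith
      _ = 2 ^ ε * ((1 + A) ^ ε * (1 + v) ^ ε) := by
          rw [Real.mul_rpow (by norm_num) (by positivity),
            Real.mul_rpow (by positivity) (by positivity)]
      _ ≤ _ := by gcongr
  rw [div_le_iff₀ hD]
  have hx1 := rpow_le_two_mul_add hx hκ
  have hp := one_add_rpow_le_peetre hx hA κ
  rw [← hvd] at hp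
  have hvpow : (1 + v) ^ (-(2 - |κ| - ε)) * (1 + v) ^ 2 = (1 + v) ^ |κ| * (1 + v) ^ ε := by
    rw [← Real.rpow_natCast, ← Real.rpow_add (by positivity), ← Real.rpow_add (by positivity)]
    congr 1; push_cast; ring
  have hApow : (1 + A) ^ (κ + ε) = (1 + A) ^ κ * (1 + A) ^ ε := Real.rpow_add (by positivity) _ _
  have hfirst : 2 * (1 + x) ^ κ * (1 + x + A) ^ ε ≤
      (1 + A) ^ (κ + ε) * (8 * (1 + v) ^ (-(2 - |κ| - ε))) * (1 + (A - x) ^ 2) := by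
    calc 2 * (1 + x) ^ κ * (1 + x + A) ^ ε
        ≤ 2 * ((1 + A) ^ κ * (1 + v) ^ |κ|) * (2 * ((1 + A) ^ ε * (1 + v) ^ ε)) := by gcongr
      _ = (1 + A) ^ (κ + ε) * 4 * ((1 + v) ^ |κ| * (1 + v) ^ ε) := by rw [hApow]; ring
      _ = (1 + A) ^ (κ + ε) * (8 * (1 + v) ^ (-(2 - |κ| - ε))) * ((1 + v) ^ 2 / 2) := by
          rw [← hvpow]; ring
      _ ≤ _ := by gcongr
  have hsecond : (if x ≤ 1 then x ^ κ else 0) * (1 + x + A) ^ ε ≤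
      (1 + A) ^ (κ + ε) * (16 * (if x ≤ 1 then x ^ κ else 0)) * (1 + (A - x) ^ 2) := by
    split_ifs with hx'
    · have hA2 : 1 + A ≤ 2 * (1 + v) := by
        have := neg_abs_le (x - A)
        nlinarith
      have h3 : (1 + x + A) ^ ε ≤ 2 * (1 + A) ^ ε := by
        have h2 : (2 : ℝ) ^ ε ≤ 2 := by
          calc (2 : ℝ) ^ ε ≤ 2 ^ (1 : ℝ) := Real.rpow_le_rpow_of_exponent_le (by norm_num) hε
            _ = 2 := Real.rpow_one 2
        calc (1 + x + A) ^ ε ≤ (2 * (1 + A)) ^ ε :=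
              Real.rpow_le_rpow (by positivity) (by linarith) hε0
          _ = 2 ^ ε * (1 + A) ^ ε := Real.mul_rpow (by norm_num) (by positivity)
          _ ≤ _ := by gcongr
      have h4 : 1 ≤ (1 + A) ^ κ * (8 * (1 + (A - x) ^ 2)) := by
        have h5 : (1 + A) ^ (2 : ℕ) ≤ 8 * (1 + (A - x) ^ 2) := by nlinarith
        have h6 : 1 ≤ (1 + A) ^ κ * (1 + A) ^ (2 : ℕ) := by
          rw [← Real.rpow_natCast, ← Real.rpow_add (by positivity)]
          refine Real.one_le_rpow (by linarith) ?_
          have := neg_abs_le κ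
          push_cast; linarith
        refine h6.trans ?_
        gcongr
      have hxk : 0 ≤ x ^ κ := by positivity
      calc x ^ κ * (1 + x + A) ^ ε ≤ x ^ κ * (2 * (1 + A) ^ ε) := by gcongr
        _ = x ^ κ * (2 * (1 + A) ^ ε) * 1 := by ring
        _ ≤ x ^ κ * (2 * (1 + A) ^ ε) * ((1 + A) ^ κ * (8 * (1 + (A - x) ^ 2))) := by gcongr
        _ = _ := by rw [hApow]; ring
    · simp
  have hρ0 : 0 ≤ (1 + x + A) ^ ε := by positivity
  calc x ^ κ * (1 + x + A) ^ ε
      ≤ (2 * (1 + x) ^ κ + (if x ≤ 1 then x ^ κ else 0)) * (1 + x + A) ^ ε := by gcongr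
    _ = 2 * (1 + x) ^ κ * (1 + x + A) ^ ε + (if x ≤ 1 then x ^ κ else 0) * (1 + x + A) ^ ε := by
        ring
    _ ≤ _ := add_le_add hfirst hsecond
    _ = _ := by ring

/-- The condition on κ and ε leaves a bump around ±A with exponent 2 - |κ| - ε > 1, whose integral
does not depend on A by translation invariance. -/
theorem exists_lintegral_resonance_le {κ ε : ℝ} (hκ : -1 < κ) (hε0 : 0 ≤ ε) (hε : |κ| + ε < 1) :
    ∃ C : ℝ≥0∞, C < ⊤ ∧ ∀ A : ℝ, 0 ≤ A →
      ∫⁻ ξ : ℝ, ENNReal.ofReal (|ξ| ^ κ * (1 + |ξ| + A) ^ ε / (1 + (A - |ξ|) ^ 2)) ≤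
        ENNReal.ofReal ((1 + A) ^ (κ + ε)) * C := by
  set q := 2 - |κ| - ε with hq
  set I := ∫⁻ v : ℝ, ENNReal.ofReal ((1 + |v|) ^ (-q)) with hI
  set S := ∫⁻ v : ℝ, ENNReal.ofReal (if |v| ≤ 1 then |v| ^ κ else 0) with hS
  have hIt : I < ⊤ := by
    have := lintegral_abs_rpow_mul_lt_top (s := 0) (e := q) (by norm_num) (by linarith)
    simpa using this
  have hSt : S < ⊤ := by
    have h := lintegral_ball_rpow_lt_top hκ 1
    rw [← lintegral_indicator (measurableSet_le (by fun_prop) (by fun_prop))] at h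
    refine lt_of_le_of_lt (lintegral_mono fun v => ?_) h
    by_cases hv : |v| ≤ 1 <;> simp [hv]
  refine ⟨8 * (I + I) + 16 * S, ?_, fun A hA => ?_⟩
  · exact ENNReal.add_lt_top.mpr ⟨ENNReal.mul_lt_top (by simp) (ENNReal.add_lt_top.mpr ⟨hIt, hIt⟩),
      ENNReal.mul_lt_top (by simp) hSt⟩
  have hI1 : ∫⁻ ξ : ℝ, ENNReal.ofReal ((1 + |ξ - A|) ^ (-q)) = I :=
    lintegral_sub_right_eq_self (fun v : ℝ => ENNReal.ofReal ((1 + |v|) ^ (-q))) A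
  have hI2 : ∫⁻ ξ : ℝ, ENNReal.ofReal ((1 + |ξ + A|) ^ (-q)) = I :=
    lintegral_add_right_eq_self (fun v : ℝ => ENNReal.ofReal ((1 + |v|) ^ (-q))) A
  have hms : Measurable fun v : ℝ => ENNReal.ofReal (if |v| ≤ 1 then |v| ^ κ else 0) :=
    (Measurable.ite (measurableSet_le (by fun_prop) (by fun_prop)) (by fun_prop)
      measurable_const).ennreal_ofReal
  calc ∫⁻ ξ : ℝ, ENNReal.ofReal (|ξ| ^ κ * (1 + |ξ| + A) ^ ε / (1 + (A - |ξ|) ^ 2))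
      ≤ ∫⁻ ξ : ℝ, ENNReal.ofReal ((1 + A) ^ (κ + ε)) *
        (8 * (ENNReal.ofReal ((1 + |ξ - A|) ^ (-q)) + ENNReal.ofReal ((1 + |ξ + A|) ^ (-q))) +
          16 * ENNReal.ofReal (if |ξ| ≤ 1 then |ξ| ^ κ else 0)) := by
        refine lintegral_mono fun ξ => ?_
        refine (ENNReal.ofReal_le_ofReal (resonance_integrand_le (by linarith) hε0
          (by linarith [abs_nonneg κ]) (abs_nonneg ξ) hA)).trans ?_
        have hif : 0 ≤ (if |ξ| ≤ 1 then |ξ| ^ κ else 0) := by split_ifs <;> positivity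
        rw [ENNReal.ofReal_mul (by positivity), ENNReal.ofReal_add (by positivity) (by positivity),
          ENNReal.ofReal_mul (by norm_num), ENNReal.ofReal_mul (by norm_num)]
        norm_num
        gcongr
        rw [show ε - (2 - |κ|) = -q by rw [hq]; ring]
        rcases abs_cases ξ with ⟨h, _⟩ | ⟨h, _⟩
        · rw [h]; exact le_self_add
        · rw [h, show -ξ - A = -(ξ + A) by ring, abs_neg]; exact le_add_self
    _ = _ := by
        rw [lintegral_const_mul _ (by fun_prop), lintegral_add_left (by fun_prop),
          lintegral_const_mul _ (by fun_prop), lintegral_add_left (by fun_prop),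
          lintegral_const_mul _ hms, hI1, hI2]

/-- The spectral weight times the resonance factor bounding `|γ_t| ^ 2`. -/
noncomputable def resonantWeight {d : ℕ} (H : Fin (d + 1) → ℝ)
    (z : ℝ × EuclideanSpace ℝ (Fin d)) : ℝ :=
  spectralWeight H z / (1 + (‖z.2‖ ^ 2 - |z.1|) ^ 2)

/-- The parabolic size of a space-time frequency. -/
noncomputable def parabolicSize {d : ℕ} (z : ℝ × EuclideanSpace ℝ (Fin d)) : ℝ :=
  1 + |z.1| + ‖z.2‖ ^ 2

theorem spectralWeight_nonneg {d : ℕ} (H : Fin (d + 1) → ℝ)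
    (z : ℝ × EuclideanSpace ℝ (Fin d)) : 0 ≤ spectralWeight H z := by
  unfold spectralWeight; positivity

theorem resonantWeight_nonneg {d : ℕ} (H : Fin (d + 1) → ℝ)
    (z : ℝ × EuclideanSpace ℝ (Fin d)) : 0 ≤ resonantWeight H z := by
  have := spectralWeight_nonneg H z
  unfold resonantWeight; positivity

theorem parabolicSize_pos {d : ℕ} (z : ℝ × EuclideanSpace ℝ (Fin d)) : 0 < parabolicSize z := by
  unfold parabolicSize; positivity

@[fun_prop]
theorem measurable_spectralWeight {d : ℕ} (H : Fin (d + 1) → ℝ) :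
    Measurable (spectralWeight H) := by
  unfold spectralWeight; fun_prop

@[fun_prop]
theorem measurable_resonantWeight {d : ℕ} (H : Fin (d + 1) → ℝ) :
    Measurable (resonantWeight H) := by
  unfold resonantWeight; fun_prop

@[fun_prop]
theorem measurable_parabolicSize {d : ℕ} : Measurable (parabolicSize (d := d)) := by
  unfold parabolicSize; fun_prop

/-- With A = ‖η‖² the resonance integral is of size (1 + ‖η‖)^(2(1 - 2H₀ + ε)). The spare power of
the frequency therefore only shifts H₀ to H₀ - ε/2. -/
theorem exists_lintegral_resonantWeight_le {d : ℕ} {H : Fin (d + 1) → ℝ}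
    (hH : H 0 < 1) {ε : ℝ} (hε0 : 0 ≤ ε) (hε : |1 - 2 * H 0| + ε < 1) :
    ∃ C : ℝ≥0∞, C < ⊤ ∧ ∀ η : EuclideanSpace ℝ (Fin d),
      ∫⁻ ξ : ℝ, ENNReal.ofReal (resonantWeight H (ξ, η) * parabolicSize (ξ, η) ^ ε) ≤
        ENNReal.ofReal (momentumWeight (fun i => H i.succ) (H 0 - ε / 2) η) * C := by
  obtain ⟨C, hC, hle⟩ := exists_lintegral_resonance_le (κ := 1 - 2 * H 0) (ε := ε)
    (by linarith) hε0 hε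
  refine ⟨ENNReal.ofReal (2 ^ |1 - 2 * H 0 + ε|) * C, ENNReal.mul_lt_top (by simp) hC, fun η => ?_⟩
  set p := ∏ i : Fin d, |η i| ^ (1 - 2 * H i.succ) with hp
  have hp0 : 0 ≤ p := by positivity
  have h1 : ∀ ξ : ℝ, ENNReal.ofReal (resonantWeight H (ξ, η) * parabolicSize (ξ, η) ^ ε) =
      ENNReal.ofReal p * ENNReal.ofReal (|ξ| ^ (1 - 2 * H 0) * (1 + |ξ| + ‖η‖ ^ 2) ^ ε /
        (1 + (‖η‖ ^ 2 - |ξ|) ^ 2)) := by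
    intro ξ
    rw [← ENNReal.ofReal_mul hp0]
    congr 1
    have e : ∀ (x s : ℝ), 0 ≤ x → 1 / x ^ (2 * s - 1) = x ^ (1 - 2 * s) := fun x s hx => by
      rw [one_div, ← Real.rpow_neg hx]; congr 1; ring
    simp only [resonantWeight, spectralWeight, parabolicSize, e _ _ (abs_nonneg _), hp]
    ring
  simp_rw [h1]
  rw [lintegral_const_mul' _ _ (by simp)]
  refine (mul_le_mul_right (hle _ (by positivity)) _).trans ?_
  rw [← mul_assoc, ← mul_assoc, ← ENNReal.ofReal_mul hp0,
    ← ENNReal.ofReal_mul (momentumWeight_nonneg _ _ _)]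
  refine mul_le_mul_left (ENNReal.ofReal_le_ofReal ?_) _
  unfold momentumWeight
  rw [mul_assoc]
  refine mul_le_mul_of_nonneg_left ?_ hp0
  set σ := 1 - 2 * H 0 + ε
  have h2 : 2 - 4 * (H 0 - ε / 2) = 2 * σ := by simp only [σ]; ring
  have hr := norm_nonneg η
  have e1 : 1 + ‖η‖ ^ 2 = ((1 + ‖η‖ ^ 2) / (1 + ‖η‖) ^ 2) * (1 + ‖η‖) ^ 2 := by field_simp
  have h3 : 1 / 2 ≤ (1 + ‖η‖ ^ 2) / (1 + ‖η‖) ^ 2 := by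
    rw [le_div_iff₀ (by positivity)]; nlinarith [sq_nonneg (1 - ‖η‖)]
  have h4 : (1 + ‖η‖ ^ 2) / (1 + ‖η‖) ^ 2 ≤ 2 := by
    rw [div_le_iff₀ (by positivity)]; nlinarith
  have h5 := rpow_le_two_rpow_abs h3 h4 σ
  rw [h2, e1, Real.mul_rpow (by positivity) (by positivity), mul_comm]
  rw [← Real.rpow_natCast (1 + ‖η‖) 2, ← Real.rpow_mul (by positivity)]
  push_cast
  gcongr
  simp only [Real.rpow_two]
  exact h5

/-- The shift by ε/2 raises the critical exponent from θ to θ + ε, so any ε < α - θ is admissible.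
The spare power `parabolicSize ^ ε` is later the source of all decay in the truncation level. -/
theorem exists_lintegral_energy_lt_top {d : ℕ} (hd : 1 ≤ d) {H : Fin (d + 1) → ℝ}
    (hH : ∀ j, H j ∈ Set.Ioo (0 : ℝ) 1) (hup : 2 * H 0 + ∑ i : Fin d, H i.succ ≤ (d : ℝ) + 1)
    {α : ℝ} (hα : (d : ℝ) + 1 - (2 * H 0 + ∑ i : Fin d, H i.succ) < α) (hα' : α < 1 / 4) :
    ∃ ε : ℝ, 0 < ε ∧ ∫⁻ z : ℝ × EuclideanSpace ℝ (Fin d), ∫⁻ w : ℝ × EuclideanSpace ℝ (Fin d),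
      ENNReal.ofReal ((resonantWeight H z * parabolicSize z ^ ε) *
        (resonantWeight H w * parabolicSize w ^ ε) * (1 + ‖z.2 - w.2‖ ^ 2) ^ (-(2 * α))) < ⊤ := by
  set θ := (d : ℝ) + 1 - (2 * H 0 + ∑ i : Fin d, H i.succ) with hθ
  have hθ0 : 0 ≤ θ := by linarith
  have hκ : |1 - 2 * H 0| < 1 := by
    rw [abs_lt]; constructor <;> linarith [(hH 0).1, (hH 0).2]
  obtain ⟨ε, hε0, hε1, hε2⟩ : ∃ ε : ℝ, 0 < ε ∧ ε < α - θ ∧ |1 - 2 * H 0| + ε < 1 := by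
    obtain ⟨ε, h1, h2⟩ := exists_between (show 0 < min (α - θ) (1 - |1 - 2 * H 0|) from
      lt_min (by linarith) (by linarith))
    exact ⟨ε, h1, h2.trans_le (min_le_left _ _), by linarith [min_le_right (α - θ) (1 - |1 - 2 * H 0|)]⟩
  refine ⟨ε, hε0, ?_⟩
  obtain ⟨C, hC, hle⟩ := exists_lintegral_resonantWeight_le (hH 0).2 hε0.le hε2
  have hmain := lintegral_momentumWeight_lt_top hd (H := fun i => H i.succ)
    (fun i => (hH i.succ).2) (h := H 0 - ε / 2) (a := 1 - θ - ε) (α := α) (by rw [hθ]; ring)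
    (by linarith) (by linarith) hα'
  set F : ℝ × EuclideanSpace ℝ (Fin d) → ℝ≥0∞ := fun z =>
    ENNReal.ofReal (resonantWeight H z * parabolicSize z ^ ε) with hF
  set K : EuclideanSpace ℝ (Fin d) → EuclideanSpace ℝ (Fin d) → ℝ≥0∞ := fun η η' =>
    ENNReal.ofReal ((1 + ‖η - η'‖ ^ 2) ^ (-(2 * α))) with hK
  have hFm : Measurable F := by simp only [hF]; fun_prop
  have hKm : Measurable fun z : EuclideanSpace ℝ (Fin d) × EuclideanSpace ℝ (Fin d) =>
    K z.1 z.2 := by simp only [hK]; fun_prop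
  have hsplit : ∀ z w : ℝ × EuclideanSpace ℝ (Fin d),
      ENNReal.ofReal ((resonantWeight H z * parabolicSize z ^ ε) *
        (resonantWeight H w * parabolicSize w ^ ε) * (1 + ‖z.2 - w.2‖ ^ 2) ^ (-(2 * α))) =
      F z * (F w * K z.2 w.2) := by
    intro z w
    have h1 := mul_nonneg (resonantWeight_nonneg H z)
      (Real.rpow_nonneg (parabolicSize_pos z).le ε)
    have h2 := mul_nonneg (resonantWeight_nonneg H w)
      (Real.rpow_nonneg (parabolicSize_pos w).le ε)
    simp only [hF, hK]
    rw [← ENNReal.ofReal_mul h2, ← ENNReal.ofReal_mul h1, mul_assoc]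
  simp_rw [hsplit]
  set f : EuclideanSpace ℝ (Fin d) → ℝ≥0∞ := fun η => ∫⁻ ξ : ℝ, F (ξ, η) with hf
  have hfm : Measurable f := hFm.lintegral_prod_left'
  have hinner : ∀ z : ℝ × EuclideanSpace ℝ (Fin d),
      ∫⁻ w : ℝ × EuclideanSpace ℝ (Fin d), F z * (F w * K z.2 w.2) =
      F z * ∫⁻ η', f η' * K z.2 η' := by
    intro z
    rw [lintegral_const_mul _ (by fun_prop), Measure.volume_eq_prod, lintegral_prod_symm _ (by fun_prop)]
    congr 1
    refine lintegral_congr fun η' => ?_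
    dsimp only
    rw [lintegral_mul_const _ (by fun_prop)]
  simp_rw [hinner]
  have hgm : Measurable fun η => ∫⁻ η', f η' * K η η' :=
    Measurable.lintegral_prod_right' (f := fun z : EuclideanSpace ℝ (Fin d) ×
      EuclideanSpace ℝ (Fin d) => f z.2 * K z.1 z.2) (by fun_prop)
  rw [Measure.volume_eq_prod, lintegral_prod_symm _ (by fun_prop)]
  dsimp only
  have houter : ∀ η, ∫⁻ ξ : ℝ, F (ξ, η) * ∫⁻ η', f η' * K η η' = f η * ∫⁻ η', f η' * K η η' :=
    fun η => lintegral_mul_const _ (by fun_prop)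
  simp_rw [houter]
  set m : EuclideanSpace ℝ (Fin d) → ℝ≥0∞ := fun η =>
    ENNReal.ofReal (momentumWeight (fun i => H i.succ) (H 0 - ε / 2) η) with hm
  have hfle : ∀ η, f η ≤ C * m η := fun η => by rw [mul_comm]; exact hle η
  have hsm : ∀ η, ∫⁻ η', ENNReal.ofReal (momentumWeight (fun i => H i.succ) (H 0 - ε / 2) η *
        momentumWeight (fun i => H i.succ) (H 0 - ε / 2) η' * (1 + ‖η - η'‖ ^ 2) ^ (-(2 * α))) =
      m η * ∫⁻ η', m η' * K η η' := by
    intro η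
    rw [← lintegral_const_mul' _ _ (by simp [hm])]
    refine lintegral_congr fun η' => ?_
    simp only [hm, hK]
    rw [mul_assoc, ENNReal.ofReal_mul (momentumWeight_nonneg _ _ _),
      ENNReal.ofReal_mul (momentumWeight_nonneg _ _ _)]
  calc ∫⁻ η, f η * ∫⁻ η', f η' * K η η'
      ≤ ∫⁻ η, C * m η * ∫⁻ η', C * (m η' * K η η') := by
        refine lintegral_mono fun η => mul_le_mul' (hfle η) (lintegral_mono fun η' => ?_)
        rw [← mul_assoc]
        exact mul_le_mul_left (hfle η') _
    _ = C * C * ∫⁻ η, ∫⁻ η', ENNReal.ofReal (momentumWeight (fun i => H i.succ) (H 0 - ε / 2) η *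
        momentumWeight (fun i => H i.succ) (H 0 - ε / 2) η' *
          (1 + ‖η - η'‖ ^ 2) ^ (-(2 * α))) := by
        rw [← lintegral_const_mul' _ _ (ENNReal.mul_ne_top hC.ne hC.ne)]
        refine lintegral_congr fun η => ?_
        rw [lintegral_const_mul' _ _ hC.ne, hsm η]
        ring
    _ < ⊤ := ENNReal.mul_lt_top (ENNReal.mul_lt_top hC hC) hmain

/-! ### Moments of Gaussian quadratic forms. -/

section

theorem lintegral_pow_le_lintegral_pow {Ω : Type*} [MeasurableSpace Ω] (P : Measure Ω)
    [IsProbabilityMeasure P] {g : Ω → ℝ≥0∞} (hg : AEMeasurable g P) {m : ℕ} (hm : m ≠ 0) :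
    (∫⁻ ω, g ω ∂P) ^ m ≤ ∫⁻ ω, g ω ^ m ∂P := by
  have hm' : (0 : ℝ) < m := by positivity
  have hm1 : (1 : ℝ) ≤ m := by exact_mod_cast Nat.one_le_iff_ne_zero.mpr hm
  have h := ENNReal.lintegral_prod_norm_pow_le (μ := P) (Finset.univ : Finset (Fin 2))
    (f := ![fun ω => g ω ^ m, fun _ => 1]) (p := ![1 / (m : ℝ), 1 - 1 / m])
    (by intro i _; fin_cases i <;> simp; fun_prop) (by simp)
    (by
      intro i _
      fin_cases i
      · simp
      · simp only [Fin.mk_one, Matrix.cons_val_one, Matrix.cons_val_fin_one, sub_nonneg]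
        rw [div_le_one hm']; exact hm1)
  simp only [Fin.prod_univ_two, Matrix.cons_val_zero, Matrix.cons_val_one,
    Matrix.cons_val_fin_one, ENNReal.one_rpow, mul_one, lintegral_one, measure_univ] at h
  have h1 : ∀ x : ℝ≥0∞, (x ^ m) ^ (1 / (m : ℝ)) = x := fun x => by
    rw [← ENNReal.rpow_natCast, ← ENNReal.rpow_mul, mul_one_div_cancel hm'.ne', ENNReal.rpow_one]
  simp_rw [h1] at h
  calc (∫⁻ ω, g ω ∂P) ^ m ≤ ((∫⁻ ω, g ω ^ m ∂P) ^ (1 / (m : ℝ))) ^ m := by gcongr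
    _ = _ := by
      rw [← ENNReal.rpow_natCast, ← ENNReal.rpow_mul, one_div_mul_cancel hm'.ne', ENNReal.rpow_one]

/-- Minkowski's integral inequality for a natural exponent. -/
theorem lintegral_lintegral_pow_le {X Ω : Type*} [MeasurableSpace X] [MeasurableSpace Ω]
    (μ : Measure X) [SigmaFinite μ] (P : Measure Ω) [SFinite P] {f : Ω → X → ℝ≥0∞}
    (hf : Measurable (Function.uncurry f)) {m : ℕ} (hm : m ≠ 0) :
    ∫⁻ ω, (∫⁻ x, f ω x ∂μ) ^ m ∂P ≤ (∫⁻ x, (∫⁻ ω, f ω x ^ m ∂P) ^ (1 / (m : ℝ)) ∂μ) ^ m := by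
  have hm' : (0 : ℝ) < m := by positivity
  have h1 : ∀ x : ℝ≥0∞, (x ^ m) ^ (1 / (m : ℝ)) = x := fun x => by
    rw [← ENNReal.rpow_natCast, ← ENNReal.rpow_mul, mul_one_div_cancel hm'.ne', ENNReal.rpow_one]
  have hfω : ∀ ω, Measurable (f ω) := fun ω => hf.comp measurable_prodMk_left
  have hfx : ∀ x, Measurable fun ω => f ω x := fun x => hf.comp measurable_prodMk_right
  -- The m-th power becomes an integral over m independent copies of the variable. After exchanging
  -- the integrals, Hölder's inequality in ω with m equal exponents concludes.
  have e1 : ∀ ω, (∫⁻ x, f ω x ∂μ) ^ m =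
      ∫⁻ y, ∏ i, f ω (y i) ∂(Measure.pi fun _ : Fin m => μ) := by
    intro ω
    rw [lintegral_pi_prod μ m (fun _ => f ω) fun _ => hfω ω]
    simp
  have e2 : (∫⁻ x, (∫⁻ ω, f ω x ^ m ∂P) ^ (1 / (m : ℝ)) ∂μ) ^ m =
      ∫⁻ y, ∏ i, (∫⁻ ω, f ω (y i) ^ m ∂P) ^ (1 / (m : ℝ)) ∂(Measure.pi fun _ : Fin m => μ) := by
    rw [lintegral_pi_prod μ m (fun _ x => (∫⁻ ω, f ω x ^ m ∂P) ^ (1 / (m : ℝ))) fun _ =>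
      (Measurable.lintegral_prod_left' (f := fun z : Ω × X => f z.1 z.2 ^ m)
        (hf.pow_const m)).pow_const _]
    simp
  simp_rw [e1]
  have hmeas : Measurable fun z : Ω × (Fin m → X) => ∏ i, f z.1 (z.2 i) :=
    Finset.measurable_prod _ fun i _ => hf.comp (by fun_prop : Measurable
      fun z : Ω × (Fin m → X) => (z.1, z.2 i))
  rw [lintegral_lintegral_swap hmeas.aemeasurable, e2]
  refine lintegral_mono fun y => ?_
  have h := ENNReal.lintegral_prod_norm_pow_le (μ := P) (Finset.univ : Finset (Fin m))
    (f := fun i ω => f ω (y i) ^ m) (p := fun _ => 1 / (m : ℝ))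
    (fun i _ => ((hfx _).pow_const m).aemeasurable)
    (by simp [mul_inv_cancel₀ hm'.ne']) (fun i _ => by positivity)
  simpa only [h1] using h

/-- The absolute moment of order `2 m` of a standard Gaussian variable. -/
noncomputable def gaussianMoment (m : ℕ) : ℝ≥0∞ := ∫⁻ x, ‖x‖ₑ ^ (2 * m) ∂(gaussianReal 0 1)

theorem gaussianMoment_lt_top (m : ℕ) : gaussianMoment m < ⊤ := by
  have h := (memLp_id_gaussianReal (μ := 0) (v := 1) ((2 * m : ℕ) : ℝ≥0)).eLpNorm_lt_top
  rcases Nat.eq_zero_or_pos m with rfl | hm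
  · simp [gaussianMoment]
  · have h2 := eLpNorm_nnreal_pow_eq_lintegral (μ := gaussianReal 0 1) (f := (id : ℝ → ℝ))
      (p := ((2 * m : ℕ) : ℝ≥0)) (by simp; omega)
    have h3 : gaussianMoment m = ∫⁻ x, ‖(id x : ℝ)‖ₑ ^ ((((2 * m : ℕ) : ℝ≥0)) : ℝ)
        ∂(gaussianReal 0 1) := by
      unfold gaussianMoment
      refine lintegral_congr fun x => ?_
      rw [NNReal.coe_natCast, ENNReal.rpow_natCast]; rfl
    rw [h3, ← h2]
    exact ENNReal.rpow_lt_top_of_nonneg (by positivity) h.ne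

theorem lintegral_gaussianReal_pow (v : ℝ≥0) (m : ℕ) :
    ∫⁻ x, ‖x‖ₑ ^ (2 * m) ∂(gaussianReal 0 v) = gaussianMoment m * (v : ℝ≥0∞) ^ m := by
  have h := gaussianReal_map_const_mul (μ := 0) (v := 1) (NNReal.sqrt v : ℝ)
  have e : (NNReal.mk ((NNReal.sqrt v : ℝ) ^ 2) (sq_nonneg _)) * 1 = v := by
    ext; simp
  rw [e, mul_zero] at h
  rw [← h, lintegral_map (by fun_prop) (by fun_prop)]
  have h2 : ‖((NNReal.sqrt v : ℝ≥0) : ℝ)‖ₑ ^ (2 * m) = (v : ℝ≥0∞) ^ m := by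
    rw [pow_mul]
    congr 1
    rw [Real.enorm_eq_ofReal (by positivity), ENNReal.ofReal_coe_nnreal, ← ENNReal.coe_pow,
      NNReal.sq_sqrt]
  simp_rw [enorm_mul, mul_pow]
  rw [lintegral_const_mul _ (by fun_prop), h2, mul_comm]
  rfl

theorem gaussianMoment_one : gaussianMoment 1 = 1 := by
  have h := variance_id_gaussianReal (μ := 0) (v := 1)
  have h2 := (memLp_id_gaussianReal (μ := 0) (v := 1) 2)
  have h3 := evariance_eq_lintegral_ofReal (id : ℝ → ℝ) (gaussianReal 0 1)
  have h4 : ENNReal.ofReal (Var[id; gaussianReal 0 1]) = evariance id (gaussianReal 0 1) :=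
    (MemLp.ofReal_variance_eq (by simpa using h2))
  rw [h] at h4
  unfold gaussianMoment
  rw [h3] at h4
  simp only [id_eq, integral_id_gaussianReal, sub_zero] at h4
  simp only [NNReal.coe_one, ENNReal.ofReal_one] at h4
  rw [h4]
  refine lintegral_congr fun x => ?_
  rw [← sq_abs, ENNReal.ofReal_pow (abs_nonneg x), mul_one, ← Real.enorm_eq_ofReal_abs]

theorem lintegral_pow_eq_of_isGaussian {E : Type*} [NormedAddCommGroup E] [NormedSpace ℝ E]
    [MeasurableSpace E] [BorelSpace E] {μ : Measure E} [IsGaussian μ] (L : StrongDual ℝ E)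
    (h0 : ∫ x, L x ∂μ = 0) (m : ℕ) :
    ∫⁻ x, ‖L x‖ₑ ^ (2 * m) ∂μ = gaussianMoment m * (∫⁻ x, ‖L x‖ₑ ^ 2 ∂μ) ^ m := by
  have h := IsGaussian.map_eq_gaussianReal (μ := μ) L
  rw [h0] at h
  have h1 : ∀ n : ℕ, ∫⁻ x, ‖L x‖ₑ ^ n ∂μ = ∫⁻ x, ‖x‖ₑ ^ n ∂(μ.map L) := fun n =>
    (lintegral_map (f := fun x => ‖x‖ₑ ^ n) (g := L) (by fun_prop) L.continuous.measurable).symm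
  rw [h1, h1, h, lintegral_gaussianReal_pow]
  have h2 := lintegral_gaussianReal_pow (Var[L; μ]).toNNReal 1
  rw [gaussianMoment_one] at h2
  simp only [mul_one, one_mul, pow_one] at h2
  rw [h2]

section FiniteDimensional

variable {F : Type*} [Fintype F]

/-- The bilinear form `∑ cᵢ uᵢ vᵢ`. -/
noncomputable def diagBilin (c u v : F → ℝ) : ℝ := ∑ i, c i * (u i * v i)

theorem diagBilin_symm (c u v : F → ℝ) : diagBilin c u v = diagBilin c v u := by
  unfold diagBilin
  exact Finset.sum_congr rfl fun i _ => by ring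

/-- `v ↦ ∑ cᵢ uᵢ vᵢ` as a continuous linear form. -/
noncomputable def diagBilinCLM (c u : F → ℝ) : StrongDual ℝ (F → ℝ) :=
  ∑ i, (c i * u i) • ContinuousLinearMap.proj i

theorem diagBilinCLM_apply (c u v : F → ℝ) : diagBilinCLM c u v = diagBilin c u v := by
  simp [diagBilinCLM, diagBilin, mul_assoc]

theorem measurable_diagBilin (c : F → ℝ) :
    Measurable fun z : (F → ℝ) × (F → ℝ) => diagBilin c z.1 z.2 := by
  unfold diagBilin; fun_prop

variable {μ : Measure (F → ℝ)} [IsGaussian μ]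

/-- For fixed u the form is a centered Gaussian variable in v, so its moments are powers of its
variance. Minkowski's inequality exchanges the variables, and the same argument applies in u. -/
theorem lintegral_diagBilin_pow_le (h0 : ∀ L : StrongDual ℝ (F → ℝ), ∫ x, L x ∂μ = 0)
    (c : F → ℝ) {m : ℕ} (hm : m ≠ 0) :
    ∫⁻ u, ∫⁻ v, ‖diagBilin c u v‖ₑ ^ (2 * m) ∂μ ∂μ ≤
      gaussianMoment m ^ 2 * (∫⁻ u, ∫⁻ v, ‖diagBilin c u v‖ₑ ^ 2 ∂μ ∂μ) ^ m := by
  have hm' : (0 : ℝ) < m := by positivity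
  have h1 : ∀ x : ℝ≥0∞, (x ^ m) ^ (1 / (m : ℝ)) = x := fun x => by
    rw [← ENNReal.rpow_natCast, ← ENNReal.rpow_mul, mul_one_div_cancel hm'.ne', ENNReal.rpow_one]
  have e1 : ∀ u, ∫⁻ v, ‖diagBilin c u v‖ₑ ^ (2 * m) ∂μ =
      gaussianMoment m * (∫⁻ v, ‖diagBilin c u v‖ₑ ^ 2 ∂μ) ^ m := fun u => by
    simpa only [diagBilinCLM_apply] using
      lintegral_pow_eq_of_isGaussian (μ := μ) (diagBilinCLM c u) (h0 _) m
  have e2 : ∀ v, ∫⁻ u, ‖diagBilin c u v‖ₑ ^ (2 * m) ∂μ =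
      gaussianMoment m * (∫⁻ u, ‖diagBilin c u v‖ₑ ^ 2 ∂μ) ^ m := fun v => by
    simp_rw [diagBilin_symm c _ v]; exact e1 v
  have hmeas : Measurable fun z : (F → ℝ) × (F → ℝ) => ‖diagBilin c z.1 z.2‖ₑ ^ 2 :=
    (measurable_diagBilin c).enorm.pow_const 2
  simp_rw [e1]
  rw [lintegral_const_mul _ (hmeas.lintegral_prod_right'.pow_const m)]
  have hmink := lintegral_lintegral_pow_le μ μ (f := fun u v => ‖diagBilin c u v‖ₑ ^ 2) hmeas hm
  refine (mul_le_mul_right hmink _).trans (le_of_eq ?_)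
  simp_rw [← pow_mul, e2, ENNReal.mul_rpow_of_nonneg _ _ (one_div_nonneg.mpr hm'.le), h1]
  rw [lintegral_const_mul _ (hmeas.lintegral_prod_left'), mul_pow, ← ENNReal.rpow_natCast,
    ← ENNReal.rpow_mul, one_div_mul_cancel hm'.ne', ENNReal.rpow_one, sq, mul_assoc]
  congr 3
  exact (lintegral_lintegral_swap (f := fun u v => ‖diagBilin c u v‖ₑ ^ 2) hmeas.aemeasurable).symm

/-- The quadratic form `∑ cᵢ zᵢ ^ 2`. -/
noncomputable def diagQuad (c z : F → ℝ) : ℝ := diagBilin c z z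

theorem map_rotation_eq (h0 : ∀ L : StrongDual ℝ (F → ℝ), ∫ x, L x ∂μ = 0) :
    (μ.prod μ).map (ContinuousLinearMap.rotation (Real.pi / 4)) = μ.prod μ :=
  IsGaussian.map_rotation_eq_self_of_forall_strongDual_eq_zero h0 _

theorem sq_sub_sq_rotation (x y : F → ℝ) (i : F) :
    ((ContinuousLinearMap.rotation (Real.pi / 4) (x, y)).1 i) ^ 2 -
      ((ContinuousLinearMap.rotation (Real.pi / 4) (x, y)).2 i) ^ 2 = 2 * (x i * y i) := by
  have h2 : √2 ^ 2 = 2 := Real.sq_sqrt (by norm_num)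
  simp only [ContinuousLinearMap.rotation_apply, Pi.add_apply, Pi.smul_apply, smul_eq_mul,
    Real.cos_pi_div_four, Real.sin_pi_div_four]
  linear_combination (x i * y i) * h2

theorem diagQuad_sub_rotation (c x y : F → ℝ) :
    diagQuad c (ContinuousLinearMap.rotation (Real.pi / 4) (x, y)).1 -
      diagQuad c (ContinuousLinearMap.rotation (Real.pi / 4) (x, y)).2 = 2 * diagBilin c x y := by
  unfold diagQuad diagBilin
  rw [← Finset.sum_sub_distrib, Finset.mul_sum]
  refine Finset.sum_congr rfl fun i _ => ?_
  have := sq_sub_sq_rotation x y i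
  linear_combination c i * this

theorem measurable_diagQuad (c : F → ℝ) : Measurable (diagQuad c) := by
  unfold diagQuad diagBilin; fun_prop

/-- Decoupling. The product of two copies of a centered Gaussian law is invariant under the rotation
by π/4, and this rotation turns the difference of squares into twice a product. -/
theorem lintegral_diagQuad_sub_pow (h0 : ∀ L : StrongDual ℝ (F → ℝ), ∫ x, L x ∂μ = 0)
    (c : F → ℝ) (n : ℕ) :
    ∫⁻ u, ∫⁻ v, ‖diagQuad c u - diagQuad c v‖ₑ ^ n ∂μ ∂μ =
      2 ^ n * ∫⁻ u, ∫⁻ v, ‖diagBilin c u v‖ₑ ^ n ∂μ ∂μ := by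
  have hq := measurable_diagQuad c
  have hb := measurable_diagBilin c
  rw [← lintegral_prod (fun z : (F → ℝ) × (F → ℝ) => ‖diagQuad c z.1 - diagQuad c z.2‖ₑ ^ n)
    (by fun_prop), ← lintegral_prod (fun z : (F → ℝ) × (F → ℝ) => ‖diagBilin c z.1 z.2‖ₑ ^ n)
    (by fun_prop)]
  nth_rw 1 [← map_rotation_eq h0]
  rw [lintegral_map (by fun_prop) (by fun_prop), ← lintegral_const_mul _ (by fun_prop)]
  refine lintegral_congr fun z => ?_
  rw [show z = (z.1, z.2) from rfl, diagQuad_sub_rotation, enorm_mul, mul_pow]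
  congr 2
  rw [Real.enorm_eq_ofReal (by norm_num)]; simp

theorem memLp_apply (i : F) (p : ℝ≥0∞) (hp : p ≠ ⊤) : MemLp (fun x : F → ℝ => x i) p μ :=
  IsGaussian.memLp_dual μ (ContinuousLinearMap.proj i) p hp

theorem integrable_diagQuad (c : F → ℝ) : Integrable (diagQuad c) μ := by
  unfold diagQuad diagBilin
  refine integrable_finsetSum _ fun i _ => Integrable.const_mul ?_ _
  exact (memLp_apply i 2 (by simp)).integrable_mul (memLp_apply i 2 (by simp))

theorem memLp_diagQuad (c : F → ℝ) : MemLp (diagQuad c) 2 μ := by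
  unfold diagQuad diagBilin
  refine memLp_finsetSum _ fun i _ => MemLp.const_mul ?_ _
  exact (memLp_apply i 4 (by simp)).mul (memLp_apply i 4 (by simp))
    (hpqr := ⟨by
      rw [show (4 : ℝ≥0∞) = 2 * 2 by norm_num, ENNReal.mul_inv (by simp) (by simp), ← mul_add,
        ENNReal.inv_two_add_inv_two, mul_one]⟩)

theorem lintegral_sub_sq_eq {E : Type*} [MeasurableSpace E] {μ : Measure E} [IsProbabilityMeasure μ]
    {q : E → ℝ} (hq : MemLp q 2 μ) :
    ∫⁻ u, ∫⁻ v, ‖q u - q v‖ₑ ^ 2 ∂μ ∂μ = 2 * ∫⁻ u, ‖q u - ∫ v, q v ∂μ‖ₑ ^ 2 ∂μ := by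
  have hqi : Integrable q μ := hq.integrable (by norm_num)
  set a := ∫ v, q v ∂μ with ha
  have hr : MemLp (fun u => q u - a) 2 μ := hq.sub (memLp_const a)
  have hri : Integrable (fun u => q u - a) μ := hr.integrable (by norm_num)
  have hr2 : Integrable (fun u => (q u - a) ^ 2) μ := hr.integrable_sq
  have hr0 : ∫ u, (q u - a) ∂μ = 0 := by
    rw [integral_sub hqi (integrable_const a)]; simp [ha]
  have e : ∀ x : ℝ, ‖x‖ₑ ^ 2 = ENNReal.ofReal (x ^ 2) := fun x => by
    rw [← sq_abs, ENNReal.ofReal_pow (abs_nonneg x), Real.enorm_eq_ofReal_abs]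
  simp_rw [e]
  set V := ∫ u, (q u - a) ^ 2 ∂μ with hV
  have h1 : ∀ u, ∫⁻ v, ENNReal.ofReal ((q u - q v) ^ 2) ∂μ = ENNReal.ofReal ((q u - a) ^ 2 + V) := by
    intro u
    have e2 : ∀ v, (q u - q v) ^ 2 = (q u - a) ^ 2 + -2 * (q u - a) * (q v - a) + (q v - a) ^ 2 :=
      fun v => by ring
    have hi : Integrable (fun v => (q u - a) ^ 2 + -2 * (q u - a) * (q v - a)) μ :=
      (integrable_const _).add (hri.const_mul _)
    rw [← ofReal_integral_eq_lintegral_ofReal]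
    · congr 1
      simp_rw [e2]
      rw [integral_add hi hr2, integral_add (integrable_const _) (hri.const_mul _),
        integral_const_mul, hr0]
      simp [hV]
    · simp_rw [e2]; exact hi.add hr2
    · exact ae_of_all _ fun v => sq_nonneg _
  simp_rw [h1]
  have hi2 : Integrable (fun u => (q u - a) ^ 2 + V) μ := hr2.add (integrable_const V)
  rw [← ofReal_integral_eq_lintegral_ofReal hr2 (ae_of_all _ fun _ => sq_nonneg _),
    ← ofReal_integral_eq_lintegral_ofReal hi2 (ae_of_all _ fun u =>
      add_nonneg (sq_nonneg _) (integral_nonneg fun _ => sq_nonneg _)),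
    integral_add hr2 (integrable_const V)]
  simp only [integral_const, probReal_univ, smul_eq_mul, one_mul]
  rw [← hV, ← two_mul, ENNReal.ofReal_mul (by norm_num)]
  simp

/-- By Jensen's inequality the mean may be replaced by an independent copy, and the decoupled bound
applies. Returning from the second moment of the difference of two copies to the variance costs a
factor 2, hence 2 ^ m. -/
theorem lintegral_diagQuad_sub_integral_pow_le
    (h0 : ∀ L : StrongDual ℝ (F → ℝ), ∫ x, L x ∂μ = 0) (c : F → ℝ) {m : ℕ} (hm : m ≠ 0) :
    ∫⁻ u, ‖diagQuad c u - ∫ v, diagQuad c v ∂μ‖ₑ ^ (2 * m) ∂μ ≤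
      gaussianMoment m ^ 2 * 2 ^ m *
        (∫⁻ u, ‖diagQuad c u - ∫ v, diagQuad c v ∂μ‖ₑ ^ 2 ∂μ) ^ m := by
  have hq := measurable_diagQuad c
  have hqi := integrable_diagQuad (μ := μ) c
  have h1 : ∀ u, ‖diagQuad c u - ∫ v, diagQuad c v ∂μ‖ₑ ^ (2 * m) ≤
      ∫⁻ v, ‖diagQuad c u - diagQuad c v‖ₑ ^ (2 * m) ∂μ := by
    intro u
    have e : diagQuad c u - ∫ v, diagQuad c v ∂μ = ∫ v, (diagQuad c u - diagQuad c v) ∂μ := by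
      rw [integral_sub (integrable_const _) hqi]; simp
    rw [e]
    refine (pow_le_pow_left₀ zero_le (enorm_integral_le_lintegral_enorm _) _).trans ?_
    exact lintegral_pow_le_lintegral_pow μ (by fun_prop) (by omega)
  calc _ ≤ ∫⁻ u, ∫⁻ v, ‖diagQuad c u - diagQuad c v‖ₑ ^ (2 * m) ∂μ ∂μ := lintegral_mono h1
    _ = 2 ^ (2 * m) * ∫⁻ u, ∫⁻ v, ‖diagBilin c u v‖ₑ ^ (2 * m) ∂μ ∂μ :=
        lintegral_diagQuad_sub_pow h0 c _
    _ ≤ 2 ^ (2 * m) * (gaussianMoment m ^ 2 *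
          (∫⁻ u, ∫⁻ v, ‖diagBilin c u v‖ₑ ^ 2 ∂μ ∂μ) ^ m) :=
        mul_le_mul_right (lintegral_diagBilin_pow_le h0 c hm) _
    _ = gaussianMoment m ^ 2 * (2 ^ 2 * ∫⁻ u, ∫⁻ v, ‖diagBilin c u v‖ₑ ^ 2 ∂μ ∂μ) ^ m := by
        rw [mul_pow, ← pow_mul]; ring
    _ = _ := by
        rw [← lintegral_diagQuad_sub_pow h0 c 2, lintegral_sub_sq_eq (memLp_diagQuad c), mul_pow,
          mul_assoc]

end FiniteDimensional

end

/-! ### Wick's formula and hypercontractivity for Gaussian processes. -/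

section

section FiniteDimensional

variable {F : Type*} [Fintype F] {μ : Measure (F → ℝ)} [IsGaussian μ]

theorem memLp_sq_sub (i : F) (a : ℝ) : MemLp (fun x : F → ℝ => x i ^ 2 - a) 2 μ := by
  refine MemLp.sub ?_ (memLp_const a)
  simp_rw [sq]
  exact (memLp_apply i 4 (by simp)).mul (memLp_apply i 4 (by simp))
    (hpqr := ⟨by
      rw [show (4 : ℝ≥0∞) = 2 * 2 by norm_num, ENNReal.mul_inv (by simp) (by simp), ← mul_add,
        ENNReal.inv_two_add_inv_two, mul_one]⟩)

/-- Wick's formula for two squares. -/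
theorem integral_sq_sub_mul_sq_sub (h0 : ∀ L : StrongDual ℝ (F → ℝ), ∫ x, L x ∂μ = 0) (i j : F) :
    ∫ x, (x i ^ 2 - ∫ y, y i ^ 2 ∂μ) * (x j ^ 2 - ∫ y, y j ^ 2 ∂μ) ∂μ =
      2 * (∫ x, x i * x j ∂μ) ^ 2 := by
  set σ := ∫ y, y i ^ 2 ∂μ with hσ
  set τ := ∫ y, y j ^ 2 ∂μ with hτ
  have hi := memLp_sq_sub (μ := μ) i σ
  have hj := memLp_sq_sub (μ := μ) j τ
  have hi1 := hi.integrable (by norm_num)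
  have hj1 := hj.integrable (by norm_num)
  have hij : Integrable (fun x => (x i ^ 2 - σ) * (x j ^ 2 - τ)) μ := hi.integrable_mul hj
  have hi0 : ∫ x, (x i ^ 2 - σ) ∂μ = 0 := by
    rw [integral_sub (memLp_apply (μ := μ) i 2 (by simp)).integrable_sq (integrable_const _)]
    simp [hσ]
  -- The same expectation over two independent copies is computed twice: by rotation it is four
  -- times a squared covariance, by expansion it is twice the covariance of the centered squares.
  have e1 : ∫ z : (F → ℝ) × (F → ℝ), (z.1 i ^ 2 - z.2 i ^ 2) * (z.1 j ^ 2 - z.2 j ^ 2) ∂(μ.prod μ) =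
      4 * (∫ x, x i * x j ∂μ) ^ 2 := by
    nth_rw 1 [← map_rotation_eq h0]
    rw [integral_map (by fun_prop) (by
      apply Measurable.aestronglyMeasurable; fun_prop)]
    have e : ∀ z : (F → ℝ) × (F → ℝ),
        (((ContinuousLinearMap.rotation (Real.pi / 4) z).1 i) ^ 2 -
          ((ContinuousLinearMap.rotation (Real.pi / 4) z).2 i) ^ 2) *
        (((ContinuousLinearMap.rotation (Real.pi / 4) z).1 j) ^ 2 -
          ((ContinuousLinearMap.rotation (Real.pi / 4) z).2 j) ^ 2) =
        4 * ((z.1 i * z.1 j) * (z.2 i * z.2 j)) := fun z => by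
      rw [show z = (z.1, z.2) from rfl, sq_sub_sq_rotation, sq_sub_sq_rotation]; ring
    simp_rw [e]
    rw [integral_const_mul, integral_prod_mul (fun x : F → ℝ => x i * x j) (fun x : F → ℝ => x i * x j), sq]
  have e2 : ∫ z : (F → ℝ) × (F → ℝ), (z.1 i ^ 2 - z.2 i ^ 2) * (z.1 j ^ 2 - z.2 j ^ 2) ∂(μ.prod μ) =
      2 * ∫ x, (x i ^ 2 - σ) * (x j ^ 2 - τ) ∂μ := by
    have e : ∀ z : (F → ℝ) × (F → ℝ), (z.1 i ^ 2 - z.2 i ^ 2) * (z.1 j ^ 2 - z.2 j ^ 2) =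
        (z.1 i ^ 2 - σ) * (z.1 j ^ 2 - τ) + (z.2 i ^ 2 - σ) * (z.2 j ^ 2 - τ) -
        ((z.1 i ^ 2 - σ) * (z.2 j ^ 2 - τ) + (z.1 j ^ 2 - τ) * (z.2 i ^ 2 - σ)) := fun z => by ring
    simp_rw [e]
    have k1 : Integrable (fun z : (F → ℝ) × (F → ℝ) => (z.1 i ^ 2 - σ) * (z.1 j ^ 2 - τ))
      (μ.prod μ) := hij.comp_fst μ
    have k2 : Integrable (fun z : (F → ℝ) × (F → ℝ) => (z.2 i ^ 2 - σ) * (z.2 j ^ 2 - τ))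
      (μ.prod μ) := hij.comp_snd μ
    have k3 : Integrable (fun z : (F → ℝ) × (F → ℝ) => (z.1 i ^ 2 - σ) * (z.2 j ^ 2 - τ))
      (μ.prod μ) := hi1.mul_prod hj1
    have k4 : Integrable (fun z : (F → ℝ) × (F → ℝ) => (z.1 j ^ 2 - τ) * (z.2 i ^ 2 - σ))
      (μ.prod μ) := hj1.mul_prod hi1
    rw [integral_sub (by exact k1.add k2) (by exact k3.add k4), integral_add k1 k2, integral_add k3 k4,
      integral_prod_mul (fun x : F → ℝ => x i ^ 2 - σ) (fun x : F → ℝ => x j ^ 2 - τ),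
      integral_prod_mul (fun x : F → ℝ => x j ^ 2 - τ) (fun x : F → ℝ => x i ^ 2 - σ), hi0,
      integral_fun_fst (fun x : F → ℝ => (x i ^ 2 - σ) * (x j ^ 2 - τ)),
      integral_fun_snd (fun x : F → ℝ => (x i ^ 2 - σ) * (x j ^ 2 - τ))]
    simp
    ring
  linarith

end FiniteDimensional

section GaussianProcess

variable {ι Ω : Type*} [MeasurableSpace Ω] {P : Measure Ω} {Z : ι → Ω → ℝ}

theorem aemeasurable_restrict (hZ : IsGaussianProcess Z P) (s : Finset ι) :
    AEMeasurable (fun ω => s.restrict (Z · ω)) P :=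
  (hZ.hasGaussianLaw s).aemeasurable

theorem integral_strongDual_map_restrict [IsProbabilityMeasure P] (hZ : IsGaussianProcess Z P)
    (h0 : ∀ i, ∫ ω, Z i ω ∂P = 0)
    (s : Finset ι) (L : StrongDual ℝ (s → ℝ)) :
    ∫ x, L x ∂(P.map fun ω => s.restrict (Z · ω)) = 0 := by
  classical
  rw [integral_map (aemeasurable_restrict hZ s) (by fun_prop)]
  have e : ∀ x : s → ℝ, L x = ∑ i, x i * L (Pi.single i 1) := fun x => by
    conv_lhs => rw [pi_eq_sum_univ' x]
    rw [map_sum]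
    refine Finset.sum_congr rfl fun i _ => ?_
    rw [map_smul, smul_eq_mul]
  simp_rw [fun ω : Ω => e (s.restrict (Z · ω))]
  rw [integral_finsetSum]
  · refine Finset.sum_eq_zero fun i _ => ?_
    rw [integral_mul_const]
    exact mul_eq_zero_of_left (h0 i.1) _
  · intro i _
    exact ((hZ.hasGaussianLaw_eval i.1).integrable).mul_const _

theorem integral_centered_sq_mul [IsProbabilityMeasure P] (hZ : IsGaussianProcess Z P)
    (h0 : ∀ i, ∫ ω, Z i ω ∂P = 0)
    (i j : ι) :
    ∫ ω, (Z i ω ^ 2 - ∫ ω', Z i ω' ^ 2 ∂P) * (Z j ω ^ 2 - ∫ ω', Z j ω' ^ 2 ∂P) ∂P =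
      2 * (∫ ω, Z i ω * Z j ω ∂P) ^ 2 := by
  classical
  set s : Finset ι := {i, j}
  have hs := aemeasurable_restrict hZ s
  have := (hZ.hasGaussianLaw s).isGaussian_map
  have h := integral_sq_sub_mul_sq_sub (integral_strongDual_map_restrict hZ h0 s)
    ⟨i, by simp [s]⟩ ⟨j, by simp [s]⟩
  rw [integral_map hs (by apply Measurable.aestronglyMeasurable; fun_prop),
    integral_map hs (by apply Measurable.aestronglyMeasurable; fun_prop),
    integral_map hs (by apply Measurable.aestronglyMeasurable; fun_prop),
    integral_map hs (by apply Measurable.aestronglyMeasurable; fun_prop)] at h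
  exact h

theorem memLp_centered_sq [IsProbabilityMeasure P] (hZ : IsGaussianProcess Z P) (i : ι) (a : ℝ) :
    MemLp (fun ω => Z i ω ^ 2 - a) 2 P := by
  refine MemLp.sub ?_ (memLp_const a)
  simp_rw [sq]
  exact ((hZ.hasGaussianLaw_eval i).memLp (p := 4) (by simp)).mul
    ((hZ.hasGaussianLaw_eval i).memLp (p := 4) (by simp))
    (hpqr := ⟨by
      rw [show (4 : ℝ≥0∞) = 2 * 2 by norm_num, ENNReal.mul_inv (by simp) (by simp), ← mul_add,
        ENNReal.inv_two_add_inv_two, mul_one]⟩)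

theorem lintegral_sum_centered_sq_pow_le [IsProbabilityMeasure P] (hZ : IsGaussianProcess Z P)
    (h0 : ∀ i, ∫ ω, Z i ω ∂P = 0) (c : ι →₀ ℝ) {m : ℕ} (hm : m ≠ 0) :
    ∫⁻ ω, ‖c.sum fun i a => a * (Z i ω ^ 2 - ∫ ω', Z i ω' ^ 2 ∂P)‖ₑ ^ (2 * m) ∂P ≤
      gaussianMoment m ^ 2 * 2 ^ m *
        (∫⁻ ω, ‖c.sum fun i a => a * (Z i ω ^ 2 - ∫ ω', Z i ω' ^ 2 ∂P)‖ₑ ^ 2 ∂P) ^ m := by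
  set s := c.support
  have hs := aemeasurable_restrict hZ s
  have := (hZ.hasGaussianLaw s).isGaussian_map
  set μ := P.map fun ω => s.restrict (Z · ω) with hμ
  set b : s → ℝ := fun i => c i
  have h := lintegral_diagQuad_sub_integral_pow_le (integral_strongDual_map_restrict hZ h0 s) b hm
  have hq := measurable_diagQuad b
  have e1 : ∫ v, diagQuad b v ∂μ = ∑ i ∈ s, c i * ∫ ω, Z i ω ^ 2 ∂P := by
    rw [hμ, integral_map hs hq.aestronglyMeasurable]
    unfold diagQuad diagBilin
    rw [integral_finsetSum]
    · rw [← Finset.sum_coe_sort s]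
      refine Finset.sum_congr rfl fun i _ => ?_
      rw [integral_const_mul]
      simp_rw [← sq]
      rfl
    · intro i _
      simp_rw [← sq]
      exact ((hZ.hasGaussianLaw_eval i.1).memLp_two.integrable_sq).const_mul _
  have e2 : ∀ ω, diagQuad b (s.restrict (Z · ω)) - ∫ v, diagQuad b v ∂μ =
      c.sum fun i a => a * (Z i ω ^ 2 - ∫ ω', Z i ω' ^ 2 ∂P) := fun ω => by
    rw [e1]
    unfold Finsupp.sum diagQuad diagBilin
    simp_rw [mul_sub]
    rw [Finset.sum_sub_distrib]
    congr 1
    rw [← Finset.sum_coe_sort s]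
    refine Finset.sum_congr rfl fun i _ => ?_
    simp [Finset.restrict, sq, b]
  rw [lintegral_map' (by fun_prop) hs, lintegral_map' (by fun_prop) hs] at h
  simp only [← hμ, e2] at h
  exact h

/-- Hypercontractivity in the closed span of the centered squares of a Gaussian process. -/
theorem lintegral_pow_le_of_orthogonal [IsProbabilityMeasure P] (hZ : IsGaussianProcess Z P)
    (h0 : ∀ i, ∫ ω, Z i ω ∂P = 0) {X : Ω → ℝ} (hX : MemLp X 2 P)
    (horth : ∀ Y : Ω → ℝ, MemLp Y 2 P →
      (∀ i, ∫ ω, (Z i ω ^ 2 - ∫ ω', Z i ω' ^ 2 ∂P) * Y ω ∂P = 0) → ∫ ω, X ω * Y ω ∂P = 0)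
    {m : ℕ} (hm : m ≠ 0) :
    ∫⁻ ω, ‖X ω‖ₑ ^ (2 * m) ∂P ≤
      gaussianMoment m ^ 2 * 2 ^ m * (∫⁻ ω, ‖X ω‖ₑ ^ 2 ∂P) ^ m := by
  set Q : ι → Lp ℝ 2 P := fun i => (memLp_centered_sq hZ i (∫ ω', Z i ω' ^ 2 ∂P)).toLp _ with hQ
  have hQe : ∀ i, Q i =ᵐ[P] fun ω => Z i ω ^ 2 - ∫ ω', Z i ω' ^ 2 ∂P := fun i => MemLp.coeFn_toLp _
  set S := Submodule.span ℝ (Set.range Q)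
  -- The closed span is the double orthogonal complement. For averages of the field, the condition
  -- `horth` is a mere application of Fubini, and no approximation by finite sums has to be
  -- constructed.
  have hmem : hX.toLp X ∈ S.topologicalClosure := by
    rw [← Submodule.orthogonal_orthogonal_eq_closure, Submodule.mem_orthogonal]
    intro Y hY
    rw [Submodule.mem_orthogonal] at hY
    rw [L2.inner_def]
    have := horth Y (Lp.memLp Y) fun i => by
      rw [← hY (Q i) (Submodule.subset_span ⟨i, rfl⟩), L2.inner_def]
      refine integral_congr_ae ?_
      filter_upwards [hQe i] with ω hω
      rw [hω]
      simp [mul_comm]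
    rw [← this]
    refine integral_congr_ae ?_
    filter_upwards [hX.coeFn_toLp] with ω hω
    rw [hω]
    simp
  obtain ⟨f, hfS, hf⟩ := mem_closure_iff_seq_limit.mp hmem
  have hn : ∀ g : Lp ℝ 2 P, ∫⁻ ω, ‖g ω‖ₑ ^ 2 ∂P = ‖g‖ₑ ^ 2 := fun g => by
    rw [Lp.enorm_def]
    have := eLpNorm_nnreal_pow_eq_lintegral (μ := P) (f := g) (p := 2) (by norm_num)
    simp only [NNReal.coe_ofNat, ENNReal.rpow_ofNat] at this
    exact this.symm
  have hfb : ∀ n, ∫⁻ ω, ‖f n ω‖ₑ ^ (2 * m) ∂P ≤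
      gaussianMoment m ^ 2 * 2 ^ m * (‖f n‖ₑ ^ 2) ^ m := by
    intro n
    obtain ⟨c, hc⟩ := Finsupp.mem_span_range_iff_exists_finsupp.mp (hfS n)
    have e : f n =ᵐ[P] fun ω => c.sum fun i a => a * (Z i ω ^ 2 - ∫ ω', Z i ω' ^ 2 ∂P) := by
      rw [← hc]
      unfold Finsupp.sum
      refine (Lp.coeFn_finsetSum _ _).trans ?_
      have h1 : ∀ᵐ ω ∂P, ∀ i ∈ c.support,
          (c i • Q i : Lp ℝ 2 P) ω = c i * (Z i ω ^ 2 - ∫ ω', Z i ω' ^ 2 ∂P) := by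
        refine (eventually_countable_ball c.support.countable_toSet).mpr fun i _ => ?_
        filter_upwards [hQe i, Lp.coeFn_smul (c i) (Q i)] with ω h2 h3
        rw [h3, Pi.smul_apply, h2, smul_eq_mul]
      filter_upwards [h1] with ω hω
      rw [Finset.sum_apply]
      exact Finset.sum_congr rfl hω
    rw [← hn]
    have h := lintegral_sum_centered_sq_pow_le hZ h0 c hm
    refine le_trans (le_of_eq ?_) (h.trans (le_of_eq ?_))
    · refine lintegral_congr_ae ?_
      filter_upwards [e] with ω hω
      rw [hω]
    · congr 2
      refine lintegral_congr_ae ?_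
      filter_upwards [e] with ω hω
      rw [hω]
  -- Convergence in L² does not give convergence of higher moments; an almost surely convergent
  -- subsequence and Fatou's lemma give the inequality, which is all that is needed.
  obtain ⟨ns, hns, hae⟩ := (tendstoInMeasure_of_tendsto_Lp hf).exists_seq_tendsto_ae
  have hlim : Tendsto (fun k => gaussianMoment m ^ 2 * 2 ^ m * (‖f (ns k)‖ₑ ^ 2) ^ m) atTop
      (𝓝 (gaussianMoment m ^ 2 * 2 ^ m * (‖hX.toLp X‖ₑ ^ 2) ^ m)) := by
    have hC : gaussianMoment m ^ 2 * 2 ^ m ≠ ⊤ :=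
      ENNReal.mul_ne_top (ENNReal.pow_ne_top (gaussianMoment_lt_top m).ne) (by simp)
    have h1 : Tendsto (fun k => ‖f (ns k)‖ₑ) atTop (𝓝 ‖hX.toLp X‖ₑ) :=
      (continuous_enorm.tendsto _).comp (hf.comp hns.tendsto_atTop)
    exact ENNReal.Tendsto.const_mul (ENNReal.Tendsto.pow (ENNReal.Tendsto.pow h1)) (Or.inr hC)
  have e1 : ∫⁻ ω, ‖X ω‖ₑ ^ 2 ∂P = ‖hX.toLp X‖ₑ ^ 2 := by
    rw [← hn]
    refine lintegral_congr_ae ?_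
    filter_upwards [hX.coeFn_toLp] with ω hω
    rw [hω]
  rw [e1]
  calc ∫⁻ ω, ‖X ω‖ₑ ^ (2 * m) ∂P
      ≤ ∫⁻ ω, liminf (fun k => ‖f (ns k) ω‖ₑ ^ (2 * m)) atTop ∂P := by
        refine lintegral_mono_ae ?_
        filter_upwards [hae, hX.coeFn_toLp] with ω h1 h2
        rw [h2] at h1
        have h3 : Tendsto (fun k => ‖f (ns k) ω‖ₑ ^ (2 * m)) atTop (𝓝 (‖X ω‖ₑ ^ (2 * m))) :=
          ENNReal.Tendsto.pow ((continuous_enorm.tendsto _).comp h1)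
        exact h3.liminf_eq.ge
    _ ≤ liminf (fun k => ∫⁻ ω, ‖f (ns k) ω‖ₑ ^ (2 * m) ∂P) atTop :=
        lintegral_liminf_le' fun k =>
          ((Lp.aestronglyMeasurable (f (ns k))).enorm.pow_const _)
    _ ≤ liminf (fun k => gaussianMoment m ^ 2 * 2 ^ m * (‖f (ns k)‖ₑ ^ 2) ^ m) atTop :=
        liminf_le_liminf (Eventually.of_forall fun k => hfb _)
    _ = _ := hlim.liminf_eq

end GaussianProcess

section Complex

variable {ι Ω : Type*} [MeasurableSpace Ω] {P : Measure Ω} {Z : ι → Ω → ℂ}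

/-- The real and imaginary parts of a complex process. -/
def realParts (Z : ι → Ω → ℂ) (i : ι × Bool) (ω : Ω) : ℝ :=
  if i.2 then (Z i.1 ω).re else (Z i.1 ω).im

theorem isGaussianProcess_realParts (hZ : IsGaussianProcess Z P) :
    IsGaussianProcess (realParts Z) P := by
  refine hZ.of_isGaussianProcess fun i => ⟨{i.1}, ?_⟩
  refine ⟨(if i.2 then Complex.reCLM else Complex.imCLM).comp
    (ContinuousLinearMap.proj ⟨i.1, by simp⟩), fun ω => ?_⟩
  unfold realParts
  by_cases h : i.2 <;> simp [h]

theorem integral_realParts (hZ : IsGaussianProcess Z P) (h0 : ∀ i, ∫ ω, Z i ω ∂P = 0)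
    (i : ι × Bool) : ∫ ω, realParts Z i ω ∂P = 0 := by
  have hi := (hZ.hasGaussianLaw_eval i.1).integrable
  unfold realParts
  by_cases h : i.2
  · simp only [h, if_true]
    have := integral_re hi
    simp only [h0, RCLike.re_eq_complex_re] at this
    simpa using this
  · simp only [h, Bool.false_eq_true, if_false]
    have := integral_im hi
    simp only [h0, RCLike.im_eq_complex_im] at this
    simpa using this

theorem norm_sq_sub_eq [IsProbabilityMeasure P] (hZ : IsGaussianProcess Z P) (i : ι) (ω : Ω) :
    ‖Z i ω‖ ^ 2 - ∫ ω', ‖Z i ω'‖ ^ 2 ∂P =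
      (realParts Z (i, true) ω ^ 2 - ∫ ω', realParts Z (i, true) ω' ^ 2 ∂P) +
      (realParts Z (i, false) ω ^ 2 - ∫ ω', realParts Z (i, false) ω' ^ 2 ∂P) := by
  have hR := isGaussianProcess_realParts hZ
  have e : ∀ ω, ‖Z i ω‖ ^ 2 = realParts Z (i, true) ω ^ 2 + realParts Z (i, false) ω ^ 2 :=
    fun ω => by
      rw [← Complex.normSq_eq_norm_sq, Complex.normSq_apply]; simp [realParts, sq]
  simp_rw [e]
  rw [integral_add (hR.hasGaussianLaw_eval _).memLp_two.integrable_sq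
    (hR.hasGaussianLaw_eval _).memLp_two.integrable_sq]
  ring

/-- Wick's formula for the squared moduli of a complex Gaussian process. -/
theorem integral_norm_sq_sub_mul [IsProbabilityMeasure P] (hZ : IsGaussianProcess Z P)
    (h0 : ∀ i, ∫ ω, Z i ω ∂P = 0)
    (i j : ι) :
    ∫ ω, (‖Z i ω‖ ^ 2 - ∫ ω', ‖Z i ω'‖ ^ 2 ∂P) * (‖Z j ω‖ ^ 2 - ∫ ω', ‖Z j ω'‖ ^ 2 ∂P) ∂P =
      ‖∫ ω, Z i ω * (starRingEnd ℂ) (Z j ω) ∂P‖ ^ 2 + ‖∫ ω, Z i ω * Z j ω ∂P‖ ^ 2 := by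
  have hR := isGaussianProcess_realParts hZ
  have hR0 := integral_realParts hZ h0
  have hprod : ∀ a b, Integrable (fun ω => realParts Z a ω * realParts Z b ω) P := fun a b =>
    (hR.hasGaussianLaw_eval a).memLp_two.integrable_mul (hR.hasGaussianLaw_eval b).memLp_two
  have hc : ∀ a b, Integrable (fun ω => (realParts Z a ω ^ 2 - ∫ ω', realParts Z a ω' ^ 2 ∂P) *
      (realParts Z b ω ^ 2 - ∫ ω', realParts Z b ω' ^ 2 ∂P)) P := fun a b =>
    (memLp_centered_sq hR a _).integrable_mul (memLp_centered_sq hR b _)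
  simp_rw [norm_sq_sub_eq hZ, add_mul, mul_add]
  rw [integral_add (by exact (hc _ _).add (hc _ _)) (by exact (hc _ _).add (hc _ _)), integral_add (hc _ _) (hc _ _),
    integral_add (hc _ _) (hc _ _)]
  simp_rw [integral_centered_sq_mul hR hR0]
  have hdec : ∀ k ω, Z k ω = (realParts Z (k, true) ω : ℂ) + (realParts Z (k, false) ω : ℂ) * Complex.I :=
    fun k ω => by simp [realParts]
  have e1 : ∫ ω, Z i ω * (starRingEnd ℂ) (Z j ω) ∂P =
      ((∫ ω, realParts Z (i, true) ω * realParts Z (j, true) ω ∂P +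
        ∫ ω, realParts Z (i, false) ω * realParts Z (j, false) ω ∂P : ℝ) : ℂ) +
      ((∫ ω, realParts Z (i, false) ω * realParts Z (j, true) ω ∂P -
        ∫ ω, realParts Z (i, true) ω * realParts Z (j, false) ω ∂P : ℝ) : ℂ) * Complex.I := by
    rw [← integral_add (hprod _ _) (hprod _ _), ← integral_sub (hprod _ _) (hprod _ _),
      ← integral_complex_ofReal, ← integral_complex_ofReal, ← integral_mul_const, ← integral_add]
    · refine integral_congr_ae (ae_of_all _ fun ω => ?_)
      simp only [hdec i ω, hdec j ω, map_add, map_mul, Complex.conj_ofReal, Complex.conj_I]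
      push_cast
      linear_combination (-(realParts Z (i, false) ω : ℂ) * realParts Z (j, false) ω) * Complex.I_sq
    · exact ((hprod _ _).add (hprod _ _)).ofReal
    · exact (((hprod _ _).sub (hprod _ _)).ofReal).mul_const _
  have e2 : ∫ ω, Z i ω * Z j ω ∂P =
      ((∫ ω, realParts Z (i, true) ω * realParts Z (j, true) ω ∂P -
        ∫ ω, realParts Z (i, false) ω * realParts Z (j, false) ω ∂P : ℝ) : ℂ) +
      ((∫ ω, realParts Z (i, false) ω * realParts Z (j, true) ω ∂P +
        ∫ ω, realParts Z (i, true) ω * realParts Z (j, false) ω ∂P : ℝ) : ℂ) * Complex.I := by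
    rw [← integral_add (hprod _ _) (hprod _ _), ← integral_sub (hprod _ _) (hprod _ _),
      ← integral_complex_ofReal, ← integral_complex_ofReal, ← integral_mul_const, ← integral_add]
    · refine integral_congr_ae (ae_of_all _ fun ω => ?_)
      simp only [hdec i ω, hdec j ω]
      push_cast
      linear_combination ((realParts Z (i, false) ω : ℂ) * realParts Z (j, false) ω) * Complex.I_sq
    · exact ((hprod _ _).sub (hprod _ _)).ofReal
    · exact (((hprod _ _).add (hprod _ _)).ofReal).mul_const _
  rw [e1, e2, ← Complex.normSq_eq_norm_sq, ← Complex.normSq_eq_norm_sq, Complex.normSq_add_mul_I,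
    Complex.normSq_add_mul_I]
  ring

/-- Hypercontractivity in the closed span of the centered squared moduli of a complex Gaussian
process. -/
theorem lintegral_pow_le_of_orthogonal_norm_sq [IsProbabilityMeasure P] (hZ : IsGaussianProcess Z P)
    (h0 : ∀ i, ∫ ω, Z i ω ∂P = 0) {X : Ω → ℝ} (hX : MemLp X 2 P)
    (horth : ∀ Y : Ω → ℝ, MemLp Y 2 P →
      (∀ i, ∫ ω, (‖Z i ω‖ ^ 2 - ∫ ω', ‖Z i ω'‖ ^ 2 ∂P) * Y ω ∂P = 0) → ∫ ω, X ω * Y ω ∂P = 0)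
    {m : ℕ} (hm : m ≠ 0) :
    ∫⁻ ω, ‖X ω‖ₑ ^ (2 * m) ∂P ≤
      gaussianMoment m ^ 2 * 2 ^ m * (∫⁻ ω, ‖X ω‖ₑ ^ 2 ∂P) ^ m := by
  have hR := isGaussianProcess_realParts hZ
  refine lintegral_pow_le_of_orthogonal hR (integral_realParts hZ h0) hX
    (fun Y hY h => horth Y hY fun i => ?_) hm
  simp_rw [norm_sq_sub_eq hZ, add_mul]
  rw [integral_add (by exact (memLp_centered_sq hR _ _).integrable_mul hY)
    (by exact (memLp_centered_sq hR _ _).integrable_mul hY), h, h, add_zero]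

theorem memLp_norm_sq_sub [IsProbabilityMeasure P] (hZ : IsGaussianProcess Z P) (i : ι) :
    MemLp (fun ω => ‖Z i ω‖ ^ 2 - ∫ ω', ‖Z i ω'‖ ^ 2 ∂P) 2 P := by
  have hR := isGaussianProcess_realParts hZ
  simp_rw [norm_sq_sub_eq hZ]
  exact (memLp_centered_sq hR _ _).add (memLp_centered_sq hR _ _)

end Complex

end

/-! ### Bessel potentials as averages over a probability measure. -/

section

section Gamma

theorem measurable_gammaPDF (β r : ℝ) : Measurable (gammaPDF β r) :=
  (measurable_gammaPDFReal β r).ennreal_ofReal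

/-- Multiplying the gamma density by an exponential changes its rate from 1 to 1 + a; the ratio of
the normalizing constants is the result. -/
theorem lintegral_gammaMeasure_exp {β : ℝ} (hβ : 0 < β) {a : ℝ} (ha : 0 ≤ a) :
    ∫⁻ s, ENNReal.ofReal (Real.exp (-(a * s))) ∂(gammaMeasure β 1) =
      ENNReal.ofReal ((1 + a) ^ (-β)) := by
  have ha1 : 0 < 1 + a := by positivity
  rw [gammaMeasure, lintegral_withDensity_eq_lintegral_mul _ (measurable_gammaPDF β 1)
    (by fun_prop)]
  have e : ∀ s, (gammaPDF β 1 * fun s => ENNReal.ofReal (Real.exp (-(a * s)))) s =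
      ENNReal.ofReal ((1 + a) ^ (-β)) * gammaPDF β (1 + a) s := fun s => by
    rcases lt_or_ge s 0 with hs | hs
    · simp [gammaPDF_of_neg hs]
    · rw [Pi.mul_apply, gammaPDF_of_nonneg hs, gammaPDF_of_nonneg hs,
        ← ENNReal.ofReal_mul (by have := Real.Gamma_pos_of_pos hβ; positivity),
        ← ENNReal.ofReal_mul (by positivity)]
      congr 1
      have h1 : (1 + a) ^ (-β) * (1 + a) ^ β = 1 := by
        rw [← Real.rpow_add ha1]; simp
      rw [show -((1 + a) * s) = -(1 * s) + -(a * s) by ring, Real.exp_add, Real.one_rpow]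
      linear_combination (-(1 / Real.Gamma β * s ^ (β - 1) * (Real.exp (-(1 * s)) *
        Real.exp (-(a * s))))) * h1
  simp_rw [e]
  rw [lintegral_const_mul _ (measurable_gammaPDF _ _),
    lintegral_gammaPDF_eq_one hβ ha1, mul_one]

theorem ae_pos_gammaMeasure (β : ℝ) : ∀ᵐ s ∂(gammaMeasure β 1), 0 < s := by
  rw [gammaMeasure, ae_withDensity_iff (measurable_gammaPDF β 1)]
  have h : ∀ᵐ s : ℝ, s ≠ 0 := by simp [ae_iff]
  filter_upwards [h] with s hs h2
  rcases lt_or_gt_of_ne hs with h3 | h3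
  · exact absurd (gammaPDF_of_neg h3) h2
  · exact h3

/-- The product of the power and the gamma density is a multiple of the gamma density of shape β - κ
> 0. -/
theorem lintegral_gammaMeasure_rpow_neg_lt_top {β κ : ℝ} (hκ : 0 ≤ κ) (hβ : κ < β) :
    ∫⁻ s, ENNReal.ofReal (s ^ (-κ)) ∂(gammaMeasure β 1) < ⊤ := by
  have hβ0 : 0 < β := hκ.trans_lt hβ
  rw [gammaMeasure, lintegral_withDensity_eq_lintegral_mul _ (measurable_gammaPDF β 1)
    (by fun_prop)]
  have h : ∀ᵐ s : ℝ, s ≠ 0 := by simp [ae_iff]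
  have e : ∀ᵐ s : ℝ, (gammaPDF β 1 * fun s => ENNReal.ofReal (s ^ (-κ))) s =
      ENNReal.ofReal (Real.Gamma (β - κ) / Real.Gamma β) * gammaPDF (β - κ) 1 s := by
    filter_upwards [h] with s hs
    rcases lt_or_gt_of_ne hs with h3 | h3
    · simp [gammaPDF_of_neg h3]
    · have g1 := Real.Gamma_pos_of_pos hβ0
      have g2 := Real.Gamma_pos_of_pos (sub_pos.mpr hβ)
      rw [Pi.mul_apply, gammaPDF_of_nonneg h3.le, gammaPDF_of_nonneg h3.le,
        ← ENNReal.ofReal_mul (by positivity), ← ENNReal.ofReal_mul (by positivity)]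
      congr 1
      have h4 : s ^ (β - κ - 1) = s ^ (β - 1) * s ^ (-κ) := by
        rw [← Real.rpow_add h3]; ring_nf
      rw [h4, Real.one_rpow, Real.one_rpow]
      field_simp
  rw [lintegral_congr_ae e, lintegral_const_mul _ (measurable_gammaPDF _ _),
    lintegral_gammaPDF_eq_one (sub_pos.mpr hβ) one_pos, mul_one]
  exact ENNReal.ofReal_lt_top

end Gamma

variable (E : Type*) [NormedAddCommGroup E] [InnerProductSpace ℝ E] [FiniteDimensional ℝ E]
  [MeasurableSpace E] [BorelSpace E]

/-- The Gaussian measure with density `exp (-π |x| ^ 2)`. -/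
noncomputable def piGaussian : Measure E :=
  volume.withDensity fun x => ENNReal.ofReal (Real.exp (-Real.pi * ‖x‖ ^ 2))

variable {E}

theorem piGaussian_le : piGaussian E ≤ volume := by
  unfold piGaussian
  calc _ ≤ (volume : Measure E).withDensity 1 := by
        refine withDensity_mono (ae_of_all _ fun x => ?_)
        rw [Pi.one_apply, ENNReal.ofReal_le_one, Real.exp_le_one_iff]
        have := Real.pi_pos
        nlinarith [sq_nonneg ‖x‖]
    _ = volume := withDensity_one

theorem integral_piGaussian (t : E) :
    ∫ x, Complex.exp ((inner ℝ x t : ℝ) * Complex.I) ∂(piGaussian E) =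
      Complex.exp (-(‖t‖ ^ 2 / (4 * Real.pi) : ℝ)) := by
  have hpi : (Real.pi : ℂ) ≠ 0 := by exact_mod_cast Real.pi_ne_zero
  have h := fourier_gaussian_innerProductSpace (V := E) (b := Real.pi)
    (by simpa using Real.pi_pos) (-(2 * Real.pi)⁻¹ • t)
  rw [Real.fourier_eq', div_self hpi, Complex.one_cpow, one_mul] at h
  unfold piGaussian
  rw [integral_withDensity_eq_integral_toReal_smul (by fun_prop) (by simp)]
  convert h using 1
  · refine integral_congr_ae (ae_of_all _ fun x => ?_)
    simp only [Complex.real_smul, smul_eq_mul]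
    rw [ENNReal.toReal_ofReal (Real.exp_pos _).le, mul_comm]
    congr 1
    · have e : -2 * Real.pi * inner ℝ x (-(2 * Real.pi)⁻¹ • t) = inner ℝ x t := by
        rw [inner_smul_right]; field_simp
      rw [e]
    · push_cast; rfl
  · congr 1
    rw [norm_smul]
    push_cast
    rw [mul_pow, ← Complex.ofReal_pow ‖-(2 * Real.pi)⁻¹‖, Real.norm_eq_abs, sq_abs]
    push_cast
    field_simp
    norm_num

instance : IsProbabilityMeasure (piGaussian E) := by
  constructor
  have h := fourier_gaussian_innerProductSpace (V := E) (b := Real.pi)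
    (by simpa using Real.pi_pos) 0
  have hpi : (Real.pi : ℂ) ≠ 0 := by exact_mod_cast Real.pi_ne_zero
  rw [Real.fourier_eq', div_self hpi, Complex.one_cpow, one_mul] at h
  have h2 : ∫ x : E, Real.exp (-Real.pi * ‖x‖ ^ 2) = 1 := by
    rw [← Complex.ofReal_inj, ← integral_complex_ofReal]
    simpa using h
  have hi : Integrable fun x : E => Real.exp (-Real.pi * ‖x‖ ^ 2) := by
    by_contra hn
    rw [integral_undef hn] at h2
    norm_num at h2
  rw [piGaussian, withDensity_apply _ MeasurableSet.univ, Measure.restrict_univ,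
    ← ofReal_integral_eq_lintegral_ofReal hi (ae_of_all _ fun _ => (Real.exp_pos _).le), h2]
  simp

variable (E) in
/-- The probability measure whose characteristic function is `(1 + |t| ^ 2) ^ (-β)`. -/
noncomputable def besselMeasure (β : ℝ) : Measure E :=
  ((gammaMeasure β 1).prod (piGaussian E)).map fun p => √(4 * Real.pi * p.1) • p.2

theorem lintegral_besselMeasure {β : ℝ} {f : E → ℝ≥0∞} (hf : Measurable f) :
    ∫⁻ u, f u ∂(besselMeasure E β) =
      ∫⁻ s, ∫⁻ x, f (√(4 * Real.pi * s) • x) ∂(piGaussian E) ∂(gammaMeasure β 1) := by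
  rw [besselMeasure, lintegral_map hf (by fun_prop), lintegral_prod _ (by fun_prop)]

theorem isProbabilityMeasure_besselMeasure {β : ℝ} (hβ : 0 < β) :
    IsProbabilityMeasure (besselMeasure E β) := by
  have := isProbabilityMeasure_gammaMeasure hβ one_pos
  exact Measure.isProbabilityMeasure_map (by fun_prop)

/-- Subordination: given the gamma variable s, the scaling √(4πs) makes the Gaussian characteristic
function exp(-s ‖t‖²), and averaging over s is the Laplace transform of the gamma law. -/
theorem charFun_besselMeasure {β : ℝ} (hβ : 0 < β) (t : E) :
    charFun (besselMeasure E β) t = (((1 + ‖t‖ ^ 2) ^ (-β) : ℝ) : ℂ) := by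
  have := isProbabilityMeasure_gammaMeasure hβ one_pos
  have hm : Measurable fun p : ℝ × E => √(4 * Real.pi * p.1) • p.2 := by fun_prop
  rw [charFun_apply, besselMeasure, integral_map hm.aemeasurable (by fun_prop), integral_prod]
  · have e : ∀ᵐ s ∂(gammaMeasure β 1), ∫ x, Complex.exp
        ((inner ℝ (√(4 * Real.pi * s) • x) t : ℝ) * Complex.I) ∂(piGaussian E) =
        ((Real.exp (-(‖t‖ ^ 2 * s)) : ℝ) : ℂ) := by
      filter_upwards [ae_pos_gammaMeasure β] with s hs
      have h := integral_piGaussian (√(4 * Real.pi * s) • t)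
      simp_rw [inner_smul_right] at h
      simp_rw [inner_smul_left]
      refine h.trans ?_
      rw [norm_smul, mul_pow, Real.norm_eq_abs, sq_abs, Real.sq_sqrt (by positivity)]
      push_cast
      congr 2
      have hpi : (Real.pi : ℂ) ≠ 0 := by exact_mod_cast Real.pi_ne_zero
      field_simp
    rw [integral_congr_ae e, integral_complex_ofReal, integral_eq_lintegral_of_nonneg_ae
      (ae_of_all _ fun _ => (Real.exp_pos _).le) (by fun_prop),
      lintegral_gammaMeasure_exp hβ (sq_nonneg _), ENNReal.toReal_ofReal (by positivity)]
  · refine (integrable_const (1 : ℝ)).mono' (by fun_prop) (ae_of_all _ fun p => ?_)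
    rw [Complex.norm_exp_ofReal_mul_I]

/-- Characteristic functions multiply under convolution and determine the measure. This is the
semigroup law of the Bessel potentials. -/
theorem besselMeasure_conv {α β : ℝ} (hα : 0 < α) (hβ : 0 < β) :
    besselMeasure E α ∗ besselMeasure E β = besselMeasure E (α + β) := by
  have h1 := isProbabilityMeasure_besselMeasure (E := E) hα
  have h2 := isProbabilityMeasure_besselMeasure (E := E) hβ
  have h3 := isProbabilityMeasure_besselMeasure (E := E) (add_pos hα hβ)
  refine Measure.ext_of_charFun (funext fun t => ?_)
  rw [charFun_conv, charFun_besselMeasure hα, charFun_besselMeasure hβ,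
    charFun_besselMeasure (add_pos hα hβ), ← Complex.ofReal_mul, ← Real.rpow_add (by positivity)]
  ring_nf

theorem lintegral_comp_add_smul (y : E) {r : ℝ} (hr : 0 < r) {f : E → ℝ≥0∞} (hf : Measurable f) :
    ∫⁻ x, f (y + r • x) = ENNReal.ofReal ((r ^ Module.finrank ℝ E)⁻¹) * ∫⁻ x, f x := by
  have h1 : ∫⁻ x, f (y + r • x) = ∫⁻ x, f (y + x) ∂(Measure.map (fun x => r • x) volume) := by
    rw [lintegral_map (by fun_prop) (by fun_prop)]
  rw [h1, Measure.map_addHaar_smul _ hr.ne', lintegral_smul_measure, smul_eq_mul,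
    abs_of_pos (by positivity), lintegral_add_left_eq_self]

/-- The Bessel potential of order `β > d / (2 m)` maps `L ^ m` to `L ^ ∞`. -/
theorem exists_lintegral_besselMeasure_le {β : ℝ} {m : ℕ} (hm : m ≠ 0)
    (hβ : (Module.finrank ℝ E : ℝ) / (2 * m) < β) :
    ∃ C : ℝ≥0∞, C < ⊤ ∧ ∀ f : E → ℝ≥0∞, Measurable f → ∀ y,
      ∫⁻ u, f (y + u) ∂(besselMeasure E β) ≤ C * (∫⁻ x, f x ^ m) ^ (1 / (m : ℝ)) := by
  have hm' : (0 : ℝ) < m := by positivity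
  set κ : ℝ := (Module.finrank ℝ E : ℝ) / (2 * m)
  have hκ : 0 ≤ κ := by positivity
  refine ⟨∫⁻ s, ENNReal.ofReal ((4 * Real.pi) ^ (-κ)) * ENNReal.ofReal (s ^ (-κ))
    ∂(gammaMeasure β 1), ?_, fun f hf y => ?_⟩
  · rw [lintegral_const_mul _ (by fun_prop)]
    exact ENNReal.mul_lt_top ENNReal.ofReal_lt_top (lintegral_gammaMeasure_rpow_neg_lt_top hκ hβ)
  rw [lintegral_besselMeasure (by fun_prop), ← lintegral_mul_const _ (by fun_prop)]
  refine lintegral_mono_ae ?_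
  filter_upwards [ae_pos_gammaMeasure β] with s hs
  have hr : 0 < √(4 * Real.pi * s) := by positivity
  set r := √(4 * Real.pi * s) with hrd
  -- Given s, Jensen's inequality, domination of the Gaussian by Lebesgue measure and a change of
  -- scale produce the heat kernel factor (4πs)^(-d/(2m)). Its integrability under the gamma law is
  -- the condition on β.
  have h1 : (∫⁻ x, f (y + r • x) ∂(piGaussian E)) ^ m ≤
      ENNReal.ofReal ((r ^ Module.finrank ℝ E)⁻¹) * ∫⁻ x, f x ^ m := by
    calc _ ≤ ∫⁻ x, f (y + r • x) ^ m ∂(piGaussian E) :=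
          lintegral_pow_le_lintegral_pow _ (by fun_prop) hm
      _ ≤ ∫⁻ x, f (y + r • x) ^ m := lintegral_mono' piGaussian_le le_rfl
      _ = _ := lintegral_comp_add_smul y hr (f := fun x => f x ^ m) (by fun_prop)
  calc ∫⁻ x, f (y + r • x) ∂(piGaussian E)
      = ((∫⁻ x, f (y + r • x) ∂(piGaussian E)) ^ m) ^ (1 / (m : ℝ)) := by
        rw [← ENNReal.rpow_natCast, ← ENNReal.rpow_mul, mul_one_div_cancel hm'.ne',
          ENNReal.rpow_one]
    _ ≤ (ENNReal.ofReal ((r ^ Module.finrank ℝ E)⁻¹) * ∫⁻ x, f x ^ m) ^ (1 / (m : ℝ)) := by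
        gcongr
    _ = _ := by
        rw [ENNReal.mul_rpow_of_nonneg _ _ (by positivity), ENNReal.ofReal_rpow_of_nonneg
          (by positivity) (by positivity), ← ENNReal.ofReal_mul (by positivity),
          ← Real.mul_rpow (by positivity) hs.le]
        congr 2
        rw [hrd, Real.sqrt_eq_rpow, ← Real.rpow_natCast, ← Real.rpow_mul (by positivity),
          ← Real.rpow_neg (by positivity), ← Real.rpow_mul (by positivity)]
        congr 1
        simp only [κ]
        field_simp

/-- The Bessel potential of order `2 β` of a function, `y ↦ ∫ f (y + u) dJ(u)`. -/
noncomputable def besselPot {F : Type*} [NormedAddCommGroup F] [NormedSpace ℝ F] (β : ℝ)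
    (f : E → F) (y : E) : F :=
  ∫ u, f (y + u) ∂(besselMeasure E β)

section BesselPot

variable {F : Type*} [NormedAddCommGroup F] [NormedSpace ℝ F]

theorem lintegral_lintegral_besselMeasure {β : ℝ} (hβ : 0 < β) {f : E → ℝ≥0∞}
    (hf : Measurable f) : ∫⁻ y, ∫⁻ u, f (y + u) ∂(besselMeasure E β) = ∫⁻ y, f y := by
  have := isProbabilityMeasure_besselMeasure (E := E) hβ
  rw [lintegral_lintegral_swap (by fun_prop)]
  simp_rw [lintegral_add_right_eq_self f]
  simp

theorem enorm_besselPot_le {β : ℝ} (f : E → F) (y : E) :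
    ‖besselPot β f y‖ₑ ≤ ∫⁻ u, ‖f (y + u)‖ₑ ∂(besselMeasure E β) :=
  enorm_integral_le_lintegral_enorm _

theorem norm_besselPot_le {β : ℝ} (hβ : 0 < β) {f : E → F} {C : ℝ} (hf : ∀ x, ‖f x‖ ≤ C) (y : E) :
    ‖besselPot β f y‖ ≤ C := by
  have := isProbabilityMeasure_besselMeasure (E := E) hβ
  simpa [besselPot] using norm_integral_le_of_norm_le_const (μ := besselMeasure E β)
    (ae_of_all _ fun u => hf (y + u))

theorem lintegral_enorm_besselPot_pow_le {β : ℝ} (hβ : 0 < β) {f : E → F} [MeasurableSpace F]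
    [BorelSpace F] (hf : Measurable f) {m : ℕ} (hm : m ≠ 0) :
    ∫⁻ y, ‖besselPot β f y‖ₑ ^ m ≤ ∫⁻ y, ‖f y‖ₑ ^ m := by
  have := isProbabilityMeasure_besselMeasure (E := E) hβ
  calc ∫⁻ y, ‖besselPot β f y‖ₑ ^ m
      ≤ ∫⁻ y, (∫⁻ u, ‖f (y + u)‖ₑ ∂(besselMeasure E β)) ^ m :=
        lintegral_mono fun y => pow_le_pow_left₀ zero_le (enorm_besselPot_le f y) m
    _ ≤ ∫⁻ y, ∫⁻ u, ‖f (y + u)‖ₑ ^ m ∂(besselMeasure E β) :=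
        lintegral_mono fun y => lintegral_pow_le_lintegral_pow _ (by fun_prop) hm
    _ = _ := lintegral_lintegral_besselMeasure hβ (f := fun x => ‖f x‖ₑ ^ m) (by fun_prop)

theorem continuous_besselPot {β : ℝ} (hβ : 0 < β) {f : E → F} {C : ℝ} (hc : Continuous f)
    (hf : ∀ x, ‖f x‖ ≤ C) : Continuous (besselPot β f) := by
  have := isProbabilityMeasure_besselMeasure (E := E) hβ
  refine continuous_of_dominated (bound := fun _ => C)
    (fun y => (by fun_prop : Continuous fun u => f (y + u)).aestronglyMeasurable)
    (fun y => ae_of_all _ fun u => hf _) (integrable_const _) (ae_of_all _ fun u => by fun_prop)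

theorem besselPot_besselPot {α β : ℝ} (hα : 0 < α) (hβ : 0 < β) {f : E → F} {C : ℝ}
    (hc : Continuous f) (hf : ∀ x, ‖f x‖ ≤ C) :
    besselPot α (besselPot β f) = besselPot (α + β) f := by
  have h1 := isProbabilityMeasure_besselMeasure (E := E) hα
  have h2 := isProbabilityMeasure_besselMeasure (E := E) hβ
  have h3 := isProbabilityMeasure_besselMeasure (E := E) (add_pos hα hβ)
  funext y
  unfold besselPot
  rw [← besselMeasure_conv hα hβ, integral_conv]
  · simp_rw [add_assoc]
  · exact (integrable_const C).mono' (by fun_prop : Continuous fun u => f (y + u)).aestronglyMeasurable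
      (ae_of_all _ fun u => hf _)

theorem besselPot_sub {β : ℝ} (hβ : 0 < β) {f g : E → F} {C D : ℝ}
    (hc : Continuous f) (hf : ∀ x, ‖f x‖ ≤ C) (hgc : Continuous g) (hg : ∀ x, ‖g x‖ ≤ D) (y : E) :
    besselPot β (fun x => f x - g x) y = besselPot β f y - besselPot β g y := by
  have h1 := isProbabilityMeasure_besselMeasure (E := E) hβ
  exact integral_sub
    ((integrable_const C).mono' (by fun_prop : Continuous fun u => f (y + u)).aestronglyMeasurable
      (ae_of_all _ fun u => hf _))
    ((integrable_const D).mono' (by fun_prop : Continuous fun u => g (y + u)).aestronglyMeasurable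
      (ae_of_all _ fun u => hg _))

end BesselPot

end

/-! ### Identification with the Fourier multiplier; negative Sobolev spaces. -/

section

open FourierTransform in
-- The symbol is the characteristic function of `besselMeasure` at 2πξ. Fubini moves the average
-- outside, where each exponential is a translation of φ by Fourier inversion.
theorem fourier_smulLeftCLM_fourierInv_apply {d : ℕ} {α : ℝ} (hα : 0 < α)
    (φ : 𝓢(EuclideanSpace ℝ (Fin d), ℂ)) (x : EuclideanSpace ℝ (Fin d)) :
    (𝓕 (SchwartzMap.smulLeftCLM ℂ (fun ξ : EuclideanSpace ℝ (Fin d) =>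
      (((1 + ‖(2 * Real.pi) • ξ‖ ^ 2) ^ (-2 * α / 2) : ℝ) : ℂ)) (𝓕⁻ φ)) :
        𝓢(EuclideanSpace ℝ (Fin d), ℂ)) x =
      ∫ v, φ (x - v) ∂(besselMeasure (EuclideanSpace ℝ (Fin d)) α) := by
  have hJ := isProbabilityMeasure_besselMeasure (E := EuclideanSpace ℝ (Fin d)) hα
  set J := besselMeasure (EuclideanSpace ℝ (Fin d)) α
  set ψ : 𝓢(EuclideanSpace ℝ (Fin d), ℂ) := 𝓕⁻ φ with hψ
  have hinv : ∀ y, ∫ ξ, Complex.exp (((-2 * Real.pi * inner ℝ ξ y : ℝ) : ℂ) * Complex.I) * ψ ξ =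
      φ y := fun y => by
    have h1 : (𝓕 ψ : 𝓢(EuclideanSpace ℝ (Fin d), ℂ)) = φ := by rw [hψ, fourier_fourierInv_eq]
    conv_rhs => rw [← h1, SchwartzMap.fourier_coe, Real.fourier_eq']
    rfl
  rw [SchwartzMap.fourier_coe, Real.fourier_eq']
  have hg := besselSymbol_hasTemperateGrowth d (-2 * α)
  simp_rw [SchwartzMap.smulLeftCLM_apply_apply hg, smul_eq_mul]
  have e1 : ∀ ξ, (((1 + ‖(2 * Real.pi) • ξ‖ ^ 2) ^ (-2 * α / 2) : ℝ) : ℂ) =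
      ∫ v, Complex.exp ((inner ℝ v ((2 * Real.pi) • ξ) : ℝ) * Complex.I) ∂J := fun ξ => by
    rw [← charFun_apply, charFun_besselMeasure hα, show -2 * α / 2 = -α by ring]
  simp_rw [e1]
  have e2 : ∀ ξ v : EuclideanSpace ℝ (Fin d),
      Complex.exp (((-2 * Real.pi * inner ℝ ξ x : ℝ) : ℂ) * Complex.I) *
        (Complex.exp ((inner ℝ v ((2 * Real.pi) • ξ) : ℝ) * Complex.I) * ψ ξ) =
      Complex.exp (((-2 * Real.pi * inner ℝ ξ (x - v) : ℝ) : ℂ) * Complex.I) * ψ ξ := fun ξ v => by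
    rw [← mul_assoc, ← Complex.exp_add, inner_sub_right, inner_smul_right, real_inner_comm ξ v]
    congr 2
    push_cast
    ring
  simp_rw [← integral_mul_const, ← integral_const_mul, e2]
  rw [integral_integral_swap]
  · simp_rw [hinv]
  · have h1 : Integrable (fun z : EuclideanSpace ℝ (Fin d) × EuclideanSpace ℝ (Fin d) => ‖ψ z.1‖)
      ((volume : Measure (EuclideanSpace ℝ (Fin d))).prod J) :=
      (ψ.integrable (μ := volume)).norm.comp_fst J
    have h2 := ψ.continuous
    refine h1.mono' (Continuous.aestronglyMeasurable (by fun_prop)) (ae_of_all _ fun z => ?_)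
    rw [Function.uncurry, norm_mul, Complex.norm_exp_ofReal_mul_I, one_mul]

/-- By duality the multiplier acts on the test function; exchanging the integrals and translating x
moves the average from the test function to f. -/
theorem besselOp_eq_of_isFunction {d : ℕ} {α : ℝ} (hα : 0 < α)
    {f : EuclideanSpace ℝ (Fin d) → ℂ} (hf : Continuous f) {C : ℝ} (hC : ∀ x, ‖f x‖ ≤ C)
    {U V : 𝓢'(EuclideanSpace ℝ (Fin d), ℂ)} (hU : IsFunction U f)
    (hV : IsFunction V (besselPot α f)) : besselOp d (-2 * α) U = V := by
  have hJ := isProbabilityMeasure_besselMeasure (E := EuclideanSpace ℝ (Fin d)) hα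
  ext φ
  rw [besselOp, TemperedDistribution.fourierMultiplierCLM_apply_apply, (hU _).2, (hV _).2]
  simp_rw [fourier_smulLeftCLM_fourierInv_apply hα]
  set J := besselMeasure (EuclideanSpace ℝ (Fin d)) α
  unfold besselPot
  have hφ := φ.continuous
  simp_rw [← integral_mul_const, ← integral_const_mul]
  have hi1 : Integrable (Function.uncurry fun (v x : EuclideanSpace ℝ (Fin d)) => φ x * f (x + v))
      (J.prod volume) := by
    have h1 : Integrable (fun z : EuclideanSpace ℝ (Fin d) × EuclideanSpace ℝ (Fin d) =>
        C * ‖φ z.2‖) (J.prod volume) :=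
      ((φ.integrable (μ := volume)).norm.comp_snd J).const_mul C
    refine h1.mono' (Continuous.aestronglyMeasurable (by fun_prop)) (ae_of_all _ fun z => ?_)
    rw [Function.uncurry, norm_mul, mul_comm]
    exact mul_le_mul_of_nonneg_right (hC _) (norm_nonneg _)
  have hi2 : Integrable (Function.uncurry fun (v x : EuclideanSpace ℝ (Fin d)) => φ (x - v) * f x)
      (J.prod volume) := by
    refine (integrable_prod_iff (Continuous.aestronglyMeasurable (by fun_prop))).mpr ⟨?_, ?_⟩
    · refine ae_of_all _ fun v => ?_
      have h1 : Integrable (fun x => C * ‖φ (x - v)‖) :=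
        (((φ.integrable (μ := volume)).comp_sub_right v).norm).const_mul C
      refine h1.mono' (Continuous.aestronglyMeasurable (by fun_prop)) (ae_of_all _ fun z => ?_)
      rw [Function.uncurry, norm_mul, mul_comm]
      exact mul_le_mul_of_nonneg_right (hC _) (norm_nonneg _)
    · have e : ∀ v, ∫ x, ‖Function.uncurry (fun (v x : EuclideanSpace ℝ (Fin d)) =>
          φ (x - v) * f x) (v, x)‖ = ∫ x, ‖Function.uncurry (fun (v x : EuclideanSpace ℝ (Fin d)) =>
          φ x * f (x + v)) (v, x)‖ := fun v => by
        rw [← integral_add_right_eq_self _ v]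
        simp [Function.uncurry]
      simp_rw [e]
      exact hi1.integral_norm_prod_left
  rw [← integral_integral_swap hi2, ← integral_integral_swap hi1]
  refine integral_congr_ae (ae_of_all _ fun v => ?_)
  simp only
  rw [← integral_add_right_eq_self _ v]
  simp

namespace SobolevSpace

variable {d : ℕ} {s : ℝ} {p : ℝ≥0∞} [Fact (1 ≤ p)]

theorem isometry_toLp : Isometry
    (toLp : SobolevSpace d s p →ₗ[ℂ] Lp ℂ p (volume : Measure (EuclideanSpace ℝ (Fin d)))) :=
  AddMonoidHomClass.isometry_of_norm _ fun _ => rfl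

/-- The Bessel operators of opposite orders are inverse to each other, so `toLp` is onto.
Completeness of the Sobolev space is thus inherited from L^p. -/
theorem exists_of_toLp (g : Lp ℂ p (volume : Measure (EuclideanSpace ℝ (Fin d)))) :
    ∃ w : SobolevSpace d s p, w.toLp = g ∧
      w.toDistribution = besselOp d (-s) (Lp.toTemperedDistributionCLM ℂ volume p g) := by
  have h := besselOp_neg_besselOp d (-s) (Lp.toTemperedDistributionCLM ℂ volume p g)
  rw [neg_neg] at h
  refine ⟨⟨besselOp d (-s) (Lp.toTemperedDistributionCLM ℂ volume p g), ⟨g, h.symm⟩⟩, ?_, rfl⟩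
  apply toTemperedDistribution_injective d p
  exact (toLp_spec _).trans h

instance : CompleteSpace (SobolevSpace d s p) := by
  have h : IsUniformInducing
      (toLp : SobolevSpace d s p →ₗ[ℂ] Lp ℂ p (volume : Measure (EuclideanSpace ℝ (Fin d)))) :=
    isometry_toLp.isUniformInducing
  rw [completeSpace_iff_isComplete_range h, Set.range_eq_univ.mpr fun g => ?_]
  · exact isComplete_univ
  · obtain ⟨w, hw, -⟩ := exists_of_toLp (s := s) g
    exact ⟨w, hw⟩

/-- This allows limits taken in different Sobolev spaces to be compared as distributions. -/
theorem continuous_toDistribution :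
    Continuous (toDistribution : SobolevSpace d s p → 𝓢'(EuclideanSpace ℝ (Fin d), ℂ)) := by
  have e : (toDistribution : SobolevSpace d s p → 𝓢'(EuclideanSpace ℝ (Fin d), ℂ)) =
      fun w => besselOp d (-s) (Lp.toTemperedDistributionCLM ℂ volume p w.toLp) := by
    funext w
    rw [toLp_spec, besselOp_neg_besselOp]
  rw [e]
  exact (besselOp d (-s)).continuous.comp
    ((Lp.toTemperedDistributionCLM ℂ volume p).continuous.comp isometry_toLp.continuous)

end SobolevSpace

/-- From |f|^p ≤ R^(p-2) |f|²: control in L² and in L^∞ settles all exponents 2 ≤ p ≤ ∞ at once. -/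
theorem eLpNorm_le_of_two_le {X F : Type*} [MeasurableSpace X] [NormedAddCommGroup F]
    {μ : Measure X} {f : X → F} {R : ℝ≥0∞} (h1 : ∀ x, ‖f x‖ₑ ≤ R)
    (h2 : ∫⁻ x, ‖f x‖ₑ ^ 2 ∂μ ≤ R ^ 2) {p : ℝ≥0∞} (hp : 2 ≤ p) : eLpNorm f p μ ≤ R := by
  rcases eq_or_ne p ⊤ with rfl | hp'
  · rw [eLpNorm_exponent_top]
    exact eLpNormEssSup_le_of_ae_enorm_bound (ae_of_all _ h1)
  have hp0 : p ≠ 0 := (lt_of_lt_of_le (by norm_num) hp).ne'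
  have hr : (2 : ℝ) ≤ p.toReal := by
    have := ENNReal.toReal_mono hp' hp
    simpa using this
  rw [eLpNorm_eq_lintegral_rpow_enorm_toReal hp0 hp']
  have hr0 : 0 < p.toReal := by linarith
  rw [one_div, ENNReal.rpow_inv_le_iff hr0]
  have e : ∀ y : ℝ≥0∞, y ^ p.toReal = y ^ (p.toReal - 2) * y ^ 2 := fun y => by
    rw [← ENNReal.rpow_natCast, ← ENNReal.rpow_add_of_nonneg _ _ (by linarith) (by norm_num)]
    norm_num
  calc ∫⁻ x, ‖f x‖ₑ ^ p.toReal ∂μ ≤ ∫⁻ x, R ^ (p.toReal - 2) * ‖f x‖ₑ ^ 2 ∂μ := by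
        refine lintegral_mono fun x => ?_
        simp only
        rw [e]
        gcongr
        exact h1 x
    _ ≤ R ^ (p.toReal - 2) * R ^ 2 := by
        rcases eq_or_ne R ⊤ with rfl | hR
        · rw [ENNReal.top_pow (by norm_num)]
          by_cases h0 : (⊤ : ℝ≥0∞) ^ (p.toReal - 2) = 0
          · simp [h0]
          · rw [ENNReal.mul_top h0]; exact le_top
        · rw [lintegral_const_mul' _ _ (ENNReal.rpow_ne_top_of_nonneg (by linarith) hR)]
          gcongr
    _ = _ := (e R).symm

theorem isFunction_toTemperedDistribution {d : ℕ} {p : ℝ≥0∞} [Fact (1 ≤ p)]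
    {f : EuclideanSpace ℝ (Fin d) → ℂ} (hf : MemLp f p) :
    IsFunction (Lp.toTemperedDistributionCLM ℂ volume p (hf.toLp f)) f := by
  intro φ
  have : p.HolderConjugate (ENNReal.conjExponent p) := .conjExponent Fact.out
  have : (ENNReal.conjExponent p).HolderTriple p 1 := ENNReal.HolderConjugate.symm
  refine ⟨(φ.memLp (ENNReal.conjExponent p) volume).integrable_mul hf, ?_⟩
  rw [Lp.toTemperedDistributionCLM_apply, Lp.toTemperedDistribution_apply]
  refine integral_congr_ae ?_
  filter_upwards [hf.coeFn_toLp] with x hx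
  rw [hx, smul_eq_mul]

theorem memLp_besselPot {d : ℕ} {α : ℝ} (hα : 0 < α) {f : EuclideanSpace ℝ (Fin d) → ℂ}
    (hf : Continuous f) (hfc : HasCompactSupport f) {p : ℝ≥0∞} (hp : 2 ≤ p) :
    MemLp (besselPot α f) p := by
  obtain ⟨C, hC⟩ := hf.bounded_above_of_compact_support hfc
  have hc := continuous_besselPot hα hf hC
  refine ⟨hc.aestronglyMeasurable, ?_⟩
  have h2 := hf.memLp_of_hasCompactSupport (p := 2) (μ := volume) hfc
  have h3 : ∫⁻ x, ‖f x‖ₑ ^ 2 < ⊤ := by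
    have := eLpNorm_nnreal_pow_eq_lintegral (μ := volume) (f := f) (p := 2) (by norm_num)
    simp only [NNReal.coe_ofNat, ENNReal.rpow_ofNat] at this
    rw [← this]
    exact ENNReal.pow_lt_top h2.eLpNorm_lt_top
  set A := ∫⁻ x, ‖f x‖ₑ ^ 2
  refine (eLpNorm_le_of_two_le (R := ENNReal.ofReal C + (1 + A)) (fun x => ?_) ?_ hp).trans_lt
    (ENNReal.add_lt_top.mpr ⟨ENNReal.ofReal_lt_top, ENNReal.add_lt_top.mpr ⟨by simp, h3⟩⟩)
  · refine le_trans ?_ le_self_add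
    rw [← ofReal_norm]
    exact ENNReal.ofReal_le_ofReal (norm_besselPot_le hα hC x)
  · refine (lintegral_enorm_besselPot_pow_le hα hf.measurable two_ne_zero).trans ?_
    have h4 : (1 : ℝ≥0∞) ≤ 1 + A := le_self_add
    calc A ≤ (1 + A) := le_add_self
      _ ≤ (1 + A) ^ 2 := by rw [sq]; exact le_mul_of_one_le_left zero_le h4
      _ ≤ _ := pow_le_pow_left₀ zero_le le_add_self 2

/-- Continuous functions with compact support as elements of a Sobolev space of negative order. -/
theorem exists_sobolevSpace_isFunction {d : ℕ} {α : ℝ} (hα : 0 < α)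
    {f : EuclideanSpace ℝ (Fin d) → ℂ} (hf : Continuous f) (hfc : HasCompactSupport f)
    {p : ℝ≥0∞} [Fact (1 ≤ p)] (hp : 2 ≤ p) :
    ∃ w : SobolevSpace d (-2 * α) p, IsFunction w.toDistribution f ∧
      w.toLp =ᵐ[volume] besselPot α f := by
  obtain ⟨C, hC⟩ := hf.bounded_above_of_compact_support hfc
  have h2 := hf.memLp_of_hasCompactSupport (p := 2) (μ := volume) hfc
  have hS := memLp_besselPot hα hf hfc hp
  set U := Lp.toTemperedDistributionCLM ℂ volume 2 (h2.toLp f)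
  have hU := isFunction_toTemperedDistribution h2
  have h := besselOp_eq_of_isFunction hα hf hC hU (isFunction_toTemperedDistribution hS)
  obtain ⟨w, hw, hw'⟩ := SobolevSpace.exists_of_toLp (s := -2 * α) (hS.toLp _)
  refine ⟨w, ?_, ?_⟩
  · rw [hw', ← h, besselOp_neg_besselOp]
    exact hU
  · rw [hw]
    exact hS.coeFn_toLp

theorem SobolevSpace.dist_eq_of_ae {d : ℕ} {s : ℝ} {p : ℝ≥0∞} [Fact (1 ≤ p)]
    {w w' : SobolevSpace d s p} {g g' : EuclideanSpace ℝ (Fin d) → ℂ}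
    (hw : w.toLp =ᵐ[volume] g) (hw' : w'.toLp =ᵐ[volume] g') :
    dist w w' = (eLpNorm (fun x => g x - g' x) p volume).toReal := by
  rw [← isometry_toLp.dist_eq, Lp.dist_def]
  congr 1
  refine eLpNorm_congr_ae ?_
  filter_upwards [hw, hw'] with x h1 h2
  rw [Pi.sub_apply, h1, h2]

end

/-! ### Bounds for γ_t and energies of spatial kernels. -/

section

section GammaFun

theorem norm_integral_exp_mul_le_abs_sub (a s t : ℝ) :
    ‖∫ τ in s..t, Complex.exp (Complex.I * τ * a)‖ ≤ |t - s| := by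
  have h := intervalIntegral.norm_integral_le_of_norm_le_const (a := s) (b := t) (C := 1)
    (f := fun τ : ℝ => Complex.exp (Complex.I * τ * a)) (fun τ _ => by
      rw [show Complex.I * τ * a = ((τ * a : ℝ) : ℂ) * Complex.I by push_cast; ring,
        Complex.norm_exp_ofReal_mul_I])
  simpa using h

theorem norm_integral_exp_mul_mul_abs_le (a t : ℝ) :
    ‖∫ τ in (0 : ℝ)..t, Complex.exp (Complex.I * τ * a)‖ * |a| ≤ 2 := by
  rcases eq_or_ne a 0 with rfl | ha
  · simp
  have hc : Complex.I * (a : ℂ) ≠ 0 := mul_ne_zero Complex.I_ne_zero (by exact_mod_cast ha)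
  have e : ∀ τ : ℝ, Complex.exp (Complex.I * τ * a) = Complex.exp (Complex.I * a * τ) :=
    fun τ => by ring_nf
  simp_rw [e]
  rw [integral_exp_mul_complex hc, norm_div, norm_mul, Complex.norm_I, one_mul, Complex.norm_real,
    Real.norm_eq_abs, div_mul_cancel₀ _ (abs_pos.mpr ha).ne']
  refine (norm_sub_le _ _).trans ?_
  rw [show Complex.I * a * t = ((a * t : ℝ) : ℂ) * Complex.I by push_cast; ring,
    Complex.norm_exp_ofReal_mul_I]
  norm_num

theorem gammaFun_eq (t ξ r : ℝ) : gammaFun t ξ r = Complex.exp (Complex.I * ξ * t) *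
    ∫ s in (0 : ℝ)..t, Complex.exp (Complex.I * s * ((r ^ 2 - ξ : ℝ) : ℂ)) := by
  unfold gammaFun; push_cast; rfl

theorem norm_exp_I_mul_mul (a b : ℝ) : ‖Complex.exp (Complex.I * a * b)‖ = 1 := by
  rw [show Complex.I * a * b = ((a * b : ℝ) : ℂ) * Complex.I by push_cast; ring,
    Complex.norm_exp_ofReal_mul_I]

theorem norm_gammaFun_le (t ξ r : ℝ) : ‖gammaFun t ξ r‖ ≤ |t| := by
  rw [gammaFun_eq, norm_mul, norm_exp_I_mul_mul, one_mul]
  simpa only [sub_zero] using norm_integral_exp_mul_le_abs_sub (r ^ 2 - ξ) 0 t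

/-- The sum of two bounds: the trivial one by |t|, and the one obtained by integrating the
oscillating exponential explicitly, which gains 2 / |r² - ξ|. -/
theorem norm_gammaFun_sq_le (t ξ r : ℝ) :
    ‖gammaFun t ξ r‖ ^ 2 ≤ (t ^ 2 + 4) / (1 + (r ^ 2 - ξ) ^ 2) := by
  rw [le_div_iff₀ (by positivity)]
  have h1 := norm_gammaFun_le t ξ r
  have h2 : ‖gammaFun t ξ r‖ * |r ^ 2 - ξ| ≤ 2 := by
    rw [gammaFun_eq, norm_mul, norm_exp_I_mul_mul, one_mul]
    exact norm_integral_exp_mul_mul_abs_le _ t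
  have h3 : (‖gammaFun t ξ r‖ * |r ^ 2 - ξ|) ^ 2 ≤ 2 ^ 2 := by gcongr
  have h4 : ‖gammaFun t ξ r‖ ^ 2 ≤ |t| ^ 2 := by gcongr
  rw [mul_pow, sq_abs] at h3
  rw [sq_abs] at h4
  linarith

/-- Time enters through the phase, which costs |ξ| per unit of time, and through the upper limit of
the integral, which costs 1. -/
theorem norm_gammaFun_sub_le (s t ξ r : ℝ) :
    ‖gammaFun t ξ r - gammaFun s ξ r‖ ≤ (1 + |ξ| * |t|) * |t - s| := by
  have hi : ∀ a b : ℝ, IntervalIntegrable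
      (fun τ : ℝ => Complex.exp (Complex.I * τ * ((r ^ 2 - ξ : ℝ) : ℂ))) volume a b :=
    fun a b => (by fun_prop : Continuous _).intervalIntegrable _ _
  rw [gammaFun_eq, gammaFun_eq]
  have e := intervalIntegral.integral_add_adjacent_intervals (hi 0 s) (hi s t)
  have h1 : ‖Complex.exp (Complex.I * ξ * t) - Complex.exp (Complex.I * ξ * s)‖ ≤ |ξ| * |t - s| := by
    have e2 : Complex.exp (Complex.I * ξ * t) - Complex.exp (Complex.I * ξ * s) =
        Complex.exp (Complex.I * ξ * s) * (Complex.exp (Complex.I * (ξ * (t - s) : ℝ)) - 1) := by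
      rw [mul_sub, ← Complex.exp_add, mul_one]
      congr 2
      push_cast; ring
    rw [e2, norm_mul, norm_exp_I_mul_mul, one_mul]
    refine (Real.norm_exp_I_mul_ofReal_sub_one_le).trans ?_
    rw [Real.norm_eq_abs, abs_mul]
  have h2 := norm_integral_exp_mul_le_abs_sub (r ^ 2 - ξ) s t
  have h3 := norm_integral_exp_mul_le_abs_sub (r ^ 2 - ξ) 0 t
  rw [sub_zero] at h3
  have e3 : Complex.exp (Complex.I * ξ * t) *
      (∫ τ in (0 : ℝ)..t, Complex.exp (Complex.I * τ * ((r ^ 2 - ξ : ℝ) : ℂ))) -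
      Complex.exp (Complex.I * ξ * s) *
      (∫ τ in (0 : ℝ)..s, Complex.exp (Complex.I * τ * ((r ^ 2 - ξ : ℝ) : ℂ))) =
      (Complex.exp (Complex.I * ξ * t) - Complex.exp (Complex.I * ξ * s)) *
      (∫ τ in (0 : ℝ)..t, Complex.exp (Complex.I * τ * ((r ^ 2 - ξ : ℝ) : ℂ))) +
      Complex.exp (Complex.I * ξ * s) *
      (∫ τ in s..t, Complex.exp (Complex.I * τ * ((r ^ 2 - ξ : ℝ) : ℂ))) := by
    rw [← e]; ring
  rw [e3]
  calc _ ≤ (|ξ| * |t - s|) * |t| + 1 * |t - s| := by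
        refine (norm_add_le _ _).trans ?_
        rw [norm_mul, norm_mul, norm_exp_I_mul_mul]
        gcongr
    _ = _ := by ring

theorem continuous_gammaFun (t : ℝ) : Continuous fun p : ℝ × ℝ => gammaFun t p.1 p.2 := by
  unfold gammaFun
  refine Continuous.mul (by fun_prop) ?_
  exact intervalIntegral.continuous_parametric_intervalIntegral_of_continuous' (by fun_prop) _ _

end GammaFun

variable {d : ℕ}

theorem measurableSet_freqDomain (n : ℕ+) : MeasurableSet (freqDomain d n) := by
  have h1 : MeasurableSet {z : ℝ × EuclideanSpace ℝ (Fin d) | |z.1| ≤ 2 ^ (2 * (n : ℕ))} :=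
    measurableSet_le (by fun_prop) (by fun_prop)
  have h2 : MeasurableSet {z : ℝ × EuclideanSpace ℝ (Fin d) | ‖z.2‖ ≤ 2 ^ (n : ℕ)} :=
    measurableSet_le (by fun_prop) (by fun_prop)
  exact h1.inter h2

theorem freqDomain_mono {n m : ℕ+} (h : n ≤ m) : freqDomain d n ⊆ freqDomain d m := by
  have h' : (n : ℕ) ≤ m := h
  intro z hz
  refine ⟨hz.1.trans ?_, hz.2.trans ?_⟩
  · exact pow_le_pow_right₀ (by norm_num) (by omega)
  · exact pow_le_pow_right₀ (by norm_num) h'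

/-- The inverse Fourier transform in space of the restriction of `f` to `S`, integrated over the
time frequency. -/
noncomputable def waveKernel (S : Set (ℝ × EuclideanSpace ℝ (Fin d)))
    (f : ℝ × EuclideanSpace ℝ (Fin d) → ℂ) (v : EuclideanSpace ℝ (Fin d)) : ℂ :=
  ∫ z in S, f z * Complex.exp (Complex.I * (inner ℝ z.2 v : ℝ))

theorem norm_exp_I_mul_ofReal (a : ℝ) : ‖Complex.exp (Complex.I * a)‖ = 1 := by
  rw [mul_comm, Complex.norm_exp_ofReal_mul_I]

theorem integrable_waveKernel {S : Set (ℝ × EuclideanSpace ℝ (Fin d))}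
    {f : ℝ × EuclideanSpace ℝ (Fin d) → ℂ} (hf : IntegrableOn f S) (v : EuclideanSpace ℝ (Fin d)) :
    IntegrableOn (fun z => f z * Complex.exp (Complex.I * (inner ℝ z.2 v : ℝ))) S := by
  have hf' : Integrable f (volume.restrict S) := hf
  refine Integrable.mono hf' (hf'.1.mul (Continuous.aestronglyMeasurable (by fun_prop)))
    (ae_of_all _ fun z => ?_)
  rw [norm_mul, norm_exp_I_mul_ofReal, mul_one]

theorem norm_waveKernel_le (S : Set (ℝ × EuclideanSpace ℝ (Fin d)))
    (f : ℝ × EuclideanSpace ℝ (Fin d) → ℂ) (v : EuclideanSpace ℝ (Fin d)) :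
    ‖waveKernel S f v‖ ≤ ∫ z in S, ‖f z‖ := by
  refine (norm_integral_le_integral_norm _).trans (le_of_eq ?_)
  simp_rw [norm_mul, norm_exp_I_mul_ofReal, mul_one]

theorem waveKernel_diff {S S' : Set (ℝ × EuclideanSpace ℝ (Fin d))} (hS : MeasurableSet S)
    (h : S ⊆ S') {f : ℝ × EuclideanSpace ℝ (Fin d) → ℂ} (hf : IntegrableOn f S')
    (v : EuclideanSpace ℝ (Fin d)) :
    waveKernel S' f v = waveKernel S f v + waveKernel (S' \ S) f v := by
  have := setIntegral_sdiff hS (integrable_waveKernel hf v) h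
  unfold waveKernel
  rw [this]; ring

theorem waveKernel_sub {S : Set (ℝ × EuclideanSpace ℝ (Fin d))}
    {f g : ℝ × EuclideanSpace ℝ (Fin d) → ℂ} (hf : IntegrableOn f S) (hg : IntegrableOn g S)
    (v : EuclideanSpace ℝ (Fin d)) :
    waveKernel S f v - waveKernel S g v = waveKernel S (fun z => f z - g z) v := by
  unfold waveKernel
  rw [← integral_sub (integrable_waveKernel hf v) (integrable_waveKernel hg v)]
  simp_rw [sub_mul]

/-- The difference of two independent variables of law J_α has the squared modulus of a
characteristic function as its own; the exponent doubles. -/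
theorem integral_besselMeasure_exp {α : ℝ} (hα : 0 < α) (η η' : EuclideanSpace ℝ (Fin d)) :
    ∫ p : EuclideanSpace ℝ (Fin d) × EuclideanSpace ℝ (Fin d),
      Complex.exp (Complex.I * (inner ℝ (η - η') (p.1 - p.2) : ℝ))
        ∂((besselMeasure (EuclideanSpace ℝ (Fin d)) α).prod (besselMeasure _ α)) =
      (((1 + ‖η - η'‖ ^ 2) ^ (-(2 * α)) : ℝ) : ℂ) := by
  have hJ := isProbabilityMeasure_besselMeasure (E := EuclideanSpace ℝ (Fin d)) hα
  have h1 := charFun_besselMeasure hα (η - η')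
  have h2 := charFun_besselMeasure hα (η' - η)
  rw [charFun_apply] at h1 h2
  have e : ∀ p : EuclideanSpace ℝ (Fin d) × EuclideanSpace ℝ (Fin d),
      Complex.exp (Complex.I * (inner ℝ (η - η') (p.1 - p.2) : ℝ)) =
      Complex.exp ((inner ℝ p.1 (η - η') : ℝ) * Complex.I) *
        Complex.exp ((inner ℝ p.2 (η' - η) : ℝ) * Complex.I) := fun p => by
    rw [← Complex.exp_add, inner_sub_right (η - η'), real_inner_comm (p.1), real_inner_comm (p.2),
      ← neg_sub η η', inner_neg_right]
    congr 1
    push_cast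
    ring
  simp_rw [e]
  rw [integral_prod_mul (fun u => Complex.exp ((inner ℝ u (η - η') : ℝ) * Complex.I))
    (fun u => Complex.exp ((inner ℝ u (η' - η) : ℝ) * Complex.I)), h1, h2, norm_sub_rev η' η,
    ← Complex.ofReal_mul, ← Real.rpow_add (by positivity)]
  ring_nf

/-- The energy of the restriction of `g` to `S` for the kernel of the Bessel potential of order
`4 α`. -/
noncomputable def besselEnergy (α : ℝ) (S : Set (ℝ × EuclideanSpace ℝ (Fin d)))
    (g : ℝ × EuclideanSpace ℝ (Fin d) → ℝ≥0∞) : ℝ≥0∞ :=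
  ∫⁻ z in S, ∫⁻ w in S, g z * g w * ENNReal.ofReal ((1 + ‖z.2 - w.2‖ ^ 2) ^ (-(2 * α)))

theorem continuous_bessel_weight (α : ℝ) : Continuous fun q : (ℝ × EuclideanSpace ℝ (Fin d)) ×
    (ℝ × EuclideanSpace ℝ (Fin d)) => (1 + ‖q.1.2 - q.2.2‖ ^ 2) ^ (-(2 * α)) :=
  Continuous.rpow_const (by fun_prop) fun q => Or.inl (by positivity)

/-- The squared modulus is expanded into a double integral over frequencies, whose phase depends
only on the difference of the momenta. Averaging the phase under J_α × J_α gives the kernel of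
`besselEnergy`; the inequality arises from taking absolute values of f. -/
theorem lintegral_enorm_waveKernel_sq_le {α : ℝ} (hα : 0 < α)
    {S : Set (ℝ × EuclideanSpace ℝ (Fin d))} {f : ℝ × EuclideanSpace ℝ (Fin d) → ℂ}
    (hf : IntegrableOn f S) :
    ∫⁻ p, ‖waveKernel S f (p.1 - p.2)‖ₑ ^ 2
      ∂((besselMeasure (EuclideanSpace ℝ (Fin d)) α).prod (besselMeasure _ α)) ≤
      besselEnergy α S fun z => ‖f z‖ₑ := by
  have hJ := isProbabilityMeasure_besselMeasure (E := EuclideanSpace ℝ (Fin d)) hα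
  set J := besselMeasure (EuclideanSpace ℝ (Fin d)) α
  set μ : Measure (ℝ × EuclideanSpace ℝ (Fin d)) := volume.restrict S
  set G : (ℝ × EuclideanSpace ℝ (Fin d)) × (ℝ × EuclideanSpace ℝ (Fin d)) →
      EuclideanSpace ℝ (Fin d) × EuclideanSpace ℝ (Fin d) → ℂ := fun q p =>
    (f q.1 * (starRingEnd ℂ) (f q.2)) *
      Complex.exp (Complex.I * (inner ℝ (q.1.2 - q.2.2) (p.1 - p.2) : ℝ)) with hG
  have hf' : Integrable f μ := hf
  have hff : Integrable (fun q : (ℝ × EuclideanSpace ℝ (Fin d)) × (ℝ × EuclideanSpace ℝ (Fin d)) =>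
      f q.1 * (starRingEnd ℂ) (f q.2)) (μ.prod μ) :=
    hf'.mul_prod ((LinearIsometryEquiv.integrable_comp_iff Complex.conjLIE).mpr hf')
  have hGi : Integrable (Function.uncurry G) ((μ.prod μ).prod (J.prod J)) := by
    refine (hff.comp_fst (J.prod J)).mono
      ((hff.comp_fst (J.prod J)).1.mul (Continuous.aestronglyMeasurable (by fun_prop)))
      (ae_of_all _ fun q => ?_)
    rw [Function.uncurry, hG, norm_mul, norm_exp_I_mul_ofReal, mul_one]
  have e1 : ∀ p, ∫ q, G q p ∂(μ.prod μ) = ((‖waveKernel S f (p.1 - p.2)‖ ^ 2 : ℝ) : ℂ) := by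
    intro p
    have e : ∀ q, G q p = (f q.1 * Complex.exp (Complex.I * (inner ℝ q.1.2 (p.1 - p.2) : ℝ))) *
        (starRingEnd ℂ) (f q.2 * Complex.exp (Complex.I * (inner ℝ q.2.2 (p.1 - p.2) : ℝ))) := by
      intro q
      simp only [hG, map_mul, ← Complex.exp_conj, Complex.conj_I, Complex.conj_ofReal,
        inner_sub_left]
      rw [mul_mul_mul_comm, ← Complex.exp_add]
      congr 2
      push_cast
      ring
    simp_rw [e]
    rw [integral_prod_mul (fun z : ℝ × EuclideanSpace ℝ (Fin d) =>
      f z * Complex.exp (Complex.I * (inner ℝ z.2 (p.1 - p.2) : ℝ)))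
      (fun z => (starRingEnd ℂ) (f z * Complex.exp (Complex.I * (inner ℝ z.2 (p.1 - p.2) : ℝ)))),
      integral_conj, Complex.mul_conj, Complex.normSq_eq_norm_sq]
    rfl
  have e2 : ∀ q, ∫ p, G q p ∂(J.prod J) = (f q.1 * (starRingEnd ℂ) (f q.2)) *
      (((1 + ‖q.1.2 - q.2.2‖ ^ 2) ^ (-(2 * α)) : ℝ) : ℂ) := by
    intro q
    simp only [hG]
    rw [integral_const_mul, integral_besselMeasure_exp hα]
  have hsw := integral_integral_swap hGi
  simp_rw [e1, e2] at hsw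
  have hi : Integrable (fun p : EuclideanSpace ℝ (Fin d) × EuclideanSpace ℝ (Fin d) =>
      ‖waveKernel S f (p.1 - p.2)‖ ^ 2) (J.prod J) := by
    have h := hGi.integral_prod_right
    simp only [Function.uncurry_apply_pair, e1] at h
    exact h.re.congr (ae_of_all _ fun p => Complex.ofReal_re _)
  have e3 : ∀ p : EuclideanSpace ℝ (Fin d) × EuclideanSpace ℝ (Fin d),
      ‖waveKernel S f (p.1 - p.2)‖ₑ ^ 2 = ENNReal.ofReal (‖waveKernel S f (p.1 - p.2)‖ ^ 2) :=
    fun p => by rw [ENNReal.ofReal_pow (norm_nonneg _), ofReal_norm]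
  simp_rw [e3]
  rw [← ofReal_integral_eq_lintegral_ofReal hi (ae_of_all _ fun _ => sq_nonneg _)]
  have hcast : ENNReal.ofReal (∫ p, ‖waveKernel S f (p.1 - p.2)‖ ^ 2 ∂(J.prod J)) =
      ‖∫ p, ((‖waveKernel S f (p.1 - p.2)‖ ^ 2 : ℝ) : ℂ) ∂(J.prod J)‖ₑ := by
    rw [integral_complex_ofReal, ← ofReal_norm, Complex.norm_real, Real.norm_eq_abs,
      abs_of_nonneg (integral_nonneg fun _ => sq_nonneg _)]
  rw [hcast, ← hsw]
  refine (enorm_integral_le_lintegral_enorm _).trans (le_of_eq ?_)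
  have hw := continuous_bessel_weight (d := d) α
  rw [lintegral_prod _ (by
    refine AEStronglyMeasurable.enorm (hff.1.mul ?_)
    exact (Complex.continuous_ofReal.comp hw).aestronglyMeasurable)]
  unfold besselEnergy
  refine lintegral_congr fun z => lintegral_congr fun w => ?_
  rw [enorm_mul, enorm_mul, RCLike.enorm_conj]
  congr 1
  rw [← ofReal_norm, Complex.norm_real, Real.norm_eq_abs, abs_of_nonneg (by positivity)]

end

/-! ### Covariance densities, their energy and their truncation. -/

section

variable {d : ℕ}

/-- The spectral density of the covariance (`b = true`) or of the pseudo-covariance (`b = false`)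
of the linear solutions at the times `s` and `t`. -/
noncomputable def covDensity (H : Fin (d + 1) → ℝ) (b : Bool) (s t : ℝ)
    (z : ℝ × EuclideanSpace ℝ (Fin d)) : ℂ :=
  (spectralWeight H z : ℂ) * gammaFun s z.1 ‖z.2‖ *
    (if b then (starRingEnd ℂ) (gammaFun t z.1 ‖z.2‖) else gammaFun t (-z.1) ‖z.2‖)

section Pointwise

variable (H : Fin (d + 1) → ℝ)

theorem measurable_gammaFun (t : ℝ) : Measurable fun z : ℝ × EuclideanSpace ℝ (Fin d) =>
    gammaFun t z.1 ‖z.2‖ :=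
  ((continuous_gammaFun t).comp (by fun_prop : Continuous fun z : ℝ × EuclideanSpace ℝ (Fin d) =>
    (z.1, ‖z.2‖))).measurable

theorem measurable_gammaFun_neg (t : ℝ) : Measurable fun z : ℝ × EuclideanSpace ℝ (Fin d) =>
    gammaFun t (-z.1) ‖z.2‖ :=
  ((continuous_gammaFun t).comp (by fun_prop : Continuous fun z : ℝ × EuclideanSpace ℝ (Fin d) =>
    (-z.1, ‖z.2‖))).measurable

theorem measurable_covDensity (b : Bool) (s t : ℝ) : Measurable (covDensity H b s t) := by
  unfold covDensity
  have h1 := measurable_spectralWeight H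
  have h2 := measurable_gammaFun (d := d) s
  have h3 := measurable_gammaFun (d := d) t
  have h4 := measurable_gammaFun_neg (d := d) t
  refine (h1.complex_ofReal.mul h2).mul ?_
  cases b
  · simpa using h4
  · exact Complex.continuous_conj.measurable.comp h3

/-- As r² ≥ 0, the number |ξ| is at least as close to r² as ξ is. The resulting bound is even in ξ
and so serves the pseudo-covariance, where γ is evaluated at -ξ. -/
theorem sq_sub_abs_le (r x : ℝ) : (r ^ 2 - |x|) ^ 2 ≤ (r ^ 2 - x) ^ 2 := by
  rw [sq_le_sq]
  rcases abs_cases x with ⟨h, _⟩ | ⟨h, h2⟩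
  · rw [h]
  · rw [h]
    have := sq_nonneg r
    rw [abs_of_nonneg (a := r ^ 2 - x) (by linarith), abs_le]
    constructor <;> linarith

theorem norm_gammaFun_sq_le_abs {T t : ℝ} (ht : |t| ≤ T) (ξ r : ℝ) :
    ‖gammaFun t ξ r‖ ^ 2 ≤ (T ^ 2 + 4) / (1 + (r ^ 2 - |ξ|) ^ 2) := by
  refine (norm_gammaFun_sq_le t ξ r).trans ?_
  have h1 := sq_sub_abs_le r ξ
  have h2 : t ^ 2 ≤ T ^ 2 := by rw [← sq_abs t]; gcongr
  gcongr

theorem norm_covDensity (b : Bool) (s t : ℝ) (z : ℝ × EuclideanSpace ℝ (Fin d)) :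
    ‖covDensity H b s t z‖ = spectralWeight H z * ‖gammaFun s z.1 ‖z.2‖‖ *
      ‖gammaFun t (if b then z.1 else -z.1) ‖z.2‖‖ := by
  unfold covDensity
  rw [norm_mul, norm_mul, Complex.norm_real, Real.norm_eq_abs, abs_of_nonneg
    (spectralWeight_nonneg H z)]
  cases b <;> simp

theorem norm_covDensity_sub (b : Bool) (s t t' : ℝ) (z : ℝ × EuclideanSpace ℝ (Fin d)) :
    ‖covDensity H b s t z - covDensity H b s t' z‖ = spectralWeight H z * ‖gammaFun s z.1 ‖z.2‖‖ *
      ‖gammaFun t (if b then z.1 else -z.1) ‖z.2‖ -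
        gammaFun t' (if b then z.1 else -z.1) ‖z.2‖‖ := by
  unfold covDensity
  rw [← mul_sub, norm_mul, norm_mul, Complex.norm_real, Real.norm_eq_abs, abs_of_nonneg
    (spectralWeight_nonneg H z)]
  cases b
  · simp
  · simp [← map_sub]

theorem norm_covDensity_le_resonantWeight {T s t : ℝ} (hs : |s| ≤ T) (ht : |t| ≤ T) (b : Bool)
    (z : ℝ × EuclideanSpace ℝ (Fin d)) :
    ‖covDensity H b s t z‖ ≤ (T ^ 2 + 4) * resonantWeight H z := by
  rw [norm_covDensity]
  have h1 := norm_gammaFun_sq_le_abs hs z.1 ‖z.2‖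
  have h2 := norm_gammaFun_sq_le_abs ht (if b then z.1 else -z.1) ‖z.2‖
  have e : |if b then z.1 else -z.1| = |z.1| := by cases b <;> simp
  rw [e] at h2
  have h3 : ‖gammaFun s z.1 ‖z.2‖‖ * ‖gammaFun t (if b then z.1 else -z.1) ‖z.2‖‖ ≤
      (T ^ 2 + 4) / (1 + (‖z.2‖ ^ 2 - |z.1|) ^ 2) := by
    nlinarith [sq_nonneg (‖gammaFun s z.1 ‖z.2‖‖ - ‖gammaFun t (if b then z.1 else -z.1) ‖z.2‖‖)]
  calc _ = spectralWeight H z * (‖gammaFun s z.1 ‖z.2‖‖ *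
        ‖gammaFun t (if b then z.1 else -z.1) ‖z.2‖‖) := by ring
    _ ≤ spectralWeight H z * ((T ^ 2 + 4) / (1 + (‖z.2‖ ^ 2 - |z.1|) ^ 2)) :=
        mul_le_mul_of_nonneg_left h3 (spectralWeight_nonneg H z)
    _ = _ := by unfold resonantWeight; ring

theorem norm_covDensity_le {T s t : ℝ} (hs : |s| ≤ T) (ht : |t| ≤ T) (b : Bool)
    (z : ℝ × EuclideanSpace ℝ (Fin d)) :
    ‖covDensity H b s t z‖ ≤ T ^ 2 * spectralWeight H z := by
  rw [norm_covDensity]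
  have h0 := spectralWeight_nonneg H z
  have h1 := (norm_gammaFun_le s z.1 ‖z.2‖).trans hs
  have h2 := (norm_gammaFun_le t (if b then z.1 else -z.1) ‖z.2‖).trans ht
  have hT : 0 ≤ T := (abs_nonneg s).trans hs
  calc _ ≤ spectralWeight H z * T * T := by gcongr
    _ = _ := by ring

theorem norm_covDensity_sub_le {T s t t' : ℝ} (hs : |s| ≤ T) (ht : |t| ≤ T) (b : Bool)
    (z : ℝ × EuclideanSpace ℝ (Fin d)) :
    ‖covDensity H b s t z - covDensity H b s t' z‖ ≤
      T * (1 + |z.1| * T) * |t - t'| * spectralWeight H z := by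
  rw [norm_covDensity_sub]
  have h0 := spectralWeight_nonneg H z
  have hT : 0 ≤ T := (abs_nonneg s).trans hs
  have h1 := (norm_gammaFun_le s z.1 ‖z.2‖).trans hs
  have h2 := norm_gammaFun_sub_le t' t (if b then z.1 else -z.1) ‖z.2‖
  have e : |if b then z.1 else -z.1| = |z.1| := by cases b <;> simp
  rw [e] at h2
  calc _ ≤ spectralWeight H z * T * ((1 + |z.1| * |t|) * |t - t'|) := by gcongr
    _ ≤ spectralWeight H z * T * ((1 + |z.1| * T) * |t - t'|) := by gcongr
    _ = _ := by ring

end Pointwise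

theorem besselEnergy_le {α : ℝ} {S : Set (ℝ × EuclideanSpace ℝ (Fin d))} (hS : MeasurableSet S)
    {f g : ℝ × EuclideanSpace ℝ (Fin d) → ℝ≥0∞} {c : ℝ≥0∞} (hc : c ≠ ⊤)
    (h : ∀ z ∈ S, f z ≤ c * g z) :
    besselEnergy α S f ≤ c ^ 2 * besselEnergy α Set.univ g := by
  unfold besselEnergy
  rw [← lintegral_const_mul' _ _ (ENNReal.pow_ne_top hc), Measure.restrict_univ]
  simp_rw [← lintegral_const_mul' _ _ (ENNReal.pow_ne_top hc)]
  refine (setLIntegral_mono' hS fun z hz => (setLIntegral_mono' hS fun w hw => ?_).trans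
    (setLIntegral_le_lintegral S _)).trans (setLIntegral_le_lintegral S _)
  calc f z * f w * _ ≤ (c * g z) * (c * g w) * ENNReal.ofReal ((1 + ‖z.2 - w.2‖ ^ 2) ^ (-(2 * α))) :=
        mul_le_mul_left (mul_le_mul' (h z hz) (h w hw)) _
    _ = _ := by ring

theorem enorm_sq_eq_ofReal {F : Type*} [NormedAddCommGroup F] (a : F) :
    ‖a‖ₑ ^ 2 = ENNReal.ofReal (‖a‖ ^ 2) := by
  rw [ENNReal.ofReal_pow (norm_nonneg _), ofReal_norm]

/-- Young's inequality for the cross term, with a free weight μ that will be matched to the size of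
the perturbation. -/
theorem enorm_sq_add_sub_sq_le (a b : ℂ) {μ : ℝ} (hμ : 0 < μ) :
    ‖‖a + b‖ ^ 2 - ‖a‖ ^ 2‖ₑ ≤
      ENNReal.ofReal μ * ‖a‖ₑ ^ 2 + ENNReal.ofReal (1 / μ + 1) * ‖b‖ₑ ^ 2 := by
  rw [enorm_sq_eq_ofReal, enorm_sq_eq_ofReal, ← ENNReal.ofReal_mul hμ.le,
    ← ENNReal.ofReal_mul (by positivity), ← ENNReal.ofReal_add (by positivity) (by positivity),
    Real.enorm_eq_ofReal_abs]
  refine ENNReal.ofReal_le_ofReal ?_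
  have h1 : |‖a + b‖ - ‖a‖| ≤ ‖b‖ := by
    refine (abs_norm_sub_norm_le _ _).trans (le_of_eq ?_); congr 1; ring
  have h2 : ‖a + b‖ + ‖a‖ ≤ 2 * ‖a‖ + ‖b‖ := by linarith [norm_add_le a b]
  have h3 : |‖a + b‖ ^ 2 - ‖a‖ ^ 2| ≤ ‖b‖ * (2 * ‖a‖ + ‖b‖) := by
    rw [sq_sub_sq, abs_mul, mul_comm, abs_of_nonneg (a := ‖a + b‖ + ‖a‖) (by positivity)]
    gcongr
  refine h3.trans ?_
  have h4 : 2 * (‖a‖ * ‖b‖) ≤ μ * ‖a‖ ^ 2 + 1 / μ * ‖b‖ ^ 2 := by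
    have h5 : 0 ≤ (μ * ‖a‖ - ‖b‖) ^ 2 / μ := by positivity
    have h6 : (μ * ‖a‖ - ‖b‖) ^ 2 / μ = μ * ‖a‖ ^ 2 - 2 * (‖a‖ * ‖b‖) + 1 / μ * ‖b‖ ^ 2 := by
      field_simp; ring
    linarith
  nlinarith

section Bounds

variable {H : Fin (d + 1) → ℝ}

/-- `resonantWeight` with the extra weight `parabolicSize ^ ε`. -/
noncomputable def weightedDensity (H : Fin (d + 1) → ℝ) (ε : ℝ)
    (z : ℝ × EuclideanSpace ℝ (Fin d)) : ℝ≥0∞ :=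
  ENNReal.ofReal (resonantWeight H z * parabolicSize z ^ ε)

theorem exists_besselEnergy_weightedDensity_lt_top (hd : 1 ≤ d)
    (hH : ∀ j, H j ∈ Set.Ioo (0 : ℝ) 1) (hup : 2 * H 0 + ∑ i : Fin d, H i.succ ≤ (d : ℝ) + 1)
    {α : ℝ} (hα : (d : ℝ) + 1 - (2 * H 0 + ∑ i : Fin d, H i.succ) < α) (hα' : α < 1 / 4) :
    ∃ ε : ℝ, 0 < ε ∧ besselEnergy α Set.univ (weightedDensity H ε) < ⊤ := by
  obtain ⟨ε, hε, h⟩ := exists_lintegral_energy_lt_top hd hH hup hα hα'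
  refine ⟨ε, hε, lt_of_eq_of_lt ?_ h⟩
  unfold besselEnergy weightedDensity
  rw [Measure.restrict_univ]
  refine lintegral_congr fun z => lintegral_congr fun w => ?_
  have h1 : ∀ z, 0 ≤ resonantWeight H z * parabolicSize z ^ ε := fun z =>
    mul_nonneg (resonantWeight_nonneg H z) (Real.rpow_nonneg (parabolicSize_pos z).le _)
  rw [← ENNReal.ofReal_mul (h1 _), ← ENNReal.ofReal_mul (mul_nonneg (h1 _) (h1 _))]

theorem one_le_parabolicSize (z : ℝ × EuclideanSpace ℝ (Fin d)) : 1 ≤ parabolicSize z := by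
  unfold parabolicSize
  have := abs_nonneg z.1
  have := sq_nonneg ‖z.2‖
  linarith

theorem four_pow_le_parabolicSize {n : ℕ+} {z : ℝ × EuclideanSpace ℝ (Fin d)}
    (hz : z ∉ freqDomain d n) : (4 : ℝ) ^ (n : ℕ) ≤ parabolicSize z := by
  have e : (2 : ℝ) ^ (2 * (n : ℕ)) = 4 ^ (n : ℕ) := by rw [pow_mul]; norm_num
  have e2 : ((2 : ℝ) ^ (n : ℕ)) ^ 2 = 4 ^ (n : ℕ) := by rw [← pow_mul, mul_comm, e]
  have h1 := abs_nonneg z.1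
  have h2 := sq_nonneg ‖z.2‖
  unfold parabolicSize
  by_cases h : |z.1| ≤ 2 ^ (2 * (n : ℕ))
  · have h3 : (2 : ℝ) ^ (n : ℕ) < ‖z.2‖ := by
      by_contra hn
      exact hz ⟨h, not_lt.mp hn⟩
    have h4 : ((2 : ℝ) ^ (n : ℕ)) ^ 2 ≤ ‖z.2‖ ^ 2 := by gcongr
    linarith
  · rw [not_le, e] at h
    linarith

theorem resonantWeight_le_weightedDensity {ε : ℝ} (hε : 0 ≤ ε) (z : ℝ × EuclideanSpace ℝ (Fin d)) :
    ENNReal.ofReal (resonantWeight H z) ≤ weightedDensity H ε z :=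
  ENNReal.ofReal_le_ofReal (le_mul_of_one_le_right (resonantWeight_nonneg H z)
    (Real.one_le_rpow (one_le_parabolicSize z) hε))

/-- Outside D_n the parabolic size is at least 4^n, so the spare power ε becomes a factor 4^(-nε).
-/
theorem resonantWeight_le_of_notMem {ε : ℝ} (hε : 0 ≤ ε) {n : ℕ+}
    {z : ℝ × EuclideanSpace ℝ (Fin d)} (hz : z ∉ freqDomain d n) :
    ENNReal.ofReal (resonantWeight H z) ≤
      ENNReal.ofReal (((4 : ℝ) ^ (n : ℕ)) ^ (-ε)) * weightedDensity H ε z := by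
  unfold weightedDensity
  rw [← ENNReal.ofReal_mul (by positivity)]
  refine ENNReal.ofReal_le_ofReal ?_
  have h0 := resonantWeight_nonneg H z
  have h1 : ((4 : ℝ) ^ (n : ℕ)) ^ ε ≤ parabolicSize z ^ ε :=
    Real.rpow_le_rpow (by positivity) (four_pow_le_parabolicSize hz) hε
  have h2 : ((4 : ℝ) ^ (n : ℕ)) ^ (-ε) * ((4 : ℝ) ^ (n : ℕ)) ^ ε = 1 := by
    rw [← Real.rpow_add (by positivity)]; simp
  calc resonantWeight H z = resonantWeight H z * (((4 : ℝ) ^ (n : ℕ)) ^ (-ε) *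
        ((4 : ℝ) ^ (n : ℕ)) ^ ε) := by rw [h2, mul_one]
    _ ≤ resonantWeight H z * (((4 : ℝ) ^ (n : ℕ)) ^ (-ε) * parabolicSize z ^ ε) := by gcongr
    _ = _ := by ring

/-- On D_n the momenta differ by at most 2 · 2^n, and 2α < 1, so the energy kernel is at least (5 ·
4^n)^(-1) there. Finite energy thus bounds the square of the mass, and local integrability comes for
free. -/
theorem lintegral_freqDomain_resonantWeight_le {α ε : ℝ} (hα : 0 < α) (hα' : α < 1 / 4) (hε : 0 ≤ ε)
    (n : ℕ+) :
    ∫⁻ z in freqDomain d n, ENNReal.ofReal (resonantWeight H z) ≤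
      (1 + 5 * besselEnergy α Set.univ (weightedDensity H ε)) * 4 ^ (n : ℕ) := by
  set K := besselEnergy α Set.univ (weightedDensity H ε)
  set I := ∫⁻ z in freqDomain d n, ENNReal.ofReal (resonantWeight H z)
  have hw : Measurable fun z => ENNReal.ofReal (resonantWeight H z) :=
    (measurable_resonantWeight H).ennreal_ofReal
  have hD := measurableSet_freqDomain (d := d) n
  have h1 : I * I * ENNReal.ofReal ((5 * 4 ^ (n : ℕ))⁻¹) ≤ K := by
    calc I * I * ENNReal.ofReal ((5 * 4 ^ (n : ℕ))⁻¹)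
        = ∫⁻ z in freqDomain d n, ∫⁻ w in freqDomain d n, ENNReal.ofReal (resonantWeight H z) *
            ENNReal.ofReal (resonantWeight H w) * ENNReal.ofReal ((5 * 4 ^ (n : ℕ))⁻¹) := by
          simp_rw [lintegral_mul_const _ (hw.const_mul _), lintegral_const_mul _ hw]
          rw [lintegral_mul_const _ (hw.mul_const _), lintegral_mul_const _ hw]
      _ ≤ besselEnergy α (freqDomain d n) fun z => ENNReal.ofReal (resonantWeight H z) := by
          refine setLIntegral_mono' hD fun z hz => setLIntegral_mono' hD fun w hw => ?_
          refine mul_le_mul_right (ENNReal.ofReal_le_ofReal ?_) _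
          have h2 : 1 + ‖z.2 - w.2‖ ^ 2 ≤ 5 * 4 ^ (n : ℕ) := by
            have h3 : ‖z.2 - w.2‖ ≤ 2 * 2 ^ (n : ℕ) := by
              have := norm_sub_le z.2 w.2
              linarith [hz.2, hw.2]
            have h4 : ‖z.2 - w.2‖ ^ 2 ≤ (2 * 2 ^ (n : ℕ)) ^ 2 := by gcongr
            have h5 : ((2 : ℝ) * 2 ^ (n : ℕ)) ^ 2 = 4 * 4 ^ (n : ℕ) := by
              rw [mul_pow, ← pow_mul, mul_comm (n : ℕ), pow_mul]; norm_num
            have h6 : (1 : ℝ) ≤ 4 ^ (n : ℕ) := one_le_pow₀ (by norm_num)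
            linarith
          rw [← Real.rpow_neg_one]
          calc (5 * 4 ^ (n : ℕ) : ℝ) ^ (-1 : ℝ) ≤ (1 + ‖z.2 - w.2‖ ^ 2) ^ (-1 : ℝ) :=
                Real.rpow_le_rpow_of_nonpos (by positivity) h2 (by norm_num)
            _ ≤ _ := Real.rpow_le_rpow_of_exponent_le (by
                have := sq_nonneg ‖z.2 - w.2‖; linarith) (by linarith)
      _ ≤ 1 ^ 2 * K := besselEnergy_le hD (by simp) fun z _ => by
          rw [one_mul]; exact resonantWeight_le_weightedDensity hε z
      _ = K := by rw [one_pow, one_mul]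
  have h2 : I * I ≤ 5 * 4 ^ (n : ℕ) * K := by
    have e : (5 * 4 ^ (n : ℕ) : ℝ≥0∞) * ENNReal.ofReal ((5 * 4 ^ (n : ℕ))⁻¹) = 1 := by
      rw [show (5 * 4 ^ (n : ℕ) : ℝ≥0∞) = ENNReal.ofReal (5 * 4 ^ (n : ℕ)) by
        rw [ENNReal.ofReal_mul (by norm_num), ENNReal.ofReal_pow (by norm_num)]; simp,
        ← ENNReal.ofReal_mul (by positivity), mul_inv_cancel₀ (by positivity), ENNReal.ofReal_one]
    calc I * I = (5 * 4 ^ (n : ℕ)) * ENNReal.ofReal ((5 * 4 ^ (n : ℕ))⁻¹) * (I * I) := by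
          rw [e, one_mul]
      _ = 5 * 4 ^ (n : ℕ) * (I * I * ENNReal.ofReal ((5 * 4 ^ (n : ℕ))⁻¹)) := by ring
      _ ≤ _ := mul_le_mul_right h1 _
  -- The square root of 5 · 4^n · K is replaced by the cruder linear bound (1 + 5K) · 4^n, which is
  -- all that the later steps need.
  by_contra hn
  rw [not_le] at hn
  have h3 : (1 + 5 * K) * 4 ^ (n : ℕ) * ((1 + 5 * K) * 4 ^ (n : ℕ)) < I * I :=
    ENNReal.mul_lt_mul hn hn
  have h4 : 5 * 4 ^ (n : ℕ) * K ≤ (1 + 5 * K) * 4 ^ (n : ℕ) * ((1 + 5 * K) * 4 ^ (n : ℕ)) := by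
    calc 5 * 4 ^ (n : ℕ) * K = (5 * K) * 4 ^ (n : ℕ) := by ring
      _ ≤ (1 + 5 * K) * 4 ^ (n : ℕ) := by gcongr; exact le_add_self
      _ ≤ _ := by
        refine le_mul_of_one_le_right zero_le ?_
        exact one_le_mul le_self_add (one_le_pow₀ (by norm_num))
  exact absurd (h2.trans h4) (not_le.mpr h3)

/-- On D_n both |ξ| and ‖η‖² are at most 4^n, so dropping the resonance denominator costs at most 1
+ 16^n. -/
theorem spectralWeight_le_of_mem {n : ℕ+} {z : ℝ × EuclideanSpace ℝ (Fin d)}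
    (hz : z ∈ freqDomain d n) : spectralWeight H z ≤ 2 * 16 ^ (n : ℕ) * resonantWeight H z := by
  have h0 := spectralWeight_nonneg H z
  have e : (2 : ℝ) ^ (2 * (n : ℕ)) = 4 ^ (n : ℕ) := by rw [pow_mul]; norm_num
  have h1 : ‖z.2‖ ^ 2 ≤ 4 ^ (n : ℕ) := by
    have h4 : ‖z.2‖ ^ 2 ≤ ((2 : ℝ) ^ (n : ℕ)) ^ 2 := by gcongr; exact hz.2
    rwa [← pow_mul, mul_comm, e] at h4
  have h2 : |z.1| ≤ 4 ^ (n : ℕ) := by rw [← e]; exact hz.1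
  have h3 : (‖z.2‖ ^ 2 - |z.1|) ^ 2 ≤ (4 ^ (n : ℕ)) ^ 2 := by
    rw [sq_le_sq, abs_of_pos (a := (4 : ℝ) ^ (n : ℕ)) (by positivity), abs_le]
    constructor <;> linarith [abs_nonneg z.1, sq_nonneg ‖z.2‖]
  have h4 : ((4 : ℝ) ^ (n : ℕ)) ^ 2 = 16 ^ (n : ℕ) := by
    rw [← pow_mul, mul_comm, pow_mul]; norm_num
  have h5 : (1 : ℝ) ≤ 16 ^ (n : ℕ) := one_le_pow₀ (by norm_num)
  unfold resonantWeight
  rw [mul_div_assoc', le_div_iff₀ (by positivity), mul_comm]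
  gcongr
  linarith

theorem lintegral_freqDomain_spectralWeight_le {α ε : ℝ} (hα : 0 < α) (hα' : α < 1 / 4) (hε : 0 ≤ ε)
    (n : ℕ+) :
    ∫⁻ z in freqDomain d n, ENNReal.ofReal (spectralWeight H z) ≤
      2 * (1 + 5 * besselEnergy α Set.univ (weightedDensity H ε)) * 64 ^ (n : ℕ) := by
  have hw : Measurable fun z => ENNReal.ofReal (resonantWeight H z) :=
    (measurable_resonantWeight H).ennreal_ofReal
  calc _ ≤ ∫⁻ z in freqDomain d n, (2 * 16 ^ (n : ℕ)) * ENNReal.ofReal (resonantWeight H z) := by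
        refine setLIntegral_mono' (measurableSet_freqDomain n) fun z hz => ?_
        rw [show (2 * 16 ^ (n : ℕ) : ℝ≥0∞) = ENNReal.ofReal (2 * 16 ^ (n : ℕ)) by
          rw [ENNReal.ofReal_mul (by norm_num), ENNReal.ofReal_pow (by norm_num)]; simp,
          ← ENNReal.ofReal_mul (by positivity)]
        exact ENNReal.ofReal_le_ofReal (spectralWeight_le_of_mem hz)
    _ = (2 * 16 ^ (n : ℕ)) * ∫⁻ z in freqDomain d n, ENNReal.ofReal (resonantWeight H z) :=
        lintegral_const_mul _ hw
    _ ≤ (2 * 16 ^ (n : ℕ)) *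
          ((1 + 5 * besselEnergy α Set.univ (weightedDensity H ε)) * 4 ^ (n : ℕ)) :=
        mul_le_mul_right (lintegral_freqDomain_resonantWeight_le hα hα' hε n) _
    _ = _ := by
        rw [show (64 : ℝ≥0∞) = 16 * 4 by norm_num, mul_pow]; ring

/-- The exponential growth in n is harmless: it is only ever used against a positive power of the
time increment. -/
theorem exists_integral_freqDomain_spectralWeight_le (hd : 1 ≤ d)
    (hH : ∀ j, H j ∈ Set.Ioo (0 : ℝ) 1) (hup : 2 * H 0 + ∑ i : Fin d, H i.succ ≤ (d : ℝ) + 1)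
    {α : ℝ} (hα : (d : ℝ) + 1 - (2 * H 0 + ∑ i : Fin d, H i.succ) < α) (hα' : α < 1 / 4) :
    ∃ C : ℝ, 0 ≤ C ∧ ∀ n : ℕ+, IntegrableOn (spectralWeight H) (freqDomain d n) ∧
      ∫ z in freqDomain d n, spectralWeight H z ≤ C * 64 ^ (n : ℕ) := by
  obtain ⟨ε, hε, hK⟩ := exists_besselEnergy_weightedDensity_lt_top hd hH hup hα hα'
  have hα0 : 0 < α := by linarith
  have hne : 2 * (1 + 5 * besselEnergy α Set.univ (weightedDensity H ε)) ≠ ⊤ :=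
    ENNReal.mul_ne_top (by simp) (ENNReal.add_ne_top.mpr ⟨by simp, ENNReal.mul_ne_top (by simp) hK.ne⟩)
  refine ⟨(2 * (1 + 5 * besselEnergy α Set.univ (weightedDensity H ε))).toReal,
    ENNReal.toReal_nonneg, fun n => ?_⟩
  have h := lintegral_freqDomain_spectralWeight_le (H := H) hα0 hα' hε.le n
  have hlt : 2 * (1 + 5 * besselEnergy α Set.univ (weightedDensity H ε)) * 64 ^ (n : ℕ) ≠ ⊤ :=
    ENNReal.mul_ne_top hne (by simp)
  refine ⟨⟨(measurable_spectralWeight H).aestronglyMeasurable, ?_⟩, ?_⟩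
  · rw [hasFiniteIntegral_iff_ofReal (ae_of_all _ fun z => spectralWeight_nonneg H z)]
    exact h.trans_lt hlt.lt_top
  · rw [integral_eq_lintegral_of_nonneg_ae (ae_of_all _ fun z => spectralWeight_nonneg H z)
      (measurable_spectralWeight H).aestronglyMeasurable]
    refine (ENNReal.toReal_mono hlt h).trans (le_of_eq ?_)
    rw [ENNReal.toReal_mul]
    simp

theorem integrableOn_covDensity {n : ℕ+} (hw : IntegrableOn (spectralWeight H) (freqDomain d n))
    (b : Bool) (s t : ℝ) : IntegrableOn (covDensity H b s t) (freqDomain d n) := by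
  have hw' : Integrable (spectralWeight H) (volume.restrict (freqDomain d n)) := hw
  refine Integrable.mono' (hw'.const_mul ((max |s| |t|) ^ 2))
    (measurable_covDensity H b s t).aestronglyMeasurable (ae_of_all _ fun z => ?_)
  exact norm_covDensity_le H (le_max_left _ _) (le_max_right _ _) b z

/-- Decay of the difference of the squared covariances for consecutive truncations. -/
theorem exists_lintegral_sq_waveKernel_sub_le (hd : 1 ≤ d)
    (hH : ∀ j, H j ∈ Set.Ioo (0 : ℝ) 1) (hup : 2 * H 0 + ∑ i : Fin d, H i.succ ≤ (d : ℝ) + 1)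
    {α : ℝ} (hα : (d : ℝ) + 1 - (2 * H 0 + ∑ i : Fin d, H i.succ) < α) (hα' : α < 1 / 4) (T : ℝ) :
    ∃ ε : ℝ, 0 < ε ∧ ∃ C : ℝ≥0∞, C ≠ ⊤ ∧ ∀ (n m : ℕ+), n ≤ m → ∀ (b : Bool) (t : ℝ), |t| ≤ T →
      ∫⁻ p, ‖‖waveKernel (freqDomain d m) (covDensity H b t t) (p.1 - p.2)‖ ^ 2 -
          ‖waveKernel (freqDomain d n) (covDensity H b t t) (p.1 - p.2)‖ ^ 2‖ₑ
        ∂((besselMeasure (EuclideanSpace ℝ (Fin d)) α).prod (besselMeasure _ α)) ≤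
      C * ENNReal.ofReal (((4 : ℝ) ^ (n : ℕ)) ^ (-ε)) := by
  obtain ⟨C₀, -, hint⟩ := exists_integral_freqDomain_spectralWeight_le hd hH hup hα hα'
  obtain ⟨ε, hε, hK⟩ := exists_besselEnergy_weightedDensity_lt_top hd hH hup hα hα'
  have hα0 : 0 < α := by linarith
  set K := besselEnergy α Set.univ (weightedDensity H ε)
  set B := T ^ 2 + 4
  have hB : 0 ≤ B := by positivity
  refine ⟨ε, hε, 3 * (ENNReal.ofReal B ^ 2 * K),
    ENNReal.mul_ne_top (by simp) (ENNReal.mul_ne_top (by simp) hK.ne), fun n m hnm b t ht => ?_⟩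
  set J := besselMeasure (EuclideanSpace ℝ (Fin d)) α
  set f := covDensity H b t t
  -- The shell between the two truncations has energy of order r². Taking μ = r in Young's
  -- inequality balances r · 1 against (1/r) · r².
  set r := ((4 : ℝ) ^ (n : ℕ)) ^ (-ε) with hr
  have hr0 : 0 < r := by positivity
  have hr1 : r ≤ 1 := Real.rpow_le_one_of_one_le_of_nonpos (one_le_pow₀ (by norm_num)) (by linarith)
  have hfm : IntegrableOn f (freqDomain d m) := integrableOn_covDensity (hint m).1 b t t
  have hfn : IntegrableOn f (freqDomain d n) := hfm.mono_set (freqDomain_mono hnm)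
  have hfd : IntegrableOn f (freqDomain d m \ freqDomain d n) := hfm.mono_set Set.sdiff_subset
  have hfB : ∀ z, ‖f z‖ₑ ≤ ENNReal.ofReal B * ENNReal.ofReal (resonantWeight H z) := fun z => by
    rw [← ENNReal.ofReal_mul hB, ← ofReal_norm]
    exact ENNReal.ofReal_le_ofReal (norm_covDensity_le_resonantWeight H ht ht b z)
  have h1 : ∫⁻ p, ‖waveKernel (freqDomain d n) f (p.1 - p.2)‖ₑ ^ 2 ∂(J.prod J) ≤
      ENNReal.ofReal B ^ 2 * K :=
    (lintegral_enorm_waveKernel_sq_le hα0 hfn).trans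
      (besselEnergy_le (measurableSet_freqDomain n) (by simp) fun z _ =>
        (hfB z).trans (mul_le_mul_right (resonantWeight_le_weightedDensity hε.le z) _))
  have h2 : ∫⁻ p, ‖waveKernel (freqDomain d m \ freqDomain d n) f (p.1 - p.2)‖ₑ ^ 2 ∂(J.prod J) ≤
      (ENNReal.ofReal B * ENNReal.ofReal r) ^ 2 * K :=
    (lintegral_enorm_waveKernel_sq_le hα0 hfd).trans
      (besselEnergy_le ((measurableSet_freqDomain m).diff (measurableSet_freqDomain n))
        (ENNReal.mul_ne_top (by simp) (by simp)) fun z hz =>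
        (hfB z).trans (by
          rw [mul_assoc]
          exact mul_le_mul_right (resonantWeight_le_of_notMem hε.le hz.2) _))
  have hmeas : Measurable fun p : EuclideanSpace ℝ (Fin d) × EuclideanSpace ℝ (Fin d) =>
      ‖waveKernel (freqDomain d n) f (p.1 - p.2)‖ₑ ^ 2 := by
    have hc : Continuous (waveKernel (freqDomain d n) f) := by
      refine continuous_of_dominated (bound := fun z => ‖f z‖)
        (fun v => (integrable_waveKernel hfn v).1) (fun v => ae_of_all _ fun z => ?_) hfn.norm
        (ae_of_all _ fun z => by fun_prop)
      rw [norm_mul, norm_exp_I_mul_ofReal, mul_one]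
    have := hc.measurable
    fun_prop
  calc _ ≤ ∫⁻ p, (ENNReal.ofReal r * ‖waveKernel (freqDomain d n) f (p.1 - p.2)‖ₑ ^ 2 +
        ENNReal.ofReal (1 / r + 1) *
          ‖waveKernel (freqDomain d m \ freqDomain d n) f (p.1 - p.2)‖ₑ ^ 2) ∂(J.prod J) := by
        refine lintegral_mono fun p => ?_
        rw [waveKernel_diff (measurableSet_freqDomain n) (freqDomain_mono hnm) hfm]
        exact enorm_sq_add_sub_sq_le _ _ hr0
    _ = ENNReal.ofReal r * ∫⁻ p, ‖waveKernel (freqDomain d n) f (p.1 - p.2)‖ₑ ^ 2 ∂(J.prod J) +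
        ENNReal.ofReal (1 / r + 1) *
          ∫⁻ p, ‖waveKernel (freqDomain d m \ freqDomain d n) f (p.1 - p.2)‖ₑ ^ 2 ∂(J.prod J) := by
        rw [lintegral_add_left (hmeas.const_mul _), lintegral_const_mul' _ _ (by simp),
          lintegral_const_mul' _ _ (by simp)]
    _ ≤ ENNReal.ofReal r * (ENNReal.ofReal B ^ 2 * K) +
        ENNReal.ofReal (1 / r + 1) * ((ENNReal.ofReal B * ENNReal.ofReal r) ^ 2 * K) := by gcongr
    _ = (ENNReal.ofReal r + ENNReal.ofReal (1 / r + 1) * ENNReal.ofReal r ^ 2) *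
          (ENNReal.ofReal B ^ 2 * K) := by ring
    _ ≤ ENNReal.ofReal (3 * r) * (ENNReal.ofReal B ^ 2 * K) := by
        refine mul_le_mul_left ?_ _
        rw [← ENNReal.ofReal_pow hr0.le, ← ENNReal.ofReal_mul (by positivity),
          ← ENNReal.ofReal_add hr0.le (by positivity)]
        refine ENNReal.ofReal_le_ofReal ?_
        have : (1 / r + 1) * r ^ 2 = r + r ^ 2 := by field_simp
        rw [this]
        nlinarith
    _ = _ := by rw [ENNReal.ofReal_mul (by norm_num), ENNReal.ofReal_ofNat]; ring

/-- Crude bounds for the covariances. -/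
theorem exists_norm_waveKernel_le (hd : 1 ≤ d)
    (hH : ∀ j, H j ∈ Set.Ioo (0 : ℝ) 1) (hup : 2 * H 0 + ∑ i : Fin d, H i.succ ≤ (d : ℝ) + 1)
    {α : ℝ} (hα : (d : ℝ) + 1 - (2 * H 0 + ∑ i : Fin d, H i.succ) < α) (hα' : α < 1 / 4)
    {T : ℝ} (hT : 0 ≤ T) :
    ∃ C : ℝ, 0 ≤ C ∧ ∀ (n : ℕ+) (b : Bool) (s t t' : ℝ), |s| ≤ T → |t| ≤ T → |t'| ≤ T →
      ∀ v, ‖waveKernel (freqDomain d n) (covDensity H b s t) v‖ ≤ C * 64 ^ (n : ℕ) ∧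
      ‖waveKernel (freqDomain d n) (covDensity H b s t) v -
        waveKernel (freqDomain d n) (covDensity H b s t') v‖ ≤ C * 256 ^ (n : ℕ) * |t - t'| := by
  obtain ⟨C, hC, hint⟩ := exists_integral_freqDomain_spectralWeight_le hd hH hup hα hα'
  refine ⟨(T ^ 2 + T * (1 + T)) * C, by positivity, fun n b s t t' hs ht ht' v => ⟨?_, ?_⟩⟩
  · calc _ ≤ ∫ z in freqDomain d n, ‖covDensity H b s t z‖ := norm_waveKernel_le _ _ _
      _ ≤ ∫ z in freqDomain d n, T ^ 2 * spectralWeight H z :=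
          integral_mono (integrableOn_covDensity (hint n).1 b s t).norm
            ((hint n).1.const_mul _) fun z => norm_covDensity_le H hs ht b z
      _ = T ^ 2 * ∫ z in freqDomain d n, spectralWeight H z := integral_const_mul _ _
      _ ≤ (T ^ 2 + T * (1 + T)) * (C * 64 ^ (n : ℕ)) := by
          have := (hint n).2
          have h0 : 0 ≤ C * 64 ^ (n : ℕ) := by positivity
          refine mul_le_mul ?_ this (integral_nonneg fun z => spectralWeight_nonneg H z)
            (by positivity)
          linarith [mul_nonneg hT (by linarith : 0 ≤ 1 + T)]
      _ = _ := by ring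
  · rw [waveKernel_sub (integrableOn_covDensity (hint n).1 b s t)
      (integrableOn_covDensity (hint n).1 b s t')]
    -- A time increment costs a factor of order |ξ| ≤ 4^n, which together with the mass 64^n makes
    -- 256^n.
    have h4 : (1 : ℝ) ≤ 4 ^ (n : ℕ) := one_le_pow₀ (by norm_num)
    have e : (2 : ℝ) ^ (2 * (n : ℕ)) = 4 ^ (n : ℕ) := by rw [pow_mul]; norm_num
    calc _ ≤ ∫ z in freqDomain d n, ‖covDensity H b s t z - covDensity H b s t' z‖ :=
          norm_waveKernel_le _ _ _
      _ ≤ ∫ z in freqDomain d n, (T * (1 + T) * 4 ^ (n : ℕ) * |t - t'|) * spectralWeight H z := by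
          refine setIntegral_mono_on ((integrableOn_covDensity (hint n).1 b s t).sub
            (integrableOn_covDensity (hint n).1 b s t')).norm ((hint n).1.const_mul _)
            (measurableSet_freqDomain n) fun z hz => ?_
          refine (norm_covDensity_sub_le H hs ht b z).trans ?_
          have h0 := spectralWeight_nonneg H z
          have h1 : |z.1| ≤ 4 ^ (n : ℕ) := by rw [← e]; exact hz.1
          have h2 : 1 + |z.1| * T ≤ (1 + T) * 4 ^ (n : ℕ) := by nlinarith
          calc T * (1 + |z.1| * T) * |t - t'| * spectralWeight H z
              ≤ T * ((1 + T) * 4 ^ (n : ℕ)) * |t - t'| * spectralWeight H z := by gcongr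
            _ = _ := by ring
      _ = (T * (1 + T) * 4 ^ (n : ℕ) * |t - t'|) * ∫ z in freqDomain d n, spectralWeight H z :=
          integral_const_mul _ _
      _ ≤ (T * (1 + T) * 4 ^ (n : ℕ) * |t - t'|) * (C * 64 ^ (n : ℕ)) := by
          have := (hint n).2
          gcongr
      _ ≤ ((T ^ 2 + T * (1 + T)) * 4 ^ (n : ℕ) * |t - t'|) * (C * 64 ^ (n : ℕ)) := by
          gcongr
          linarith [sq_nonneg T]
      _ = _ := by rw [show (256 : ℝ) = 4 * 64 by norm_num, mul_pow]; ring

end Bounds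

end

/-! ### Second and higher moments of smoothed random fields. -/

section

/-- `v` is bounded by `c` uniformly and in mean. -/
def UniformMeanBound {E : Type*} [MeasureSpace E] (v : E → ℝ≥0∞) (c : ℝ≥0∞) : Prop :=
  (∀ x, v x ≤ c) ∧ ∫⁻ x, v x ≤ c

theorem UniformMeanBound.min {E : Type*} [MeasureSpace E] {v : E → ℝ≥0∞} {a b : ℝ≥0∞}
    (ha : UniformMeanBound v a) (hb : UniformMeanBound v b) : UniformMeanBound v (min a b) :=
  ⟨fun x => le_min (ha.1 x) (hb.1 x), le_min ha.2 hb.2⟩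

theorem UniformMeanBound.mono {E : Type*} [MeasureSpace E] {v : E → ℝ≥0∞} {a b : ℝ≥0∞}
    (ha : UniformMeanBound v a) (h : a ≤ b) : UniformMeanBound v b :=
  ⟨fun x => (ha.1 x).trans h, ha.2.trans h⟩

variable {E : Type*} [NormedAddCommGroup E] [InnerProductSpace ℝ E] [FiniteDimensional ℝ E]
  [MeasurableSpace E] [BorelSpace E] {Ω : Type*} [MeasurableSpace Ω]

/-- The average of the random field `φ D` against translates of `J`. -/
noncomputable def fieldPot (J : Measure E) (φ : E → ℝ) (D : E → Ω → ℝ) (x : E) (ω : Ω) : ℝ :=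
  ∫ u, φ (x + u) * D (x + u) ω ∂J

section

variable {J : Measure E} [IsProbabilityMeasure J] {P : Measure Ω} {φ : E → ℝ} {D : E → Ω → ℝ}

theorem measurable_fieldPot (hφ : Measurable φ) (hD : Measurable (Function.uncurry D)) :
    Measurable (Function.uncurry (fieldPot J φ D)) := by
  have h : Measurable fun q : (E × Ω) × E => φ (q.1.1 + q.2) * D (q.1.1 + q.2) q.1.2 := by
    have h1 : Measurable fun q : (E × Ω) × E => Function.uncurry D (q.1.1 + q.2, q.1.2) :=
      hD.comp (by fun_prop)
    have h2 : Measurable fun q : (E × Ω) × E => φ (q.1.1 + q.2) := hφ.comp (by fun_prop)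
    exact h2.mul h1
  exact (h.stronglyMeasurable.integral_prod_right' (ν := J)).measurable

/-- Jensen's inequality for the probability measure J. It ignores the spatial decorrelation and
serves only for the crude bound on time increments. -/
theorem lintegral_fieldPot_sq_le [IsProbabilityMeasure P] (hφ : Measurable φ)
    (hD : Measurable (Function.uncurry D)) (x : E) :
    ∫⁻ ω, ‖fieldPot J φ D x ω‖ₑ ^ 2 ∂P ≤
      ∫⁻ u, ‖φ (x + u)‖ₑ ^ 2 * ∫⁻ ω, ‖D (x + u) ω‖ₑ ^ 2 ∂P ∂J := by
  have h1 : Measurable fun q : Ω × E => D (x + q.2) q.1 :=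
    hD.comp (by fun_prop : Measurable fun q : Ω × E => (x + q.2, q.1))
  have h2 : Measurable fun q : Ω × E => φ (x + q.2) := hφ.comp (by fun_prop)
  have h3 : Measurable fun q : Ω × E => ‖φ (x + q.2) * D (x + q.2) q.1‖ₑ ^ 2 := by fun_prop
  calc _ ≤ ∫⁻ ω, (∫⁻ u, ‖φ (x + u) * D (x + u) ω‖ₑ ∂J) ^ 2 ∂P :=
        lintegral_mono fun ω => pow_le_pow_left₀ zero_le (enorm_integral_le_lintegral_enorm _) 2
    _ ≤ ∫⁻ ω, ∫⁻ u, ‖φ (x + u) * D (x + u) ω‖ₑ ^ 2 ∂J ∂P := by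
        refine lintegral_mono fun ω => lintegral_pow_le_lintegral_pow _ ?_ two_ne_zero
        exact ((h2.mul h1).comp (measurable_prodMk_left (x := ω))).enorm.aemeasurable
    _ = ∫⁻ u, ∫⁻ ω, ‖φ (x + u) * D (x + u) ω‖ₑ ^ 2 ∂P ∂J :=
        lintegral_lintegral_swap h3.aemeasurable
    _ = _ := by
        refine lintegral_congr fun u => ?_
        simp_rw [enorm_mul, mul_pow]
        exact lintegral_const_mul' _ _ (by simp)

theorem lintegral_enorm_mul_le {X Y : Ω → ℝ} (hX : Measurable X) :
    ∫⁻ ω, ‖X ω‖ₑ * ‖Y ω‖ₑ ∂P ≤ ∫⁻ ω, ‖X ω‖ₑ ^ 2 ∂P + ∫⁻ ω, ‖Y ω‖ₑ ^ 2 ∂P := by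
  rw [← lintegral_add_left (by fun_prop)]
  refine lintegral_mono fun ω => ?_
  rcases le_total ‖X ω‖ₑ ‖Y ω‖ₑ with h | h
  · calc ‖X ω‖ₑ * ‖Y ω‖ₑ ≤ ‖Y ω‖ₑ * ‖Y ω‖ₑ := mul_le_mul_left h _
      _ ≤ _ := by rw [← sq]; exact le_add_self
  · calc ‖X ω‖ₑ * ‖Y ω‖ₑ ≤ ‖X ω‖ₑ * ‖X ω‖ₑ := mul_le_mul_right h _
      _ ≤ _ := by rw [← sq]; exact le_self_add

/-- The square of the average is a double average of products, and Fubini brings in the covariance.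
Taking absolute values loses nothing essential, J being positive, and dispenses with any Fourier
analysis of the cutoff. -/
theorem lintegral_fieldPot_sq_le_covariance [IsProbabilityMeasure P] (hφ : Measurable φ)
    (hD : Measurable (Function.uncurry D)) {A M : ℝ≥0∞} (hA : A ≠ ⊤) (hM : M ≠ ⊤)
    (hφA : ∀ x, ‖φ x‖ₑ ≤ A) (hDM : ∀ y, ∫⁻ ω, ‖D y ω‖ₑ ^ 2 ∂P ≤ M) (x : E) :
    ∫⁻ ω, ‖fieldPot J φ D x ω‖ₑ ^ 2 ∂P ≤
      ∫⁻ p, ‖φ (x + p.1)‖ₑ * ‖φ (x + p.2)‖ₑ *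
        ‖∫ ω, D (x + p.1) ω * D (x + p.2) ω ∂P‖ₑ ∂(J.prod J) := by
  have hDy : ∀ y, Measurable (D y) := fun y => hD.comp measurable_prodMk_left
  have h1 : Measurable fun q : Ω × (E × E) => D (x + q.2.1) q.1 :=
    hD.comp (by fun_prop : Measurable fun q : Ω × (E × E) => (x + q.2.1, q.1))
  have h2 : Measurable fun q : Ω × (E × E) => D (x + q.2.2) q.1 :=
    hD.comp (by fun_prop : Measurable fun q : Ω × (E × E) => (x + q.2.2, q.1))
  set G : Ω → E × E → ℝ := fun ω p =>
    (φ (x + p.1) * D (x + p.1) ω) * (φ (x + p.2) * D (x + p.2) ω) with hG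
  have hGm : Measurable (Function.uncurry G) := by
    simp only [hG, Function.uncurry_def]
    fun_prop
  have hGi : Integrable (Function.uncurry G) (P.prod (J.prod J)) := by
    refine ⟨hGm.aestronglyMeasurable, ?_⟩
    rw [HasFiniteIntegral, lintegral_prod_symm _ hGm.enorm.aemeasurable]
    refine lt_of_le_of_lt (lintegral_mono (g := fun _ => A * A * (M + M)) fun p => ?_) ?_
    · calc ∫⁻ ω, ‖Function.uncurry G (ω, p)‖ₑ ∂P
          ≤ ∫⁻ ω, A * A * (‖D (x + p.1) ω‖ₑ * ‖D (x + p.2) ω‖ₑ) ∂P := by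
            refine lintegral_mono fun ω => ?_
            simp only [hG, Function.uncurry_apply_pair, enorm_mul]
            rw [mul_mul_mul_comm]
            exact mul_le_mul_left (mul_le_mul' (hφA _) (hφA _)) _
        _ = A * A * ∫⁻ ω, ‖D (x + p.1) ω‖ₑ * ‖D (x + p.2) ω‖ₑ ∂P :=
            lintegral_const_mul' _ _ (ENNReal.mul_ne_top hA hA)
        _ ≤ A * A * (M + M) := by
            refine mul_le_mul_right ?_ _
            exact (lintegral_enorm_mul_le (hDy _)).trans (add_le_add (hDM _) (hDM _))
    · simp only [lintegral_const, measure_univ, mul_one]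
      exact ENNReal.mul_lt_top (ENNReal.mul_lt_top hA.lt_top hA.lt_top)
        (ENNReal.add_lt_top.mpr ⟨hM.lt_top, hM.lt_top⟩)
  have e1 : ∀ ω, ∫ p, G ω p ∂(J.prod J) = fieldPot J φ D x ω ^ 2 := fun ω => by
    simp only [hG]
    rw [integral_prod_mul (fun u => φ (x + u) * D (x + u) ω) (fun u => φ (x + u) * D (x + u) ω), sq]
    rfl
  have hi : Integrable (fun ω => fieldPot J φ D x ω ^ 2) P := by
    have h := hGi.integral_prod_left
    simpa only [Function.uncurry_apply_pair, e1] using h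
  have hsw := integral_integral_swap hGi
  simp_rw [e1] at hsw
  simp_rw [enorm_sq_eq_ofReal, Real.norm_eq_abs, sq_abs]
  rw [← ofReal_integral_eq_lintegral_ofReal hi (ae_of_all _ fun _ => sq_nonneg _), hsw]
  refine (ENNReal.ofReal_le_ofReal (le_abs_self _)).trans ?_
  rw [← Real.enorm_eq_ofReal_abs]
  refine (enorm_integral_le_lintegral_enorm _).trans (le_of_eq (lintegral_congr fun p => ?_))
  rw [← enorm_mul, ← enorm_mul, ← integral_const_mul]
  congr 1
  refine integral_congr_ae (ae_of_all _ fun ω => ?_)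
  simp only [hG]
  ring

theorem uniformMeanBound_fieldPot_sq [IsProbabilityMeasure P] (hφ : Measurable φ)
    (hD : Measurable (Function.uncurry D))
    {A b : ℝ≥0∞} (hφA : ∀ x, ‖φ x‖ₑ ≤ A) (hφi : ∫⁻ x, ‖φ x‖ₑ ≤ A)
    (hDb : ∀ y, ∫⁻ ω, ‖D y ω‖ₑ ^ 2 ∂P ≤ b) :
    UniformMeanBound (fun x => ∫⁻ ω, ‖fieldPot J φ D x ω‖ₑ ^ 2 ∂P) (A ^ 2 * b) := by
  have h0 : ∀ x, ∫⁻ ω, ‖fieldPot J φ D x ω‖ₑ ^ 2 ∂P ≤ ∫⁻ u, ‖φ (x + u)‖ₑ * (A * b) ∂J := fun x =>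
    (lintegral_fieldPot_sq_le hφ hD x).trans (lintegral_mono fun u => by
      rw [sq, mul_assoc]
      exact mul_le_mul_right (mul_le_mul' (hφA _) (hDb _)) _)
  constructor
  · intro x
    refine (h0 x).trans ?_
    calc _ ≤ ∫⁻ u, A * (A * b) ∂J := lintegral_mono fun u => mul_le_mul_left (hφA _) _
      _ = A ^ 2 * b := by simp [sq, mul_assoc]
  · calc _ ≤ ∫⁻ x, ∫⁻ u, ‖φ (x + u)‖ₑ * (A * b) ∂J := lintegral_mono h0
      _ = ∫⁻ u, (∫⁻ x, ‖φ (x + u)‖ₑ * (A * b)) ∂J :=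
          lintegral_lintegral_swap (f := fun x u => ‖φ (x + u)‖ₑ * (A * b)) (by fun_prop)
      _ ≤ ∫⁻ u, A * (A * b) ∂J := by
          refine lintegral_mono fun u => ?_
          rw [lintegral_mul_const _ (by fun_prop), lintegral_add_right_eq_self fun x => ‖φ x‖ₑ]
          exact mul_le_mul_left hφi _
      _ = A ^ 2 * b := by simp [sq, mul_assoc]

/-- One of the two factors φ is bounded by its supremum. The other is bounded in the same way for
the uniform bound, and integrated over x for the mean bound. -/
theorem uniformMeanBound_fieldPot_covariance [IsProbabilityMeasure P] (hφ : Measurable φ)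
    (hD : Measurable (Function.uncurry D)) {A M : ℝ≥0∞} (hA : A ≠ ⊤) (hM : M ≠ ⊤)
    (hφA : ∀ x, ‖φ x‖ₑ ≤ A) (hφi : ∫⁻ x, ‖φ x‖ₑ ≤ A) (hDM : ∀ y, ∫⁻ ω, ‖D y ω‖ₑ ^ 2 ∂P ≤ M)
    {k : E × E → ℝ≥0∞} (hk : Measurable k)
    (hDk : ∀ x u u', ‖∫ ω, D (x + u) ω * D (x + u') ω ∂P‖ₑ ≤ k (u, u')) :
    UniformMeanBound (fun x => ∫⁻ ω, ‖fieldPot J φ D x ω‖ₑ ^ 2 ∂P)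
      (A ^ 2 * ∫⁻ p, k p ∂(J.prod J)) := by
  have h0 : ∀ x, ∫⁻ ω, ‖fieldPot J φ D x ω‖ₑ ^ 2 ∂P ≤
      ∫⁻ p, ‖φ (x + p.1)‖ₑ * (A * k p) ∂(J.prod J) := fun x =>
    (lintegral_fieldPot_sq_le_covariance hφ hD hA hM hφA hDM x).trans (lintegral_mono fun p => by
      rw [mul_assoc]
      exact mul_le_mul_right (mul_le_mul' (hφA _) (hDk _ _ _)) _)
  have e : ∫⁻ p, A * (A * k p) ∂(J.prod J) = A ^ 2 * ∫⁻ p, k p ∂(J.prod J) := by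
    rw [lintegral_const_mul' _ _ hA, lintegral_const_mul' _ _ hA, sq, mul_assoc]
  constructor
  · intro x
    exact (h0 x).trans ((lintegral_mono fun u => mul_le_mul_left (hφA _) _).trans e.le)
  · calc _ ≤ ∫⁻ x, ∫⁻ p, ‖φ (x + p.1)‖ₑ * (A * k p) ∂(J.prod J) := lintegral_mono h0
      _ = ∫⁻ p, (∫⁻ x, ‖φ (x + p.1)‖ₑ * (A * k p)) ∂(J.prod J) :=
          lintegral_lintegral_swap (f := fun x (p : E × E) => ‖φ (x + p.1)‖ₑ * (A * k p))
            (by fun_prop)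
      _ ≤ ∫⁻ p, A * (A * k p) ∂(J.prod J) := by
          refine lintegral_mono fun p => ?_
          rw [lintegral_mul_const _ (by fun_prop), lintegral_add_right_eq_self fun x => ‖φ x‖ₑ]
          exact mul_le_mul_left hφi _
      _ = _ := e

theorem memLp_of_lintegral_sq_lt_top {X : Ω → ℝ} (hX : Measurable X)
    (h : ∫⁻ ω, ‖X ω‖ₑ ^ 2 ∂P < ⊤) : MemLp X 2 P := by
  refine ⟨hX.aestronglyMeasurable, ?_⟩
  have := eLpNorm_nnreal_pow_eq_lintegral (μ := P) (f := X) (p := 2) (by norm_num)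
  simp only [NNReal.coe_ofNat, ENNReal.rpow_ofNat] at this
  rw [← this] at h
  by_contra hn
  rw [not_lt, top_le_iff] at hn
  rw [show ((2 : ℝ≥0) : ℝ≥0∞) = 2 by norm_num, hn] at h
  simp at h

theorem lintegral_sq_lt_top_of_memLp {X : Ω → ℝ} (hX : MemLp X 2 P) :
    ∫⁻ ω, ‖X ω‖ₑ ^ 2 ∂P < ⊤ := by
  have := eLpNorm_nnreal_pow_eq_lintegral (μ := P) (f := X) (p := 2) (by norm_num)
  simp only [NNReal.coe_ofNat, ENNReal.rpow_ofNat] at this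
  rw [← this]
  exact ENNReal.pow_lt_top hX.eLpNorm_lt_top

/-- Orthogonality passes through the average by Fubini. This places the smoothed field in the closed
span of the Wick squares, in the form in which hypercontractivity asks for it. -/
theorem integral_fieldPot_mul_eq_zero [IsProbabilityMeasure P] (hφ : Measurable φ)
    (hD : Measurable (Function.uncurry D))
    {A M : ℝ≥0∞} (hA : A ≠ ⊤) (hM : M ≠ ⊤) (hφA : ∀ x, ‖φ x‖ₑ ≤ A)
    (hDM : ∀ y, ∫⁻ ω, ‖D y ω‖ₑ ^ 2 ∂P ≤ M) {Y : Ω → ℝ} (hY : MemLp Y 2 P)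
    (h0 : ∀ y, ∫ ω, D y ω * Y ω ∂P = 0) (x : E) : ∫ ω, fieldPot J φ D x ω * Y ω ∂P = 0 := by
  -- A measurable representative of `Y` makes the integrand jointly measurable for Fubini.
  obtain ⟨Y', hY'm, hYY'⟩ := hY.1
  have hY' : MemLp Y' 2 P := hY.ae_eq hYY'
  have hDy : ∀ y, Measurable (D y) := fun y => hD.comp measurable_prodMk_left
  have h0' : ∀ y, ∫ ω, D y ω * Y' ω ∂P = 0 := fun y => by
    rw [← h0 y]
    refine integral_congr_ae ?_
    filter_upwards [hYY'] with ω hω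
    rw [hω]
  have e0 : ∫ ω, fieldPot J φ D x ω * Y ω ∂P = ∫ ω, fieldPot J φ D x ω * Y' ω ∂P := by
    refine integral_congr_ae ?_
    filter_upwards [hYY'] with ω hω
    rw [hω]
  have h1 : Measurable fun q : Ω × E => D (x + q.2) q.1 :=
    hD.comp (by fun_prop : Measurable fun q : Ω × E => (x + q.2, q.1))
  have hYm : Measurable Y' := hY'm.measurable
  set G : Ω → E → ℝ := fun ω u => φ (x + u) * D (x + u) ω * Y' ω with hG
  have hGm : Measurable (Function.uncurry G) := by
    simp only [hG, Function.uncurry_def]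
    fun_prop
  have hGi : Integrable (Function.uncurry G) (P.prod J) := by
    refine ⟨hGm.aestronglyMeasurable, ?_⟩
    rw [HasFiniteIntegral, lintegral_prod_symm _ hGm.enorm.aemeasurable]
    refine lt_of_le_of_lt (lintegral_mono (g := fun _ => A * (M + ∫⁻ ω, ‖Y' ω‖ₑ ^ 2 ∂P))
      fun u => ?_) ?_
    · calc ∫⁻ ω, ‖Function.uncurry G (ω, u)‖ₑ ∂P
          ≤ ∫⁻ ω, A * (‖D (x + u) ω‖ₑ * ‖Y' ω‖ₑ) ∂P := by
            refine lintegral_mono fun ω => ?_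
            simp only [hG, Function.uncurry_apply_pair, enorm_mul]
            rw [mul_assoc]
            exact mul_le_mul_left (hφA _) _
        _ = A * ∫⁻ ω, ‖D (x + u) ω‖ₑ * ‖Y' ω‖ₑ ∂P := lintegral_const_mul' _ _ hA
        _ ≤ _ := mul_le_mul_right ((lintegral_enorm_mul_le (hDy _)).trans
            (add_le_add_left (hDM _) _)) _
    · simp only [lintegral_const, measure_univ, mul_one]
      exact ENNReal.mul_lt_top hA.lt_top (ENNReal.add_lt_top.mpr
        ⟨hM.lt_top, lintegral_sq_lt_top_of_memLp hY'⟩)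
  have hsw := integral_integral_swap hGi
  have e1 : ∀ ω, ∫ u, G ω u ∂J = fieldPot J φ D x ω * Y' ω := fun ω => by
    simp only [hG]
    rw [integral_mul_const]
    rfl
  have e2 : ∀ u, ∫ ω, G ω u ∂P = 0 := fun u => by
    simp only [hG]
    simp_rw [mul_assoc]
    rw [integral_const_mul, h0', mul_zero]
  simp_rw [e1, e2] at hsw
  rw [e0, hsw]
  simp

/-- Moments of the `L ^ {2 k}` norm of a random field with hypercontractive marginals. -/
theorem lintegral_lintegral_pow_le_of_hypercontractive [IsProbabilityMeasure P] {X : E → Ω → ℝ}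
    (hX : Measurable (Function.uncurry X)) {c : ℝ≥0∞} {k m : ℕ} (hk : k ≠ 0) (hm : m ≠ 0)
    {C : ℝ≥0∞} (hyp : ∀ x, ∫⁻ ω, ‖X x ω‖ₑ ^ (2 * (k * m)) ∂P ≤
      C * (∫⁻ ω, ‖X x ω‖ₑ ^ 2 ∂P) ^ (k * m))
    (hc : UniformMeanBound (fun x => ∫⁻ ω, ‖X x ω‖ₑ ^ 2 ∂P) c) :
    ∫⁻ ω, (∫⁻ x, ‖X x ω‖ₑ ^ (2 * k)) ^ m ∂P ≤ C * c ^ (k * m) := by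
  have hm' : (0 : ℝ) < m := by positivity
  have h1 : ∀ x : ℝ≥0∞, (x ^ m) ^ (1 / (m : ℝ)) = x := fun x => by
    rw [← ENNReal.rpow_natCast, ← ENNReal.rpow_mul, mul_one_div_cancel hm'.ne', ENNReal.rpow_one]
  have h2 : ∀ x : ℝ≥0∞, (x ^ (1 / (m : ℝ))) ^ m = x := fun x => by
    rw [← ENNReal.rpow_natCast, ← ENNReal.rpow_mul, one_div_mul_cancel hm'.ne', ENNReal.rpow_one]
  have hXs : Measurable (Function.uncurry fun ω x => X x ω) := hX.comp measurable_swap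
  refine (lintegral_lintegral_pow_le volume P (f := fun ω x => ‖X x ω‖ₑ ^ (2 * k))
    (hXs.enorm.pow_const _) hm).trans ?_
  -- After Minkowski's inequality and hypercontractivity, k - 1 of the k second moments are bounded
  -- uniformly and the last one is kept for the integral over x.
  calc _ ≤ (∫⁻ x, C ^ (1 / (m : ℝ)) * (c ^ (k - 1) * ∫⁻ ω, ‖X x ω‖ₑ ^ 2 ∂P)) ^ m := by
        refine pow_le_pow_left₀ zero_le (lintegral_mono fun x => ?_) m
        simp_rw [← pow_mul, mul_assoc 2 k m]
        calc _ ≤ (C * (∫⁻ ω, ‖X x ω‖ₑ ^ 2 ∂P) ^ (k * m)) ^ (1 / (m : ℝ)) := by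
              gcongr; exact hyp x
          _ = C ^ (1 / (m : ℝ)) * (∫⁻ ω, ‖X x ω‖ₑ ^ 2 ∂P) ^ k := by
              rw [ENNReal.mul_rpow_of_nonneg _ _ (by positivity), pow_mul, h1]
          _ ≤ _ := by
              refine mul_le_mul_right ?_ _
              obtain ⟨j, rfl⟩ := Nat.exists_eq_succ_of_ne_zero hk
              rw [Nat.succ_eq_add_one, pow_succ, Nat.add_sub_cancel]
              exact mul_le_mul_left (pow_le_pow_left₀ zero_le (hc.1 x) j) _
    _ = (C ^ (1 / (m : ℝ)) * (c ^ (k - 1) * ∫⁻ x, ∫⁻ ω, ‖X x ω‖ₑ ^ 2 ∂P)) ^ m := by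
        have hmeas : Measurable fun x => ∫⁻ ω, ‖X x ω‖ₑ ^ 2 ∂P :=
          (hX.enorm.pow_const 2).lintegral_prod_right'
        rw [lintegral_const_mul _ (hmeas.const_mul _), lintegral_const_mul _ hmeas]
    _ ≤ (C ^ (1 / (m : ℝ)) * (c ^ (k - 1) * c)) ^ m := by gcongr; exact hc.2
    _ = _ := by
        obtain ⟨j, rfl⟩ := Nat.exists_eq_succ_of_ne_zero hk
        rw [Nat.succ_eq_add_one, Nat.add_sub_cancel, ← pow_succ, mul_pow, h2, ← pow_mul]

end

end

/-! ### Covariances of the Wick squares and of their increments. -/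

section

section Numeric

theorem enorm_sub_sq_le (a b : ℝ) : ‖a - b‖ₑ ^ 2 ≤ 2 * ‖a‖ₑ ^ 2 + 2 * ‖b‖ₑ ^ 2 := by
  simp_rw [enorm_sq_eq_ofReal, Real.norm_eq_abs, sq_abs]
  rw [show (2 : ℝ≥0∞) = ENNReal.ofReal 2 by simp, ← ENNReal.ofReal_mul (by norm_num),
    ← ENNReal.ofReal_mul (by norm_num), ← ENNReal.ofReal_add (by positivity) (by positivity)]
  exact ENNReal.ofReal_le_ofReal (by nlinarith [sq_nonneg (a + b)])

theorem UniformMeanBound.of_le_add {E : Type*} [MeasureSpace E] {u v w : E → ℝ≥0∞} {a b : ℝ≥0∞}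
    (hv : UniformMeanBound v a) (hw : UniformMeanBound w b) (hvm : Measurable v)
    (h : ∀ x, u x ≤ 2 * v x + 2 * w x) : UniformMeanBound u (2 * a + 2 * b) := by
  refine ⟨fun x => (h x).trans (add_le_add (mul_le_mul_right (hv.1 x) _)
    (mul_le_mul_right (hw.1 x) _)), (lintegral_mono h).trans ?_⟩
  rw [lintegral_add_left (hvm.const_mul _), lintegral_const_mul' _ _ (by simp),
    lintegral_const_mul' _ _ (by simp)]
  exact add_le_add (mul_le_mul_right hv.2 _) (mul_le_mul_right hw.2 _)

theorem exists_min_le_rpow {ε : ℝ} (hε : 0 < ε) : ∃ θ : ℝ, 0 < θ ∧ ∀ (n : ℕ) (τ : ℝ), 0 ≤ τ →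
    min (((4 : ℝ) ^ n) ^ (-ε)) (16384 ^ n * τ) ≤ ((2 : ℝ) ^ n) ^ (-θ) * τ ^ θ := by
  -- With L = 2^n the two bounds are L^(-2ε) and L^14 τ; their geometric mean with weights 1 - θ and
  -- θ has L-exponent -2ε(1 - θ) + 14θ, and this θ makes it equal to -θ.
  refine ⟨2 * ε / (15 + 2 * ε), by positivity, fun n τ hτ => ?_⟩
  set θ := 2 * ε / (15 + 2 * ε) with hθ
  have hθ0 : 0 < θ := by positivity
  have hθ1 : θ < 1 := by rw [hθ, div_lt_one (by positivity)]; linarith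
  have hθe : θ * (15 + 2 * ε) = 2 * ε := div_mul_cancel₀ _ (by positivity)
  set L : ℝ := 2 ^ n
  have hL : 1 ≤ L := one_le_pow₀ (by norm_num)
  have hL0 : 0 < L := by linarith
  have e1 : ((4 : ℝ) ^ n) ^ (-ε) = L ^ (-(2 * ε)) := by
    rw [show (4 : ℝ) ^ n = L ^ (2 : ℝ) by
      rw [Real.rpow_ofNat, ← pow_mul, mul_comm, pow_mul]; norm_num, ← Real.rpow_mul hL0.le]
    ring_nf
  have e2 : (16384 : ℝ) ^ n = L ^ (14 : ℝ) := by
    rw [Real.rpow_ofNat, ← pow_mul, mul_comm, pow_mul]; norm_num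
  rw [e1, e2]
  set a := L ^ (-(2 * ε))
  set b := L ^ (14 : ℝ) * τ
  have ha : 0 < a := by positivity
  have hb : 0 ≤ b := by positivity
  have hm : 0 ≤ min a b := le_min ha.le hb
  calc min a b = (min a b) ^ ((1 - θ) + θ) := by rw [sub_add_cancel, Real.rpow_one]
    _ = (min a b) ^ (1 - θ) * (min a b) ^ θ :=
        Real.rpow_add_of_nonneg hm (by linarith) hθ0.le
    _ ≤ a ^ (1 - θ) * b ^ θ := by
        gcongr
        · exact min_le_left _ _
        · exact min_le_right _ _
    _ = L ^ (-(2 * ε) * (1 - θ) + 14 * θ) * τ ^ θ := by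
        rw [Real.mul_rpow (by positivity) hτ, ← Real.rpow_mul hL0.le, ← Real.rpow_mul hL0.le,
          ← mul_assoc, ← Real.rpow_add hL0]
    _ ≤ L ^ (-θ) * τ ^ θ := by
        gcongr
        linarith

end Numeric

variable {d : ℕ} {H : Fin (d + 1) → ℝ} {Ω : Type*} [MeasurableSpace Ω] {P : Measure Ω}
  {Ψ : ℕ+ → ℝ≥0 → EuclideanSpace ℝ (Fin d) → Ω → ℂ}

/-- The covariance of the Wick squares of two linear solutions, the first one being truncated at
the lower level `n`. -/
noncomputable def wickCov (H : Fin (d + 1) → ℝ) (n : ℕ+) (s t : ℝ)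
    (v : EuclideanSpace ℝ (Fin d)) : ℝ :=
  hurstConst H ^ 4 * (‖waveKernel (freqDomain d n) (covDensity H true s t) v‖ ^ 2 +
    ‖waveKernel (freqDomain d n) (covDensity H false s t) v‖ ^ 2)

theorem lintegral_enorm_sq_eq {X : Ω → ℝ} (hX : MemLp X 2 P) :
    ∫⁻ ω, ‖X ω‖ₑ ^ 2 ∂P = ENNReal.ofReal (∫ ω, X ω * X ω ∂P) := by
  simp_rw [enorm_sq_eq_ofReal, Real.norm_eq_abs, sq_abs]
  rw [← ofReal_integral_eq_lintegral_ofReal hX.integrable_sq (ae_of_all _ fun _ => sq_nonneg _)]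
  simp_rw [sq]

theorem integral_sub_mul_sub {a b a' b' : Ω → ℝ} (ha : MemLp a 2 P) (hb : MemLp b 2 P)
    (ha' : MemLp a' 2 P) (hb' : MemLp b' 2 P) :
    ∫ ω, (a ω - b ω) * (a' ω - b' ω) ∂P = (∫ ω, a ω * a' ω ∂P - ∫ ω, a ω * b' ω ∂P) -
      (∫ ω, b ω * a' ω ∂P - ∫ ω, b ω * b' ω ∂P) := by
  have h1 : Integrable (fun ω => a ω * a' ω) P := ha.integrable_mul ha'
  have h2 : Integrable (fun ω => a ω * b' ω) P := ha.integrable_mul hb'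
  have h3 : Integrable (fun ω => b ω * a' ω) P := hb.integrable_mul ha'
  have h4 : Integrable (fun ω => b ω * b' ω) P := hb.integrable_mul hb'
  have h12 : Integrable (fun ω => a ω * a' ω - a ω * b' ω) P := h1.sub h2
  have h34 : Integrable (fun ω => b ω * a' ω - b ω * b' ω) P := h3.sub h4
  rw [← integral_sub h1 h2, ← integral_sub h3 h4, ← integral_sub h12 h34]
  refine integral_congr_ae (ae_of_all _ fun ω => ?_)
  simp only
  ring

section Cov

variable [IsProbabilityMeasure P]

theorem integral_wickSquare_mul (hΨ : IsLinearSolution H P Ψ) {k n m : ℕ+}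
    (hk : freqDomain d n ∩ freqDomain d m = freqDomain d k)
    (s t : ℝ≥0) (x y : EuclideanSpace ℝ (Fin d)) :
    ∫ ω, wickSquare P Ψ n s x ω * wickSquare P Ψ m t y ω ∂P = wickCov H k s t (x - y) := by
  have h := integral_norm_sq_sub_mul hΨ.gaussian (fun i => hΨ.centered i.1 i.2.1 i.2.2)
    (n, s, x) (m, t, y)
  simp only at h
  rw [hΨ.covariance, hΨ.pseudoCovariance, hk] at h
  unfold wickSquare
  rw [h]
  unfold wickCov waveKernel covDensity
  simp only [norm_mul, norm_neg, norm_pow, Complex.norm_real, Real.norm_eq_abs, mul_pow, sq_abs,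
    if_true, Bool.false_eq_true, if_false]
  ring

theorem memLp_wickSquare (hΨ : IsLinearSolution H P Ψ) (n : ℕ+) (t : ℝ≥0)
    (x : EuclideanSpace ℝ (Fin d)) : MemLp (wickSquare P Ψ n t x) 2 P :=
  memLp_norm_sq_sub hΨ.gaussian (n, t, x)

/-- The increment of the Wick squares between two consecutive truncation levels. -/
noncomputable def wickIncr (P : Measure Ω) (Ψ : ℕ+ → ℝ≥0 → EuclideanSpace ℝ (Fin d) → Ω → ℂ)
    (n : ℕ+) (t : ℝ≥0) (x : EuclideanSpace ℝ (Fin d)) (ω : Ω) : ℝ :=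
  wickSquare P Ψ (n + 1) t x ω - wickSquare P Ψ n t x ω

theorem memLp_wickIncr (hΨ : IsLinearSolution H P Ψ) (n : ℕ+) (t : ℝ≥0)
    (x : EuclideanSpace ℝ (Fin d)) : MemLp (wickIncr P Ψ n t x) 2 P :=
  (memLp_wickSquare hΨ (n + 1) t x).sub (memLp_wickSquare hΨ n t x)

theorem freqDomain_inter_succ (n : ℕ+) :
    freqDomain d n ∩ freqDomain d (n + 1) = freqDomain d n :=
  Set.inter_eq_left.mpr (freqDomain_mono (PNat.lt_add_right n 1).le)

/-- Because the frequency domains are nested, the mixed covariance of two levels is that of the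
lower one, and three of the four terms collapse. -/
theorem integral_wickIncr_mul (hΨ : IsLinearSolution H P Ψ) (n : ℕ+) (t : ℝ≥0)
    (x y : EuclideanSpace ℝ (Fin d)) :
    ∫ ω, wickIncr P Ψ n t x ω * wickIncr P Ψ n t y ω ∂P =
      wickCov H (n + 1) t t (x - y) - wickCov H n t t (x - y) := by
  unfold wickIncr
  rw [integral_sub_mul_sub (memLp_wickSquare hΨ _ _ _) (memLp_wickSquare hΨ _ _ _)
    (memLp_wickSquare hΨ _ _ _) (memLp_wickSquare hΨ _ _ _),
    integral_wickSquare_mul hΨ (Set.inter_self _),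
    integral_wickSquare_mul hΨ (k := n) (by rw [Set.inter_comm, freqDomain_inter_succ]),
    integral_wickSquare_mul hΨ (k := n) (freqDomain_inter_succ n),
    integral_wickSquare_mul hΨ (Set.inter_self _)]
  ring

theorem abs_norm_sq_sub_norm_sq_le {a b : ℂ} {c e : ℝ} (ha : ‖a‖ ≤ c) (hb : ‖b‖ ≤ c)
    (hab : ‖a - b‖ ≤ e) : |‖a‖ ^ 2 - ‖b‖ ^ 2| ≤ 2 * c * e := by
  rw [sq_sub_sq, abs_mul, abs_of_nonneg (by positivity)]
  have h := (abs_norm_sub_norm_le a b).trans hab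
  have hc : 0 ≤ c := (norm_nonneg a).trans ha
  calc _ ≤ (c + c) * e := by gcongr
    _ = _ := by ring

/-- The second moment is a combination of differences in which only the second time varies. A
difference of squared kernels costs the size 64^n times the Lipschitz constant 256^n, and 16384 = 64
· 256. -/
theorem exists_lintegral_wickSquare_sub_le (hd : 1 ≤ d)
    (hH : ∀ j, H j ∈ Set.Ioo (0 : ℝ) 1) (hup : 2 * H 0 + ∑ i : Fin d, H i.succ ≤ (d : ℝ) + 1)
    {α : ℝ} (hα : (d : ℝ) + 1 - (2 * H 0 + ∑ i : Fin d, H i.succ) < α) (hα' : α < 1 / 4)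
    (hΨ : IsLinearSolution H P Ψ) (T : ℝ≥0) :
    ∃ C : ℝ, 0 ≤ C ∧ ∀ (n : ℕ+) (s t : ℝ≥0) (x : EuclideanSpace ℝ (Fin d)), s ≤ T → t ≤ T →
      ∫⁻ ω, ‖wickSquare P Ψ n t x ω - wickSquare P Ψ n s x ω‖ₑ ^ 2 ∂P ≤
        ENNReal.ofReal (C * 16384 ^ (n : ℕ) * |(t : ℝ) - s|) := by
  obtain ⟨C, hC, hb⟩ := exists_norm_waveKernel_le hd hH hup hα hα' (T := T) T.2
  refine ⟨8 * hurstConst H ^ 4 * C ^ 2, by positivity, fun n s t x hs ht => ?_⟩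
  rw [lintegral_enorm_sq_eq (X := fun ω => wickSquare P Ψ n t x ω - wickSquare P Ψ n s x ω)
    ((memLp_wickSquare hΨ n t x).sub (memLp_wickSquare hΨ n s x))]
  refine ENNReal.ofReal_le_ofReal ?_
  rw [integral_sub_mul_sub (memLp_wickSquare hΨ _ _ _) (memLp_wickSquare hΨ _ _ _)
    (memLp_wickSquare hΨ _ _ _) (memLp_wickSquare hΨ _ _ _)]
  simp_rw [integral_wickSquare_mul hΨ (Set.inter_self (freqDomain d n))]
  have hs' : |(s : ℝ)| ≤ (T : ℝ) := by
    rw [abs_of_nonneg (NNReal.coe_nonneg s)]; exact_mod_cast hs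
  have ht' : |(t : ℝ)| ≤ (T : ℝ) := by
    rw [abs_of_nonneg (NNReal.coe_nonneg t)]; exact_mod_cast ht
  have key : ∀ (b : Bool) (p q : ℝ), |p| ≤ T → |q| ≤ T → ∀ v,
      |‖waveKernel (freqDomain d n) (covDensity H b p p) v‖ ^ 2 -
        ‖waveKernel (freqDomain d n) (covDensity H b p q) v‖ ^ 2| ≤
        2 * (C * 64 ^ (n : ℕ)) * (C * 256 ^ (n : ℕ) * |p - q|) := fun b p q hp hq v =>
    abs_norm_sq_sub_norm_sq_le (hb n b p p q hp hp hq v).1 (hb n b p q q hp hq hq v).1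
      (hb n b p p q hp hp hq v).2
  have key2 : ∀ (p q : ℝ), |p| ≤ T → |q| ≤ T → ∀ v,
      wickCov H n p p v - wickCov H n p q v ≤
        4 * hurstConst H ^ 4 * C ^ 2 * 16384 ^ (n : ℕ) * |p - q| := fun p q hp hq v => by
    have h1 := (le_abs_self _).trans (key true p q hp hq v)
    have h2 := (le_abs_self _).trans (key false p q hp hq v)
    have h4 : 0 ≤ hurstConst H ^ 4 := by positivity
    unfold wickCov
    rw [← mul_sub]
    calc _ ≤ hurstConst H ^ 4 * (2 * (C * 64 ^ (n : ℕ)) * (C * 256 ^ (n : ℕ) * |p - q|) +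
          2 * (C * 64 ^ (n : ℕ)) * (C * 256 ^ (n : ℕ) * |p - q|)) := by
          refine mul_le_mul_of_nonneg_left ?_ h4
          linarith
      _ = _ := by
          rw [show (16384 : ℝ) = 64 * 256 by norm_num, mul_pow]; ring
  have h1 := key2 t s ht' hs' (x - x)
  have h2 := key2 s t hs' ht' (x - x)
  rw [abs_sub_comm] at h2
  linarith

variable {φ : EuclideanSpace ℝ (Fin d) → ℝ}

theorem measurable_wickSquare (hm : ∀ n t, Measurable (Function.uncurry (Ψ n t)))
    (n : ℕ+) (t : ℝ≥0) :
    Measurable (Function.uncurry (wickSquare P Ψ n t)) := by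
  have h1 : Measurable fun z : EuclideanSpace ℝ (Fin d) × Ω => ‖Ψ n t z.1 z.2‖ ^ 2 :=
    (hm n t).norm.pow_const 2
  have h2 : Measurable fun x : EuclideanSpace ℝ (Fin d) => ∫ ω, ‖Ψ n t x ω‖ ^ 2 ∂P :=
    (h1.stronglyMeasurable.integral_prod_right' (ν := P)).measurable
  exact h1.sub (h2.comp measurable_fst)

theorem measurable_wickIncr (hm : ∀ n t, Measurable (Function.uncurry (Ψ n t)))
    (n : ℕ+) (t : ℝ≥0) :
    Measurable (Function.uncurry (wickIncr P Ψ n t)) :=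
  (measurable_wickSquare hm (n + 1) t).sub (measurable_wickSquare hm n t)

theorem lintegral_wickIncr_sq_eq (hΨ : IsLinearSolution H P Ψ) (n : ℕ+) (t : ℝ≥0)
    (x : EuclideanSpace ℝ (Fin d)) :
    ∫⁻ ω, ‖wickIncr P Ψ n t x ω‖ₑ ^ 2 ∂P =
      ENNReal.ofReal (wickCov H (n + 1) t t 0 - wickCov H n t t 0) := by
  rw [lintegral_enorm_sq_eq (memLp_wickIncr hΨ n t x), integral_wickIncr_mul hΨ, sub_self]

theorem measurable_waveKernel {S : Set (ℝ × EuclideanSpace ℝ (Fin d))}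
    {f : ℝ × EuclideanSpace ℝ (Fin d) → ℂ} (hf : IntegrableOn f S) :
    Measurable (waveKernel S f) := by
  have hc : Continuous (waveKernel S f) := by
    refine continuous_of_dominated (bound := fun z => ‖f z‖)
      (fun v => (integrable_waveKernel hf v).1) (fun v => ae_of_all _ fun z => ?_) hf.norm
      (ae_of_all _ fun z => by fun_prop)
    rw [norm_mul, norm_exp_I_mul_ofReal, mul_one]
  exact hc.measurable

/-- Second moments of the smoothed increments at a fixed time. -/
theorem exists_uniformMeanBound_wickIncr (hd : 1 ≤ d)
    (hH : ∀ j, H j ∈ Set.Ioo (0 : ℝ) 1) (hup : 2 * H 0 + ∑ i : Fin d, H i.succ ≤ (d : ℝ) + 1)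
    {α : ℝ} (hα : (d : ℝ) + 1 - (2 * H 0 + ∑ i : Fin d, H i.succ) < α) (hα' : α < 1 / 4)
    (hΨ : IsLinearSolution H P Ψ) (hm : ∀ n t, Measurable (Function.uncurry (Ψ n t)))
    (T : ℝ≥0) (hφ : Measurable φ) {A : ℝ≥0∞} (hA : A ≠ ⊤) (hφA : ∀ x, ‖φ x‖ₑ ≤ A)
    (hφi : ∫⁻ x, ‖φ x‖ₑ ≤ A) :
    ∃ ε : ℝ, 0 < ε ∧ ∃ C : ℝ≥0∞, C ≠ ⊤ ∧ ∀ (n : ℕ+) (t : ℝ≥0), t ≤ T →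
      UniformMeanBound (fun x => ∫⁻ ω, ‖fieldPot (besselMeasure _ α) φ (wickIncr P Ψ n t) x ω‖ₑ ^ 2 ∂P)
        (C * ENNReal.ofReal (((4 : ℝ) ^ (n : ℕ)) ^ (-ε))) := by
  have hα0 : 0 < α := by linarith
  have hJ := isProbabilityMeasure_besselMeasure (E := EuclideanSpace ℝ (Fin d)) hα0
  obtain ⟨C₀, -, hint⟩ := exists_integral_freqDomain_spectralWeight_le hd hH hup hα hα'
  obtain ⟨ε, hε, C, hC, h⟩ := exists_lintegral_sq_waveKernel_sub_le hd hH hup hα hα' T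
  set h4 := ENNReal.ofReal (hurstConst H ^ 4) with hh4
  refine ⟨ε, hε, A ^ 2 * (h4 * (C + C)), ENNReal.mul_ne_top (by finiteness) (ENNReal.mul_ne_top
    (by simp [hh4]) (by simp [hC])), fun n t ht => ?_⟩
  have ht' : |(t : ℝ)| ≤ (T : ℝ) := by
    rw [abs_of_nonneg (NNReal.coe_nonneg t)]; exact_mod_cast ht
  set κ : Bool → EuclideanSpace ℝ (Fin d) → ℝ := fun b v =>
    ‖waveKernel (freqDomain d (n + 1)) (covDensity H b t t) v‖ ^ 2 -
      ‖waveKernel (freqDomain d n) (covDensity H b t t) v‖ ^ 2 with hκ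
  have hκm : ∀ b, Measurable (κ b) := fun b =>
    ((measurable_waveKernel (integrableOn_covDensity (hint (n + 1)).1 b t t)).norm.pow_const 2).sub
      ((measurable_waveKernel (integrableOn_covDensity (hint n).1 b t t)).norm.pow_const 2)
  have hM : ∀ y, ∫⁻ ω, ‖wickIncr P Ψ n t y ω‖ₑ ^ 2 ∂P ≤
      ENNReal.ofReal (wickCov H (n + 1) t t 0 - wickCov H n t t 0) := fun y =>
    (lintegral_wickIncr_sq_eq hΨ n t y).le
  refine (uniformMeanBound_fieldPot_covariance (J := besselMeasure _ α) hφ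
    (measurable_wickIncr hm n t) hA ENNReal.ofReal_ne_top hφA hφi hM
    (k := fun p => h4 * (‖κ true (p.1 - p.2)‖ₑ + ‖κ false (p.1 - p.2)‖ₑ)) (by
      have := hκm true
      have := hκm false
      fun_prop) fun x u u' => ?_).mono ?_
  · rw [integral_wickIncr_mul hΨ, add_sub_add_left_eq_sub]
    have e : wickCov H (n + 1) t t (u - u') - wickCov H n t t (u - u') =
        hurstConst H ^ 4 * (κ true (u - u') + κ false (u - u')) := by
      simp only [wickCov, hκ]; ring
    rw [e, enorm_mul, Real.enorm_eq_ofReal (by positivity)]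
    exact mul_le_mul_right (enorm_add_le _ _) _
  · rw [mul_assoc]
    refine mul_le_mul_right ?_ _
    have hκt := hκm true
    rw [lintegral_const_mul' _ _ (by simp [hh4]), lintegral_add_left (by fun_prop), mul_assoc, add_mul]
    refine mul_le_mul_right ?_ _
    exact add_le_add (h n (n + 1) (PNat.lt_add_right n 1).le true t ht')
      (h n (n + 1) (PNat.lt_add_right n 1).le false t ht')

/-- Second moments of the smoothed increments in time, with a growing constant. -/
theorem exists_uniformMeanBound_wickIncr_sub (hd : 1 ≤ d)
    (hH : ∀ j, H j ∈ Set.Ioo (0 : ℝ) 1) (hup : 2 * H 0 + ∑ i : Fin d, H i.succ ≤ (d : ℝ) + 1)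
    {α : ℝ} (hα : (d : ℝ) + 1 - (2 * H 0 + ∑ i : Fin d, H i.succ) < α) (hα' : α < 1 / 4)
    (hΨ : IsLinearSolution H P Ψ) (hm : ∀ n t, Measurable (Function.uncurry (Ψ n t)))
    (T : ℝ≥0) (hφ : Measurable φ) {A : ℝ≥0∞} (hA : A ≠ ⊤) (hφA : ∀ x, ‖φ x‖ₑ ≤ A)
    (hφi : ∫⁻ x, ‖φ x‖ₑ ≤ A) :
    ∃ C : ℝ≥0∞, C ≠ ⊤ ∧ ∀ (n : ℕ+) (s t : ℝ≥0), s ≤ T → t ≤ T →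
      UniformMeanBound (fun x => ∫⁻ ω, ‖fieldPot (besselMeasure _ α) φ
        (fun y ω => wickIncr P Ψ n t y ω - wickIncr P Ψ n s y ω) x ω‖ₑ ^ 2 ∂P)
        (C * ENNReal.ofReal (16384 ^ (n : ℕ) * |(t : ℝ) - s|)) := by
  have hα0 : 0 < α := by linarith
  have hJ := isProbabilityMeasure_besselMeasure (E := EuclideanSpace ℝ (Fin d)) hα0
  obtain ⟨C, hC, h⟩ := exists_lintegral_wickSquare_sub_le hd hH hup hα hα' hΨ T
  refine ⟨A ^ 2 * ENNReal.ofReal (2 * C * 16384 + 2 * C), by finiteness, fun n s t hs ht => ?_⟩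
  have hD : ∀ y, ∫⁻ ω, ‖wickIncr P Ψ n t y ω - wickIncr P Ψ n s y ω‖ₑ ^ 2 ∂P ≤
      ENNReal.ofReal (2 * C * 16384 + 2 * C) * ENNReal.ofReal (16384 ^ (n : ℕ) * |(t : ℝ) - s|) := by
    intro y
    calc _ ≤ ∫⁻ ω, (2 * ‖wickSquare P Ψ (n + 1) t y ω - wickSquare P Ψ (n + 1) s y ω‖ₑ ^ 2 +
          2 * ‖wickSquare P Ψ n t y ω - wickSquare P Ψ n s y ω‖ₑ ^ 2) ∂P := by
          refine lintegral_mono fun ω => ?_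
          refine le_trans (le_of_eq ?_) (enorm_sub_sq_le _ _)
          congr 2
          unfold wickIncr
          ring
      _ = 2 * ∫⁻ ω, ‖wickSquare P Ψ (n + 1) t y ω - wickSquare P Ψ (n + 1) s y ω‖ₑ ^ 2 ∂P +
          2 * ∫⁻ ω, ‖wickSquare P Ψ n t y ω - wickSquare P Ψ n s y ω‖ₑ ^ 2 ∂P := by
          rw [lintegral_add_left', lintegral_const_mul' _ _ (by simp),
            lintegral_const_mul' _ _ (by simp)]
          exact ((((memLp_wickSquare hΨ (n + 1) t y).sub
            (memLp_wickSquare hΨ (n + 1) s y)).1.enorm).pow_const 2).const_mul 2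
      _ ≤ 2 * ENNReal.ofReal (C * 16384 ^ ((n + 1 : ℕ+) : ℕ) * |(t : ℝ) - s|) +
          2 * ENNReal.ofReal (C * 16384 ^ (n : ℕ) * |(t : ℝ) - s|) := by
          gcongr
          · exact h (n + 1) s t y hs ht
          · exact h n s t y hs ht
      _ = _ := by
          rw [show (2 : ℝ≥0∞) = ENNReal.ofReal 2 by simp, ← ENNReal.ofReal_mul (by norm_num),
            ← ENNReal.ofReal_mul (by norm_num), ← ENNReal.ofReal_add (by positivity) (by positivity),
            ← ENNReal.ofReal_mul (by positivity), PNat.add_coe, PNat.one_coe, pow_succ]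
          congr 1
          ring
  rw [mul_assoc]
  exact uniformMeanBound_fieldPot_sq hφ
    ((measurable_wickIncr hm n t).sub (measurable_wickIncr hm n s)) hφA hφi hD

end Cov

end

/-! ### Sample continuity and decaying bounds for time increments. -/

section

section

variable {d : ℕ} {H : Fin (d + 1) → ℝ} {Ω : Type*} [MeasurableSpace Ω] {P : Measure Ω}
  {Ψ : ℕ+ → ℝ≥0 → EuclideanSpace ℝ (Fin d) → Ω → ℂ}

theorem ofReal_integral_norm_sq (n : ℕ+) (t : ℝ≥0) (x : EuclideanSpace ℝ (Fin d)) :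
    ((∫ ω, ‖Ψ n t x ω‖ ^ 2 ∂P : ℝ) : ℂ) =
      ∫ ω, Ψ n t x ω * (starRingEnd ℂ) (Ψ n t x ω) ∂P := by
  rw [← integral_complex_ofReal]
  refine integral_congr_ae (ae_of_all _ fun ω => ?_)
  simp only
  rw [Complex.mul_conj, Complex.normSq_eq_norm_sq]

theorem integral_mul_conj_eq (hΨ : IsLinearSolution H P Ψ) (n : ℕ+) (s t : ℝ≥0)
    (x y : EuclideanSpace ℝ (Fin d)) :
    ∫ ω, Ψ n s x ω * (starRingEnd ℂ) (Ψ n t y ω) ∂P =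
      (hurstConst H : ℂ) ^ 2 * waveKernel (freqDomain d n) (covDensity H true s t) (x - y) := by
  rw [hΨ.covariance, Set.inter_self]
  unfold waveKernel covDensity
  simp

/-- Needed to know that the subtracted variance is continuous, so that the Wick squares inherit the
sample continuity of Ψ. -/
theorem exists_abs_integral_norm_sq_sub_le (hd : 1 ≤ d)
    (hH : ∀ j, H j ∈ Set.Ioo (0 : ℝ) 1) (hup : 2 * H 0 + ∑ i : Fin d, H i.succ ≤ (d : ℝ) + 1)
    {α : ℝ} (hα : (d : ℝ) + 1 - (2 * H 0 + ∑ i : Fin d, H i.succ) < α) (hα' : α < 1 / 4)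
    (hΨ : IsLinearSolution H P Ψ) (T : ℝ≥0) :
    ∃ C : ℝ, 0 ≤ C ∧ ∀ (n : ℕ+) (s t : ℝ≥0) (x y : EuclideanSpace ℝ (Fin d)), s ≤ T → t ≤ T →
      |∫ ω, ‖Ψ n t x ω‖ ^ 2 ∂P - ∫ ω, ‖Ψ n s y ω‖ ^ 2 ∂P| ≤ C * 256 ^ (n : ℕ) * |(t : ℝ) - s| := by
  obtain ⟨C, hC, hb⟩ := exists_norm_waveKernel_le hd hH hup hα hα' (T := T) T.2
  refine ⟨2 * hurstConst H ^ 2 * C, by positivity, fun n s t x y hs ht => ?_⟩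
  have hs' : |(s : ℝ)| ≤ (T : ℝ) := by
    rw [abs_of_nonneg (NNReal.coe_nonneg s)]; exact_mod_cast hs
  have ht' : |(t : ℝ)| ≤ (T : ℝ) := by
    rw [abs_of_nonneg (NNReal.coe_nonneg t)]; exact_mod_cast ht
  set K : ℝ → ℝ → ℂ := fun p q => waveKernel (freqDomain d n) (covDensity H true p q) 0 with hK
  have e1 : ∀ r z, ((∫ ω, ‖Ψ n r z ω‖ ^ 2 ∂P : ℝ) : ℂ) = (hurstConst H : ℂ) ^ 2 * K r r :=
    fun r z => by rw [ofReal_integral_norm_sq, integral_mul_conj_eq hΨ, sub_self]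
  -- The Lipschitz bound for the kernels moves the second time only; Hermitian symmetry transfers it
  -- to the first.
  have e2 : (hurstConst H : ℂ) ^ 2 * K t s =
      (starRingEnd ℂ) ((hurstConst H : ℂ) ^ 2 * K s t) := by
    have h1 := integral_mul_conj_eq hΨ n t s x x
    have h2 := integral_mul_conj_eq hΨ n s t x x
    rw [sub_self] at h1 h2
    rw [← h1, ← h2, ← integral_conj]
    refine integral_congr_ae (ae_of_all _ fun ω => ?_)
    simp [mul_comm]
  have e3 : (hurstConst H : ℂ) ^ 2 * K s s =
      (starRingEnd ℂ) ((hurstConst H : ℂ) ^ 2 * K s s) := by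
    rw [← e1 s x, Complex.conj_ofReal]
  have hc : ‖(hurstConst H : ℂ) ^ 2‖ = hurstConst H ^ 2 := by simp
  have h1 : ‖(hurstConst H : ℂ) ^ 2 * K t t - (hurstConst H : ℂ) ^ 2 * K t s‖ ≤
      hurstConst H ^ 2 * (C * 256 ^ (n : ℕ) * |(t : ℝ) - s|) := by
    rw [← mul_sub, norm_mul, hc]
    exact mul_le_mul_of_nonneg_left (hb n true t t s ht' ht' hs' 0).2 (sq_nonneg _)
  have h2 : ‖(hurstConst H : ℂ) ^ 2 * K t s - (hurstConst H : ℂ) ^ 2 * K s s‖ ≤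
      hurstConst H ^ 2 * (C * 256 ^ (n : ℕ) * |(t : ℝ) - s|) := by
    rw [e2, e3, ← map_sub, RCLike.norm_conj, ← mul_sub, norm_mul, hc]
    exact mul_le_mul_of_nonneg_left (hb n true s t s hs' ht' hs' 0).2 (sq_nonneg _)
  rw [← Real.norm_eq_abs, ← Complex.norm_real, Complex.ofReal_sub, e1, e1]
  refine (norm_sub_le_norm_sub_add_norm_sub _ ((hurstConst H : ℂ) ^ 2 * K t s) _).trans ?_
  linarith

theorem continuous_wickSquare (hd : 1 ≤ d)
    (hH : ∀ j, H j ∈ Set.Ioo (0 : ℝ) 1) (hup : 2 * H 0 + ∑ i : Fin d, H i.succ ≤ (d : ℝ) + 1)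
    {α : ℝ} (hα : (d : ℝ) + 1 - (2 * H 0 + ∑ i : Fin d, H i.succ) < α) (hα' : α < 1 / 4)
    (hΨ : IsLinearSolution H P Ψ) {n : ℕ+} {ω : Ω}
    (hc : Continuous fun z : ℝ≥0 × EuclideanSpace ℝ (Fin d) => Ψ n z.1 z.2 ω) :
    Continuous fun z : ℝ≥0 × EuclideanSpace ℝ (Fin d) => wickSquare P Ψ n z.1 z.2 ω := by
  refine (hc.norm.pow 2).sub (continuous_iff_continuousAt.mpr fun z => ?_)
  obtain ⟨C, -, h⟩ := exists_abs_integral_norm_sq_sub_le hd hH hup hα hα' hΨ (z.1 + 1)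
  rw [ContinuousAt, tendsto_iff_dist_tendsto_zero]
  have h0 : Tendsto (fun y : ℝ≥0 × EuclideanSpace ℝ (Fin d) =>
      C * 256 ^ (n : ℕ) * |(y.1 : ℝ) - z.1|) (𝓝 z) (𝓝 0) := by
    have : Continuous fun y : ℝ≥0 × EuclideanSpace ℝ (Fin d) =>
      C * 256 ^ (n : ℕ) * |(y.1 : ℝ) - z.1| := by fun_prop
    simpa using this.tendsto z
  refine squeeze_zero' (Eventually.of_forall fun _ => dist_nonneg) ?_ h0
  have hz : ∀ᶠ y : ℝ≥0 × EuclideanSpace ℝ (Fin d) in 𝓝 z, y.1 < z.1 + 1 :=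
    continuous_fst.continuousAt.eventually_lt continuousAt_const (by simp)
  filter_upwards [hz] with y hy
  rw [Real.dist_eq]
  exact h n z.1 y.1 y.2 z.2 (by simp) hy.le

end

theorem fieldPot_sub {E : Type*} [NormedAddCommGroup E] [InnerProductSpace ℝ E]
    [FiniteDimensional ℝ E] [MeasurableSpace E] [BorelSpace E] {Ω : Type*} {J : Measure E}
    [IsProbabilityMeasure J] {φ : E → ℝ} (hφ : Continuous φ) (hφc : HasCompactSupport φ)
    {D D' : E → Ω → ℝ} {ω : Ω} (hD : Continuous fun x => D x ω) (hD' : Continuous fun x => D' x ω)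
    (x : E) :
    fieldPot J φ (fun y ω => D y ω - D' y ω) x ω = fieldPot J φ D x ω - fieldPot J φ D' x ω := by
  have hi : ∀ g : E → ℝ, Continuous g → Integrable (fun u => φ (x + u) * g (x + u)) J := by
    intro g hg
    obtain ⟨C, hC⟩ := (hφ.mul hg).bounded_above_of_compact_support hφc.mul_right
    exact (integrable_const C).mono'
      (by fun_prop : Continuous fun u => φ (x + u) * g (x + u)).aestronglyMeasurable
      (ae_of_all _ fun u => hC (x + u))
  unfold fieldPot
  rw [← integral_sub (hi _ hD) (hi _ hD')]
  simp_rw [mul_sub]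

section

variable {d : ℕ} {H : Fin (d + 1) → ℝ} {Ω : Type*} [MeasurableSpace Ω] {P : Measure Ω}
  {Ψ : ℕ+ → ℝ≥0 → EuclideanSpace ℝ (Fin d) → Ω → ℂ} [IsProbabilityMeasure P]
  {φ : EuclideanSpace ℝ (Fin d) → ℝ}

theorem integral_wickIncr_mul_eq_zero (hΨ : IsLinearSolution H P Ψ) {Y : Ω → ℝ} (hY : MemLp Y 2 P)
    (h : ∀ i : ℕ+ × ℝ≥0 × EuclideanSpace ℝ (Fin d),
      ∫ ω, (‖Ψ i.1 i.2.1 i.2.2 ω‖ ^ 2 - ∫ ω', ‖Ψ i.1 i.2.1 i.2.2 ω'‖ ^ 2 ∂P) * Y ω ∂P = 0)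
    (n : ℕ+) (s t : ℝ≥0) (y : EuclideanSpace ℝ (Fin d)) :
    ∫ ω, (wickIncr P Ψ n t y ω - wickIncr P Ψ n s y ω) * Y ω ∂P = 0 := by
  have hi : ∀ (n : ℕ+) (t : ℝ≥0), Integrable (fun ω => wickSquare P Ψ n t y ω * Y ω) P :=
    fun n t => (memLp_wickSquare hΨ n t y).integrable_mul hY
  have h0 : ∀ (n : ℕ+) (t : ℝ≥0), ∫ ω, wickSquare P Ψ n t y ω * Y ω ∂P = 0 :=
    fun n t => h (n, t, y)
  have e : (fun ω => (wickIncr P Ψ n t y ω - wickIncr P Ψ n s y ω) * Y ω) = fun ω =>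
      (wickSquare P Ψ (n + 1) t y ω * Y ω - wickSquare P Ψ n t y ω * Y ω) -
      (wickSquare P Ψ (n + 1) s y ω * Y ω - wickSquare P Ψ n s y ω * Y ω) := by
    funext ω
    unfold wickIncr
    ring
  rw [e, integral_sub (by exact (hi _ _).sub (hi _ _)) (by exact (hi _ _).sub (hi _ _)),
    integral_sub (hi _ _) (hi _ _), integral_sub (hi _ _) (hi _ _)]
  simp [h0]

/-- Second moments of the smoothed increments in time, with a decaying constant. -/
theorem exists_uniformMeanBound_fieldPot_sub (hd : 1 ≤ d)
    (hH : ∀ j, H j ∈ Set.Ioo (0 : ℝ) 1) (hup : 2 * H 0 + ∑ i : Fin d, H i.succ ≤ (d : ℝ) + 1)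
    {α : ℝ} (hα : (d : ℝ) + 1 - (2 * H 0 + ∑ i : Fin d, H i.succ) < α) (hα' : α < 1 / 4)
    (hΨ : IsLinearSolution H P Ψ) (hm : ∀ n t, Measurable (Function.uncurry (Ψ n t)))
    (hc : ∀ n ω, Continuous fun z : ℝ≥0 × EuclideanSpace ℝ (Fin d) => Ψ n z.1 z.2 ω)
    (T : ℝ≥0) (hφ : Continuous φ) (hφc : HasCompactSupport φ) :
    ∃ θ : ℝ, 0 < θ ∧ ∃ C : ℝ≥0∞, C ≠ ⊤ ∧ ∀ (n : ℕ+) (s t : ℝ≥0), s ≤ T → t ≤ T →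
      UniformMeanBound (fun x => ∫⁻ ω, ‖fieldPot (besselMeasure _ α) φ
        (fun y ω => wickIncr P Ψ n t y ω - wickIncr P Ψ n s y ω) x ω‖ₑ ^ 2 ∂P)
        (C * ENNReal.ofReal (((2 : ℝ) ^ (n : ℕ)) ^ (-θ) * |(t : ℝ) - s| ^ θ)) := by
  have hα0 : 0 < α := by linarith
  have hJ := isProbabilityMeasure_besselMeasure (E := EuclideanSpace ℝ (Fin d)) hα0
  obtain ⟨A₁, hA₁⟩ := hφ.bounded_above_of_compact_support hφc
  have hi : ∫⁻ x, ‖φ x‖ₑ < ⊤ := (hφ.integrable_of_hasCompactSupport hφc).2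
  set A : ℝ≥0∞ := ENNReal.ofReal A₁ + ∫⁻ x, ‖φ x‖ₑ with hA
  have hA' : A ≠ ⊤ := ENNReal.add_ne_top.mpr ⟨ENNReal.ofReal_ne_top, hi.ne⟩
  have hφA : ∀ x, ‖φ x‖ₑ ≤ A := fun x => by
    refine le_trans ?_ le_self_add
    rw [← ofReal_norm]
    exact ENNReal.ofReal_le_ofReal (hA₁ x)
  have hφi : ∫⁻ x, ‖φ x‖ₑ ≤ A := le_add_self
  obtain ⟨ε, hε, C₁, hC₁, h1⟩ := exists_uniformMeanBound_wickIncr hd hH hup hα hα' hΨ hm T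
    hφ.measurable hA' hφA hφi
  obtain ⟨C₂, hC₂, h2⟩ := exists_uniformMeanBound_wickIncr_sub hd hH hup hα hα' hΨ hm T
    hφ.measurable hA' hφA hφi
  obtain ⟨θ, hθ, h3⟩ := exists_min_le_rpow hε
  refine ⟨θ, hθ, 4 * C₁ + C₂, by finiteness, fun n s t hs ht => ?_⟩
  have hw : ∀ n ω (t : ℝ≥0), Continuous fun x => wickIncr P Ψ n t x ω := fun n ω t =>
    ((continuous_wickSquare hd hH hup hα hα' hΨ (hc (n + 1) ω)).comp (Continuous.prodMk_right t)).sub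
      ((continuous_wickSquare hd hH hup hα hα' hΨ (hc n ω)).comp (Continuous.prodMk_right t))
  have hmX : ∀ t, Measurable (Function.uncurry
      (fieldPot (besselMeasure _ α) φ (wickIncr P Ψ n t))) := fun t =>
    measurable_fieldPot hφ.measurable (measurable_wickIncr hm n t)
  have h4 := (h1 n t ht).of_le_add (h1 n s hs) ((hmX t).enorm.pow_const 2).lintegral_prod_right'
    (u := fun x => ∫⁻ ω, ‖fieldPot (besselMeasure _ α) φ
        (fun y ω => wickIncr P Ψ n t y ω - wickIncr P Ψ n s y ω) x ω‖ₑ ^ 2 ∂P) fun x => by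
      have hmt : Measurable fun ω => fieldPot (besselMeasure _ α) φ (wickIncr P Ψ n t) x ω :=
        (hmX t).comp measurable_prodMk_left
      rw [← lintegral_const_mul' _ _ (by simp), ← lintegral_const_mul' _ _ (by simp),
        ← lintegral_add_left (by fun_prop)]
      refine lintegral_mono fun ω => ?_
      simp only
      rw [fieldPot_sub hφ hφc (hw n ω t) (hw n ω s)]
      exact enorm_sub_sq_le _ _
  -- Two bounds hold at once: one decays in n without regard to |t - s|, the other is Lipschitz in
  -- time but grows with n. Their minimum is interpolated by `exists_min_le_rpow`.
  refine (h4.min (h2 n s t hs ht)).mono ?_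
  refine le_trans ?_ (mul_le_mul_right (ENNReal.ofReal_le_ofReal (h3 n _ (abs_nonneg _))) _)
  rw [ENNReal.ofReal_min]
  rcases le_total (ENNReal.ofReal (((4 : ℝ) ^ (n : ℕ)) ^ (-ε)))
    (ENNReal.ofReal (16384 ^ (n : ℕ) * |(t : ℝ) - s|)) with h | h
  · rw [min_eq_left h]
    refine (min_le_left _ _).trans ?_
    rw [add_mul]
    refine le_trans (le_of_eq ?_) le_self_add
    ring
  · rw [min_eq_right h]
    refine (min_le_right _ _).trans ?_
    rw [add_mul]
    exact le_add_self

/-- The exponent θ is fixed before the moments k and m. Raising m therefore multiplies the gain in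
|t - s| and in 2^(-n), which is what chaining requires. -/
theorem exists_lintegral_lintegral_fieldPot_sub_pow_le (hd : 1 ≤ d)
    (hH : ∀ j, H j ∈ Set.Ioo (0 : ℝ) 1) (hup : 2 * H 0 + ∑ i : Fin d, H i.succ ≤ (d : ℝ) + 1)
    {α : ℝ} (hα : (d : ℝ) + 1 - (2 * H 0 + ∑ i : Fin d, H i.succ) < α) (hα' : α < 1 / 4)
    (hΨ : IsLinearSolution H P Ψ) (hm : ∀ n t, Measurable (Function.uncurry (Ψ n t)))
    (hc : ∀ n ω, Continuous fun z : ℝ≥0 × EuclideanSpace ℝ (Fin d) => Ψ n z.1 z.2 ω)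
    (T : ℝ≥0) (hφ : Continuous φ) (hφc : HasCompactSupport φ) :
    ∃ θ : ℝ, 0 < θ ∧ ∀ k m : ℕ, k ≠ 0 → m ≠ 0 → ∃ C : ℝ≥0∞, C ≠ ⊤ ∧
      ∀ (n : ℕ+) (s t : ℝ≥0), s ≤ T → t ≤ T →
      ∫⁻ ω, (∫⁻ x, ‖fieldPot (besselMeasure _ α) φ (wickIncr P Ψ n t) x ω -
        fieldPot (besselMeasure _ α) φ (wickIncr P Ψ n s) x ω‖ₑ ^ (2 * k)) ^ m ∂P ≤
        C * ENNReal.ofReal (((2 : ℝ) ^ (n : ℕ)) ^ (-θ) * |(t : ℝ) - s| ^ θ) ^ (k * m) := by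
  have hα0 : 0 < α := by linarith
  have hJ := isProbabilityMeasure_besselMeasure (E := EuclideanSpace ℝ (Fin d)) hα0
  obtain ⟨A₁, hA₁⟩ := hφ.bounded_above_of_compact_support hφc
  have hφA : ∀ x, ‖φ x‖ₑ ≤ ENNReal.ofReal A₁ := fun x => by
    rw [← ofReal_norm]
    exact ENNReal.ofReal_le_ofReal (hA₁ x)
  obtain ⟨θ, hθ, C, hC, h⟩ :=
    exists_uniformMeanBound_fieldPot_sub hd hH hup hα hα' hΨ hm hc T hφ hφc
  obtain ⟨C₃, -, hD⟩ := exists_lintegral_wickSquare_sub_le hd hH hup hα hα' hΨ T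
  refine ⟨θ, hθ, fun k m hk hm0 => ⟨gaussianMoment (k * m) ^ 2 * 2 ^ (k * m) * C ^ (k * m), ?_,
    fun n s t hs ht => ?_⟩⟩
  · have := (gaussianMoment_lt_top (k * m)).ne
    finiteness
  have hw : ∀ n ω (t : ℝ≥0), Continuous fun x => wickIncr P Ψ n t x ω := fun n ω t =>
    ((continuous_wickSquare hd hH hup hα hα' hΨ (hc (n + 1) ω)).comp (Continuous.prodMk_right t)).sub
      ((continuous_wickSquare hd hH hup hα hα' hΨ (hc n ω)).comp (Continuous.prodMk_right t))
  simp_rw [← fieldPot_sub hφ hφc (hw n _ t) (hw n _ s)]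
  set D : EuclideanSpace ℝ (Fin d) → Ω → ℝ :=
    fun y ω => wickIncr P Ψ n t y ω - wickIncr P Ψ n s y ω with hDdef
  have hDm : Measurable (Function.uncurry D) :=
    (measurable_wickIncr hm n t).sub (measurable_wickIncr hm n s)
  have hX := measurable_fieldPot (J := besselMeasure _ α) hφ.measurable hDm
  rw [mul_assoc (gaussianMoment (k * m) ^ 2 * 2 ^ (k * m)), ← mul_pow]
  have hB := h n s t hs ht
  refine lintegral_lintegral_pow_le_of_hypercontractive hX hk hm0 (fun x => ?_) hB
  have hXx : Measurable (fieldPot (besselMeasure _ α) φ D x) := hX.comp measurable_prodMk_left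
  refine lintegral_pow_le_of_orthogonal_norm_sq hΨ.gaussian
    (fun i => hΨ.centered i.1 i.2.1 i.2.2) (memLp_of_lintegral_sq_lt_top hXx
      ((hB.1 x).trans_lt (by finiteness))) (fun Y hY hY0 => ?_) (mul_ne_zero hk hm0)
  -- A qualitative bound, used only to justify Fubini; its growth with n plays no role.
  have hM : ∃ M : ℝ≥0∞, M ≠ ⊤ ∧ ∀ y, ∫⁻ ω, ‖D y ω‖ₑ ^ 2 ∂P ≤ M := by
    refine ⟨2 * ENNReal.ofReal (C₃ * 16384 ^ ((n + 1 : ℕ+) : ℕ) * |(t : ℝ) - s|) +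
      2 * ENNReal.ofReal (C₃ * 16384 ^ (n : ℕ) * |(t : ℝ) - s|), by finiteness, fun y => ?_⟩
    refine le_trans ?_ (add_le_add (mul_le_mul_right (hD (n + 1) s t y hs ht) _)
      (mul_le_mul_right (hD n s t y hs ht) _))
    have hmy : ∀ n t, Measurable (wickSquare P Ψ n t y) := fun n t =>
      (measurable_wickSquare hm n t).comp measurable_prodMk_left
    have h1 := hmy (n + 1) t
    have h2 := hmy (n + 1) s
    rw [← lintegral_const_mul' _ _ (by simp), ← lintegral_const_mul' _ _ (by simp),
      ← lintegral_add_left (by fun_prop)]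
    refine lintegral_mono fun ω => le_trans (le_of_eq ?_) (enorm_sub_sq_le _ _)
    congr 2
    simp only [hDdef, wickIncr]
    ring
  obtain ⟨M, hM, hDM⟩ := hM
  exact integral_fieldPot_mul_eq_zero hφ.measurable hDm ENNReal.ofReal_ne_top hM hφA hDM hY
    (fun y => integral_wickIncr_mul_eq_zero hΨ hY hY0 n s t y) x

end

end

/-! ### Dyadic chaining in time. -/

theorem eLpNorm_natCast_pow {X F : Type*} [MeasurableSpace X] [NormedAddCommGroup F]
    (f : X → F) (μ : Measure X) {j : ℕ} (hj : j ≠ 0) :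
    eLpNorm f j μ ^ j = ∫⁻ x, ‖f x‖ₑ ^ j ∂μ := by
  have := eLpNorm_nnreal_pow_eq_lintegral (μ := μ) (f := f) (p := (j : ℝ≥0)) (by exact_mod_cast hj)
  simpa using this

/-- Chaining along dyadic times. -/
theorem eLpNorm_le_tsum_of_dyadic {X : Type*} [MeasurableSpace X] {μ : Measure X} {q : ℝ≥0∞}
    (hq : 1 ≤ q) {F : ℝ≥0 → X → ℝ} (hF : ∀ t, AEStronglyMeasurable (F t) μ)
    (hFc : ∀ x, Continuous fun t => F t x) (h0 : F 0 =ᵐ[μ] 0) {T : ℝ≥0} {b : ℕ → ℝ≥0∞}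
    (h : ∀ l, ∀ i < 2 ^ l, eLpNorm (F (T * (i + 1 : ℕ) / 2 ^ l) - F (T * i / 2 ^ l)) q μ ≤ b l)
    {t : ℝ≥0} (ht : t ≤ T) : eLpNorm (F t) q μ ≤ ∑' l, b l := by
  -- Induction on the level: an even point belongs to the previous level, and an odd one is a single
  -- step away from its left neighbour, which does.
  have step : ∀ l : ℕ, ∀ i : ℕ, i ≤ 2 ^ l → eLpNorm (F (T * i / 2 ^ l)) q μ ≤ ∑ j ∈ Finset.range (l + 1), b j := by
    have hz : eLpNorm (F 0) q μ = 0 := by rw [eLpNorm_congr_ae h0, eLpNorm_zero]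
    have add : ∀ s s' : ℝ≥0, eLpNorm (F s') q μ ≤
        eLpNorm (F s) q μ + eLpNorm (F s' - F s) q μ := fun s s' => by
      have := eLpNorm_add_le (hF s) ((hF s').sub (hF s)) hq
      rwa [add_sub_cancel] at this
    intro l
    induction l with
    | zero =>
      intro i hi
      have : i = 0 ∨ i = 1 := by rw [pow_zero] at hi; omega
      rcases this with rfl | rfl
      · simp [hz]
      · refine (add (T * (0 : ℕ) / 2 ^ 0) _).trans ?_
        have h1 := h 0 0 (by norm_num)
        simp only [Nat.cast_zero, Nat.cast_one, mul_zero, zero_div, zero_add, Finset.sum_range_one,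
          hz] at h1 ⊢
        exact h1
    | succ l ih =>
      intro i hi
      rw [Finset.sum_range_succ]
      have half : ∀ j : ℕ, T * ((2 * j : ℕ) : ℝ≥0) / 2 ^ (l + 1) = T * j / 2 ^ l := fun j => by
        push_cast
        rw [pow_succ, mul_left_comm, mul_comm (2 ^ l) 2, mul_div_mul_left _ _ two_ne_zero]
      rcases Nat.even_or_odd' i with ⟨j, rfl | rfl⟩
      · rw [half]
        exact (ih j (by rw [pow_succ] at hi; omega)).trans le_self_add
      · refine (add (T * (2 * j : ℕ) / 2 ^ (l + 1)) _).trans ?_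
        refine add_le_add ?_ (h (l + 1) (2 * j) (by omega))
        rw [half]
        exact ih j (by rw [pow_succ] at hi; omega)
  rcases eq_or_ne T 0 with rfl | hT
  · have := step 0 0 (by norm_num)
    rw [show t = 0 from le_antisymm ht zero_le]
    simp only [Nat.cast_zero, mul_zero, zero_div] at this
    exact this.trans (ENNReal.sum_le_tsum _)
  have hT0 : 0 < T := pos_iff_ne_zero.mpr hT
  -- Dyadic approximations of t from below. Fatou's lemma passes to the limit, so continuity in t is
  -- needed only pointwise in x, not in L^q.
  set i : ℕ → ℕ := fun l => ⌊((t : ℝ) / T) * 2 ^ l⌋₊ with hi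
  have hi2 : ∀ l, i l ≤ 2 ^ l := fun l => by
    refine Nat.floor_le_of_le ?_
    push_cast
    exact mul_le_of_le_one_left (by positivity) (div_le_one_of_le₀ (by exact_mod_cast ht) T.2)
  have hlim : Tendsto (fun l => T * i l / 2 ^ l) atTop (𝓝 t) := by
    have h2 : Tendsto (fun l : ℕ => (2 : ℝ) ^ l) atTop atTop :=
      tendsto_pow_atTop_atTop_of_one_lt (by norm_num)
    have h1 := ((tendsto_nat_floor_mul_div_atTop (R := ℝ) (a := (t : ℝ) / T)
      (by positivity)).comp h2).const_mul (T : ℝ)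
    rw [mul_div_cancel₀ _ (by exact_mod_cast hT)] at h1
    rw [← NNReal.tendsto_coe]
    refine h1.congr fun l => ?_
    simp only [Function.comp_apply, hi]
    push_cast
    rw [mul_div_assoc]
  refine (Lp.eLpNorm_lim_le_liminf_eLpNorm (fun l => hF (T * i l / 2 ^ l)) _
    (ae_of_all _ fun x => ((hFc x).tendsto t).comp hlim)).trans ?_
  refine liminf_le_of_le (by isBoundedDefault) fun c hc => ?_
  obtain ⟨l, hl⟩ := hc.exists
  exact hl.trans ((step l _ (hi2 l)).trans (ENNReal.sum_le_tsum _))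

/-- Kolmogorov's argument for all n at once: the increments over dyadic intervals, renormalized by
ρ^(-(n + l)), have a sum of high powers with finite expectation. Its almost sure finiteness bounds
each increment by a multiple of ρ^(n + l), and chaining sums over l, starting from time 0 where the
field vanishes. -/
theorem ae_exists_eLpNorm_le_of_moments {E Ω : Type*} [MeasureSpace E]
    [SigmaFinite (volume : Measure E)]
    [MeasurableSpace Ω] {P : Measure Ω} [IsProbabilityMeasure P] {X : ℕ+ → ℝ≥0 → E → Ω → ℝ}
    (hX : ∀ n t, Measurable (Function.uncurry (X n t)))
    (hXc : ∀ n x ω, Continuous fun t => X n t x ω)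
    (h0 : ∀ n, ∀ᵐ ω ∂P, ∀ᵐ x, X n 0 x ω = 0) (T : ℝ≥0) {θ : ℝ} (hθ : 0 < θ) {k : ℕ} (hk : k ≠ 0)
    (h : ∀ m : ℕ, m ≠ 0 → ∃ C : ℝ≥0∞, C ≠ ⊤ ∧ ∀ (n : ℕ+) (s t : ℝ≥0), s ≤ T → t ≤ T →
      ∫⁻ ω, (∫⁻ x, ‖X n t x ω - X n s x ω‖ₑ ^ (2 * k)) ^ m ∂P ≤
        C * ENNReal.ofReal (((2 : ℝ) ^ (n : ℕ)) ^ (-θ) * |(t : ℝ) - s| ^ θ) ^ (k * m)) :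
    ∀ᵐ ω ∂P, ∃ M : ℝ≥0∞, M ≠ ⊤ ∧ ∀ n, ∀ t ≤ T,
      eLpNorm (fun x => X n t x ω) (2 * k : ℕ) volume ≤
        M * ENNReal.ofReal ((2 : ℝ) ^ (-(θ / 4))) ^ (n : ℕ) := by
  set r : ℝ := (2 : ℝ) ^ (-(θ / 4)) with hr
  have hr0 : 0 < r := by positivity
  have hr1 : r < 1 := Real.rpow_lt_one_of_one_lt_of_neg (by norm_num) (by linarith)
  set ρ : ℝ≥0∞ := ENNReal.ofReal r with hρ
  have hρ0 : ρ ≠ 0 := by simpa [hρ] using hr0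
  have hρt : ρ ≠ ⊤ := ENNReal.ofReal_ne_top
  have hρ1 : ρ < 1 := by simpa [hρ] using hr1
  -- The moment is taken so large that the gain per level is at least 1/4, which beats the 2^l
  -- intervals of level l.
  obtain ⟨m₀, hm₀⟩ := ((ENNReal.tendsto_pow_atTop_nhds_zero_of_lt_one hρ1).eventually_lt_const
    (show (0 : ℝ≥0∞) < 1 / 4 by simp)).exists
  obtain ⟨C, hC, hmom⟩ := h (m₀ + 1) (Nat.succ_ne_zero _)
  set m := m₀ + 1 with hm
  have hsmall : ρ ^ (2 * (k * m)) ≤ 1 / 4 := by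
    refine le_trans (pow_le_pow_right_of_le_one' hρ1.le ?_) hm₀.le
    have : 1 ≤ k := Nat.one_le_iff_ne_zero.mpr hk
    nlinarith
  set inc : ℕ+ → ℕ → ℕ → Ω → ℝ≥0∞ := fun n l i ω =>
    ∫⁻ x, ‖X n (T * (i + 1 : ℕ) / 2 ^ l) x ω - X n (T * i / 2 ^ l) x ω‖ₑ ^ (2 * k) with hinc
  have hincm : ∀ n l i, Measurable (inc n l i) := fun n l i => by
    have h1 : Measurable (Function.uncurry fun (ω : Ω) (x : E) =>
        X n (T * (i + 1 : ℕ) / 2 ^ l) x ω - X n (T * i / 2 ^ l) x ω) :=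
      ((hX n (T * (i + 1 : ℕ) / 2 ^ l)).sub (hX n (T * i / 2 ^ l))).comp measurable_swap
    exact (h1.enorm.pow_const _).lintegral_prod_right'
  set S : Ω → ℝ≥0∞ := fun ω => ∑' n : ℕ+, ∑' l : ℕ, ∑ i ∈ Finset.range (2 ^ l),
    (ρ⁻¹ ^ ((n + l) * (2 * k)) * inc n l i ω) ^ m with hS
  have hSm : ∀ n l i, Measurable fun ω => (ρ⁻¹ ^ (((n : ℕ+) + l : ℕ) * (2 * k)) * inc n l i ω) ^ m :=
    fun n l i => ((hincm n l i).const_mul _).pow_const _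
  set C' : ℝ≥0∞ := C * ENNReal.ofReal ((T : ℝ) ^ θ) ^ (k * m) with hC'
  have hterm : ∀ (n : ℕ+) (l i : ℕ), i < 2 ^ l →
      ∫⁻ ω, (ρ⁻¹ ^ ((n + l) * (2 * k)) * inc n l i ω) ^ m ∂P ≤ C' * (1 / 4) ^ (n + l : ℕ) := by
    intro n l i hi
    have hle : ∀ j : ℕ, j ≤ 2 ^ l → T * j / 2 ^ l ≤ T := fun j hj => by
      rw [div_le_iff₀ (by positivity)]
      exact mul_le_mul_right (by exact_mod_cast hj) _
    have h1 := hmom n (T * i / 2 ^ l) (T * (i + 1 : ℕ) / 2 ^ l) (hle _ hi.le) (hle _ hi)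
    have e1 : ((2 : ℝ) ^ (n : ℕ)) ^ (-θ) *
        |((T * (i + 1 : ℕ) / 2 ^ l : ℝ≥0) : ℝ) - (T * i / 2 ^ l : ℝ≥0)| ^ θ =
        (T : ℝ) ^ θ * r ^ (4 * (n + l)) := by
      have e2 : |((T * (i + 1 : ℕ) / 2 ^ l : ℝ≥0) : ℝ) - (T * i / 2 ^ l : ℝ≥0)| =
          (T : ℝ) * ((2 : ℝ) ^ (l : ℝ))⁻¹ := by
        push_cast
        rw [Real.rpow_natCast, ← sub_div, ← mul_sub, add_sub_cancel_left, mul_one, div_eq_mul_inv,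
          abs_of_nonneg (by positivity)]
      rw [e2, Real.mul_rpow (NNReal.coe_nonneg T) (by positivity), ← Real.rpow_natCast 2 (n : ℕ),
        ← Real.rpow_natCast r, hr,
        ← Real.rpow_mul (by norm_num), ← Real.rpow_neg (by norm_num), ← Real.rpow_mul (by norm_num),
        ← Real.rpow_mul (by norm_num), mul_left_comm, ← Real.rpow_add (by norm_num)]
      congr 2
      push_cast
      ring
    rw [e1, ENNReal.ofReal_mul (by positivity), ENNReal.ofReal_pow hr0.le, mul_pow, ← mul_assoc] at h1
    simp_rw [mul_pow]
    rw [lintegral_const_mul _ ((hincm n l i).pow_const _)]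
    refine (mul_le_mul_right h1 _).trans ?_
    rw [mul_left_comm]
    refine mul_le_mul_right ?_ _
    -- The available decay is split into two equal halves: one cancels the renormalization, the
    -- other is at most (1/4)^(n + l).
    have e3 : (ρ ^ (4 * (n + l))) ^ (k * m) =
        ρ ^ ((n + l) * (2 * k) * m) * (ρ ^ (2 * (k * m))) ^ (n + l : ℕ) := by
      rw [← pow_mul, ← pow_mul, ← pow_add]
      congr 1
      ring
    rw [e3, ← pow_mul, ← ENNReal.inv_pow, ← mul_assoc, ENNReal.inv_mul_cancel (pow_ne_zero _ hρ0)
      (ENNReal.pow_ne_top hρt), one_mul]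
    exact pow_le_pow_left₀ zero_le hsmall _
  have hSint : ∫⁻ ω, S ω ∂P ≠ ⊤ := by
    have e : ∫⁻ ω, S ω ∂P = ∑' n : ℕ+, ∑' l : ℕ, ∑ i ∈ Finset.range (2 ^ l),
        ∫⁻ ω, (ρ⁻¹ ^ ((n + l) * (2 * k)) * inc n l i ω) ^ m ∂P := by
      simp only [hS]
      rw [lintegral_tsum fun n => (Measurable.tsum fun l =>
        Finset.measurable_sum _ fun i _ => hSm n l i).aemeasurable]
      refine tsum_congr fun n => ?_
      rw [lintegral_tsum fun l => (Finset.measurable_sum _ fun i _ => hSm n l i).aemeasurable]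
      refine tsum_congr fun l => ?_
      rw [lintegral_finsetSum _ fun i _ => hSm n l i]
    have hle : ∫⁻ ω, S ω ∂P ≤ ∑' n : ℕ, ∑' l : ℕ, C' * ((1 / 4) ^ n * (1 / 2) ^ l) := by
      rw [e]
      refine le_trans (ENNReal.tsum_le_tsum fun n => ENNReal.tsum_le_tsum fun l => ?_)
        (ENNReal.tsum_comp_le_tsum_of_injective PNat.coe_injective
          fun n : ℕ => ∑' l : ℕ, C' * ((1 / 4) ^ n * (1 / 2) ^ l))
      calc _ ≤ ∑ i ∈ Finset.range (2 ^ l), C' * (1 / 4) ^ (n + l : ℕ) :=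
            Finset.sum_le_sum fun i hi => hterm n l i (Finset.mem_range.mp hi)
        _ = C' * ((1 / 4) ^ (n : ℕ) * (2 * (1 / 4)) ^ l) := by
            rw [Finset.sum_const, Finset.card_range, nsmul_eq_mul, mul_pow, pow_add]
            push_cast
            ring
        _ = _ := by
            congr 3
            rw [show (4 : ℝ≥0∞) = 2 * 2 by norm_num, one_div, ENNReal.mul_inv (by simp) (by simp),
              ← mul_assoc, ENNReal.mul_inv_cancel (by simp) (by simp), one_mul, one_div]
    refine ne_top_of_le_ne_top ?_ hle
    simp_rw [ENNReal.tsum_mul_left, ENNReal.tsum_mul_right, ENNReal.tsum_geometric]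
    have hCt : C' ≠ ⊤ := by finiteness
    have h2 : (1 - 1 / 4 : ℝ≥0∞) ≠ 0 := by
      rw [Ne, tsub_eq_zero_iff_le, not_le]
      exact (ENNReal.div_lt_iff (by simp) (by simp)).mpr (by norm_num)
    have h3 : (1 - 1 / 2 : ℝ≥0∞) ≠ 0 := by
      rw [Ne, tsub_eq_zero_iff_le, not_le]
      exact (ENNReal.div_lt_iff (by simp) (by simp)).mpr (by norm_num)
    exact ENNReal.mul_ne_top hCt (ENNReal.mul_ne_top (ENNReal.inv_ne_top.mpr h2)
      (ENNReal.inv_ne_top.mpr h3))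
  have hSmeas : Measurable S := Measurable.tsum fun n => Measurable.tsum fun l =>
    Finset.measurable_sum _ fun i _ => hSm n l i
  filter_upwards [ae_lt_top hSmeas hSint, ae_all_iff.mpr h0] with ω hω hω0
  have hgeo : ∑' l : ℕ, ρ ^ l ≠ ⊤ := by
    rw [ENNReal.tsum_geometric]
    refine ENNReal.inv_ne_top.mpr ?_
    rw [Ne, tsub_eq_zero_iff_le, not_le]
    exact hρ1
  -- Using 1 + S rather than S makes the random constant at least 1, so that it may be bounded by
  -- its own powers when roots are taken.
  refine ⟨(1 + S ω) * ∑' l : ℕ, ρ ^ l, ENNReal.mul_ne_top (by finiteness) hgeo, fun n t ht => ?_⟩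
  have hb := eLpNorm_le_tsum_of_dyadic (μ := (volume : Measure E)) (q := (2 * k : ℕ))
    (F := fun t x => X n t x ω) (T := T) (b := fun l => (1 + S ω) * ρ ^ (n + l : ℕ))
    (by exact_mod_cast (by omega : 1 ≤ 2 * k))
    (fun t => ((hX n t).comp measurable_prodMk_right).aestronglyMeasurable) (fun x => hXc n x ω)
    (hω0 n) (fun l i hi => ?_) ht
  · refine hb.trans (le_of_eq ?_)
    rw [ENNReal.tsum_mul_left]
    simp_rw [pow_add]
    rw [ENNReal.tsum_mul_left]
    ring
  · have hk2 : 2 * k ≠ 0 := by omega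
    have hm0 : m ≠ 0 := Nat.succ_ne_zero _
    have h1 : (ρ⁻¹ ^ ((n + l) * (2 * k)) * inc n l i ω) ^ m ≤ S ω := by
      refine le_trans ?_ (ENNReal.le_tsum n)
      refine le_trans ?_ (ENNReal.le_tsum l)
      exact Finset.single_le_sum (f := fun i => (ρ⁻¹ ^ ((n + l) * (2 * k)) * inc n l i ω) ^ m)
        (fun _ _ => zero_le) (Finset.mem_range.mpr hi)
    have h1S : (1 : ℝ≥0∞) ≤ 1 + S ω := le_self_add
    have h2 : ρ⁻¹ ^ ((n + l) * (2 * k)) * inc n l i ω ≤ 1 + S ω := by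
      refine (ENNReal.pow_le_pow_left_iff hm0).mp (h1.trans
        ((le_add_self (a := S ω) (b := 1)).trans (le_self_pow₀ h1S hm0)))
    refine (ENNReal.pow_le_pow_left_iff hk2).mp ?_
    rw [eLpNorm_natCast_pow _ _ hk2, mul_pow, ← pow_mul]
    rw [← ENNReal.inv_pow, mul_comm, ← div_eq_mul_inv,
      ENNReal.div_le_iff (pow_ne_zero _ hρ0) (ENNReal.pow_ne_top hρt)] at h2
    refine le_trans h2 (mul_le_mul_left (le_self_pow₀ h1S hk2) _)

/-! ### Almost sure decay of the smoothed Wick increments. -/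

section

theorem continuous_fieldPot {E : Type*} [NormedAddCommGroup E] [InnerProductSpace ℝ E]
    [FiniteDimensional ℝ E] [MeasurableSpace E] [BorelSpace E] {Ω : Type*} {J : Measure E}
    [IsProbabilityMeasure J] {φ : E → ℝ} (hφ : Continuous φ) (hφc : HasCompactSupport φ)
    {D : ℝ≥0 → E → Ω → ℝ} {ω : Ω} (hD : Continuous fun z : ℝ≥0 × E => D z.1 z.2 ω) (x : E) :
    Continuous fun t => fieldPot J φ (D t) x ω := by
  have hs : IsCompact ((fun u => x + u) ⁻¹' tsupport φ) :=
    (Homeomorph.addLeft x).isCompact_preimage.mpr hφc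
  have hf : Continuous (Function.uncurry fun (t : ℝ≥0) u => φ (x + u) * D t (x + u) ω) := by
    have h1 : Continuous fun z : ℝ≥0 × E => D z.1 (x + z.2) ω :=
      hD.comp (by fun_prop : Continuous fun z : ℝ≥0 × E => (z.1, x + z.2))
    have h2 : Continuous fun z : ℝ≥0 × E => φ (x + z.2) := by fun_prop
    exact h2.mul h1
  have h := continuous_parametric_integral_of_continuous (μ := J) hf hs
  refine h.congr fun t => setIntegral_eq_integral_of_forall_compl_eq_zero fun u hu => ?_
  rw [image_eq_zero_of_notMem_tsupport hu, zero_mul]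

variable {d : ℕ} {H : Fin (d + 1) → ℝ} {Ω : Type*} [MeasurableSpace Ω] {P : Measure Ω}
  {Ψ : ℕ+ → ℝ≥0 → EuclideanSpace ℝ (Fin d) → Ω → ℂ}

/-- As γ₀ = 0, the Wick squares vanish at time 0 in mean square, which is the starting point of the
chaining. -/
theorem wickCov_zero (n : ℕ+) (v : EuclideanSpace ℝ (Fin d)) : wickCov H n 0 0 v = 0 := by
  have h : ∀ b, covDensity H b 0 0 = 0 := fun b => by
    funext z
    simp [covDensity, gammaFun]
  simp [wickCov, h, waveKernel]

theorem ae_ae_eq_zero_of_lintegral_sq {E : Type*} [MeasureSpace E]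
    [SigmaFinite (volume : Measure E)]
    [SFinite P] {X : E → Ω → ℝ} (hX : Measurable (Function.uncurry X))
    (h0 : ∀ x, ∫⁻ ω, ‖X x ω‖ₑ ^ 2 ∂P = 0) : ∀ᵐ ω ∂P, ∀ᵐ x, X x ω = 0 := by
  have hXs : Measurable (Function.uncurry fun ω x => ‖X x ω‖ₑ ^ 2) :=
    (hX.comp measurable_swap).enorm.pow_const 2
  have h1 : ∫⁻ ω, (∫⁻ x, ‖X x ω‖ₑ ^ 2) ∂P = 0 := by
    rw [lintegral_lintegral_swap hXs.aemeasurable]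
    simp [h0]
  have hXi : Measurable fun ω => ∫⁻ x, ‖X x ω‖ₑ ^ 2 := hXs.lintegral_prod_right'
  rw [lintegral_eq_zero_iff hXi] at h1
  filter_upwards [h1] with ω hω
  have h2 : Measurable fun x => ‖X x ω‖ₑ ^ 2 := hXs.comp measurable_prodMk_left
  simp only [Pi.zero_apply] at hω
  rw [lintegral_eq_zero_iff h2] at hω
  filter_upwards [hω] with x hx
  simpa using hx

variable [IsProbabilityMeasure P] {φ : EuclideanSpace ℝ (Fin d) → ℝ}

theorem ae_fieldPot_wickIncr_zero {α : ℝ} (hα : 0 < α) (hΨ : IsLinearSolution H P Ψ)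
    (hm : ∀ n t, Measurable (Function.uncurry (Ψ n t))) (hφ : Measurable φ) (n : ℕ+) :
    ∀ᵐ ω ∂P, ∀ᵐ x, fieldPot (besselMeasure _ α) φ (wickIncr P Ψ n 0) x ω = 0 := by
  have hJ := isProbabilityMeasure_besselMeasure (E := EuclideanSpace ℝ (Fin d)) hα
  have hD := measurable_wickIncr (P := P) hm n 0
  refine ae_ae_eq_zero_of_lintegral_sq (measurable_fieldPot (J := besselMeasure _ α) hφ hD)
    fun x => ?_
  refine le_antisymm ((lintegral_fieldPot_sq_le hφ hD x).trans (le_of_eq ?_)) zero_le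
  simp_rw [lintegral_wickIncr_sq_eq hΨ, NNReal.coe_zero, wickCov_zero]
  simp

theorem ae_exists_eLpNorm_fieldPot_le (hd : 1 ≤ d)
    (hH : ∀ j, H j ∈ Set.Ioo (0 : ℝ) 1) (hup : 2 * H 0 + ∑ i : Fin d, H i.succ ≤ (d : ℝ) + 1)
    {α : ℝ} (hα : (d : ℝ) + 1 - (2 * H 0 + ∑ i : Fin d, H i.succ) < α) (hα' : α < 1 / 4)
    (hΨ : IsLinearSolution H P Ψ) (hm : ∀ n t, Measurable (Function.uncurry (Ψ n t)))
    (hc : ∀ n ω, Continuous fun z : ℝ≥0 × EuclideanSpace ℝ (Fin d) => Ψ n z.1 z.2 ω)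
    (T : ℝ≥0) (hφ : Continuous φ) (hφc : HasCompactSupport φ) {k : ℕ} (hk : k ≠ 0) :
    ∀ᵐ ω ∂P, ∃ M r : ℝ≥0∞, M ≠ ⊤ ∧ r < 1 ∧ ∀ n, ∀ t ≤ T,
      eLpNorm (fun x => fieldPot (besselMeasure _ α) φ (wickIncr P Ψ n t) x ω) (2 * k : ℕ) volume ≤
        M * r ^ (n : ℕ) := by
  have hα0 : 0 < α := by linarith
  have hJ := isProbabilityMeasure_besselMeasure (E := EuclideanSpace ℝ (Fin d)) hα0
  obtain ⟨θ, hθ, h⟩ :=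
    exists_lintegral_lintegral_fieldPot_sub_pow_le hd hH hup hα hα' hΨ hm hc T hφ hφc
  have hw : ∀ n ω, Continuous fun z : ℝ≥0 × EuclideanSpace ℝ (Fin d) =>
      wickIncr P Ψ n z.1 z.2 ω := fun n ω =>
    (continuous_wickSquare hd hH hup hα hα' hΨ (hc (n + 1) ω)).sub
      (continuous_wickSquare hd hH hup hα hα' hΨ (hc n ω))
  have := ae_exists_eLpNorm_le_of_moments (P := P)
    (X := fun n t => fieldPot (besselMeasure _ α) φ (wickIncr P Ψ n t))
    (fun n t => measurable_fieldPot hφ.measurable (measurable_wickIncr hm n t))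
    (fun n x ω => continuous_fieldPot hφ hφc (hw n ω) x)
    (ae_fieldPot_wickIncr_zero hα0 hΨ hm hφ.measurable) T hθ hk (fun m hm0 => h k m hk hm0)
  filter_upwards [this] with ω hω
  obtain ⟨M, hM, h1⟩ := hω
  refine ⟨M, _, hM, ?_, h1⟩
  rw [ENNReal.ofReal_lt_one]
  exact Real.rpow_lt_one_of_one_lt_of_neg (by norm_num) (by linarith)

end

/-! ### A jointly measurable, everywhere continuous version. -/

section

variable {d : ℕ} {H : Fin (d + 1) → ℝ} {Ω : Type*} [MeasurableSpace Ω] {P : Measure Ω}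
  {Ψ Φ : ℕ+ → ℝ≥0 → EuclideanSpace ℝ (Fin d) → Ω → ℂ}

theorem IsLinearSolution.congr (hΨ : IsLinearSolution H P Ψ)
    (h : ∀ n t x, Ψ n t x =ᵐ[P] Φ n t x) : IsLinearSolution H P Φ where
  gaussian := hΨ.gaussian.congr fun i => h i.1 i.2.1 i.2.2
  centered n t x := by rw [← hΨ.centered n t x, integral_congr_ae (h n t x)]
  covariance n m s t x y := by
    rw [← hΨ.covariance n m s t x y]
    refine integral_congr_ae ?_
    filter_upwards [h n s x, h m t y] with ω h1 h2
    rw [h1, h2]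
  pseudoCovariance n m s t x y := by
    rw [← hΨ.pseudoCovariance n m s t x y]
    refine integral_congr_ae ?_
    filter_upwards [h n s x, h m t y] with ω h1 h2
    rw [h1, h2]

/-- A linear solution has a version that is measurable and everywhere continuous. -/
theorem IsLinearSolution.exists_continuous_version (hΨ : IsLinearSolution H P Ψ)
    (hcont : ∀ n, ∀ᵐ ω ∂P, Continuous
      (fun z : ℝ≥0 × EuclideanSpace ℝ (Fin d) => Ψ n z.1 z.2 ω)) :
    ∃ Φ : ℕ+ → ℝ≥0 → EuclideanSpace ℝ (Fin d) → Ω → ℂ, IsLinearSolution H P Φ ∧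
      (∀ n ω, Continuous fun z : ℝ≥0 × EuclideanSpace ℝ (Fin d) => Φ n z.1 z.2 ω) ∧
      (∀ n t, Measurable (Function.uncurry (Φ n t))) ∧
      ∀ᵐ ω ∂P, ∀ n t x, wickSquare P Φ n t x ω = wickSquare P Ψ n t x ω := by
  classical
  -- Marginals are only almost everywhere measurable. They are corrected on a countable dense set,
  -- off which a single null set is discarded; continuity then carries measurability to all points.
  set q := TopologicalSpace.denseSeq (ℝ≥0 × EuclideanSpace ℝ (Fin d))
  have hD : DenseRange q := TopologicalSpace.denseRange_denseSeq _
  have hae : ∀ n (z : ℝ≥0 × EuclideanSpace ℝ (Fin d)), AEMeasurable (Ψ n z.1 z.2) P :=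
    fun n z => hΨ.gaussian.aemeasurable (n, z.1, z.2)
  have hgood : ∀ᵐ ω ∂P, ∀ n, (Continuous fun z : ℝ≥0 × EuclideanSpace ℝ (Fin d) => Ψ n z.1 z.2 ω) ∧
      ∀ j, Ψ n (q j).1 (q j).2 ω =
        (hae n (q j)).mk _ ω :=
    ae_all_iff.mpr fun n => (hcont n).and
      (ae_all_iff.mpr fun j => (hae n (q j)).ae_eq_mk)
  obtain ⟨A, hAP, hAm, hA⟩ := hgood.exists_measurable_mem
  set Φ : ℕ+ → ℝ≥0 → EuclideanSpace ℝ (Fin d) → Ω → ℂ :=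
    fun n t x ω => if ω ∈ A then Ψ n t x ω else 0 with hΦ
  have hAae : ∀ᵐ ω ∂P, ω ∈ A := hAP
  have hΦc : ∀ n ω, Continuous fun z : ℝ≥0 × EuclideanSpace ℝ (Fin d) => Φ n z.1 z.2 ω := by
    intro n ω
    by_cases h : ω ∈ A
    · simpa [hΦ, h] using (hA ω h n).1
    · simp only [hΦ, h, if_false]
      exact continuous_const
  have hΦm0 : ∀ n j, Measurable fun ω => Φ n (q j).1
      (q j).2 ω := fun n j => by
    have : (fun ω => Φ n (q j).1
        (q j).2 ω) =
        fun ω => if ω ∈ A then (hae n (q j)).mk _ ω else 0 := by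
      funext ω
      by_cases h : ω ∈ A
      · simp only [hΦ, h, if_true]
        exact (hA ω h n).2 j
      · simp [hΦ, h]
    rw [this]
    exact Measurable.ite hAm (hae n _).measurable_mk measurable_const
  have hΦm1 : ∀ n (z : ℝ≥0 × EuclideanSpace ℝ (Fin d)), Measurable fun ω => Φ n z.1 z.2 ω := by
    intro n z
    obtain ⟨u, hu, hlim⟩ := mem_closure_iff_seq_limit.mp (hD z)
    refine measurable_of_tendsto_metrizable (f := fun j ω => Φ n (u j).1 (u j).2 ω) (fun j => ?_) ?_
    · obtain ⟨i, hi⟩ := hu j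
      rw [← hi]
      exact hΦm0 n i
    · exact tendsto_pi_nhds.mpr fun ω => ((hΦc n ω).tendsto z).comp hlim
  have hΦΨ : ∀ n t x, Ψ n t x =ᵐ[P] Φ n t x := fun n t x => by
    filter_upwards [hAae] with ω hω
    simp [hΦ, hω]
  refine ⟨Φ, hΨ.congr hΦΨ, hΦc, fun n t => ?_, ?_⟩
  · exact measurable_uncurry_of_continuous_of_measurable
      (fun ω => (hΦc n ω).comp (Continuous.prodMk_right t)) fun x => hΦm1 n (t, x)
  · filter_upwards [hAae] with ω hω n t x
    unfold wickSquare
    congr 1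
    · simp [hΦ, hω]
    · refine integral_congr_ae ?_
      filter_upwards [hΦΨ n t x] with ω' h
      rw [h]

end

/-! ### Convergence in the Sobolev spaces. -/

section

theorem besselPot_ofReal {E : Type*} [NormedAddCommGroup E] [InnerProductSpace ℝ E]
    [FiniteDimensional ℝ E] [MeasurableSpace E] [BorelSpace E] (β : ℝ) (f : E → ℝ) (y : E) :
    besselPot β (fun x => (f x : ℂ)) y = ((besselPot β f y : ℝ) : ℂ) :=
  integral_complex_ofReal

theorem IsFunction.unique {d : ℕ} {u v : 𝓢'(EuclideanSpace ℝ (Fin d), ℂ)}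
    {f : EuclideanSpace ℝ (Fin d) → ℂ} (hu : IsFunction u f) (hv : IsFunction v f) : u = v := by
  ext φ
  exact (hu φ).2.trans (hv φ).2.symm

variable {d : ℕ}

/-- Bessel potentials improve integrability. -/
theorem exists_eLpNorm_besselPot_le {α β : ℝ} (hβ : 0 < β) (hαβ : β < α) {k : ℕ} (hk : k ≠ 0)
    (hdk : (d : ℝ) / (2 * (2 * k : ℕ)) < α - β) :
    ∃ C : ℝ≥0∞, C < ⊤ ∧ ∀ (g : EuclideanSpace ℝ (Fin d) → ℂ) (D : ℝ), Continuous g →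
      (∀ x, ‖g x‖ ≤ D) → ∀ p : ℝ≥0∞, 2 ≤ p → eLpNorm (besselPot α g) p volume ≤
        C * eLpNorm (besselPot β g) (2 * k : ℕ) volume + eLpNorm (besselPot β g) 2 volume := by
  have hk2 : 2 * k ≠ 0 := by omega
  obtain ⟨C, hC, h⟩ := exists_lintegral_besselMeasure_le (E := EuclideanSpace ℝ (Fin d)) hk2
    (β := α - β) (by simpa using hdk)
  refine ⟨C, hC, fun g D hg hD p hp => ?_⟩
  have hS := continuous_besselPot hβ hg hD
  -- The surplus smoothing of order α - β maps L^(2k) into L^∞ and contracts L²; interpolation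
  -- between the two covers every p.
  have e : besselPot α g = besselPot (α - β) (besselPot β g) := by
    rw [besselPot_besselPot (by linarith) hβ hg hD, sub_add_cancel]
  rw [e]
  refine eLpNorm_le_of_two_le (fun x => ?_) ?_ hp
  · refine le_trans ?_ le_self_add
    refine (enorm_besselPot_le _ x).trans ((h (fun y => ‖besselPot β g y‖ₑ)
      hS.measurable.enorm x).trans (le_of_eq ?_))
    rw [← eLpNorm_natCast_pow _ _ hk2, ← ENNReal.rpow_natCast, ← ENNReal.rpow_mul,
      mul_one_div_cancel (by exact_mod_cast hk2), ENNReal.rpow_one]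
  · refine (lintegral_enorm_besselPot_pow_le (by linarith) hS.measurable two_ne_zero).trans ?_
    rw [← eLpNorm_natCast_pow _ _ two_ne_zero]
    exact pow_le_pow_left₀ zero_le le_add_self 2

/-- A jointly continuous function supported over a fixed compact set is a continuous curve in C(K),
so time continuity is uniform in x and controls both the supremum and the L² norm. -/
theorem tendsto_eLpNorm_besselPot_sub {α : ℝ} (hα : 0 < α) {K : Set (EuclideanSpace ℝ (Fin d))}
    (hK : IsCompact K) {f : ℝ≥0 → EuclideanSpace ℝ (Fin d) → ℂ}
    (hf : Continuous (Function.uncurry f)) (hfK : ∀ t, ∀ x ∉ K, f t x = 0) (t₀ : ℝ≥0)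
    {p : ℝ≥0∞} (hp : 2 ≤ p) :
    Tendsto (fun t => eLpNorm (besselPot α fun x => f t x - f t₀ x) p volume) (𝓝 t₀) (𝓝 0) := by
  have : CompactSpace K := isCompact_iff_compactSpace.mp hK
  set F : C(ℝ≥0, C(K, ℂ)) := ContinuousMap.curry ⟨fun z : ℝ≥0 × K => f z.1 z.2,
    hf.comp (by fun_prop : Continuous fun z : ℝ≥0 × K => (z.1, (z.2 : EuclideanSpace ℝ (Fin d))))⟩
    with hF
  have hft : ∀ t, Continuous (f t) := fun t => hf.comp (Continuous.prodMk_right t)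
  have hlim : Tendsto (fun t => ENNReal.ofReal (dist (F t) (F t₀)) * (1 + volume K)) (𝓝 t₀) (𝓝 0) := by
    have h1 : Tendsto (fun t => dist (F t) (F t₀)) (𝓝 t₀) (𝓝 0) :=
      tendsto_iff_dist_tendsto_zero.mp (F.continuous.tendsto t₀)
    have h2 := ENNReal.Tendsto.mul_const (b := 1 + volume K) (ENNReal.tendsto_ofReal h1)
      (Or.inr (by have := hK.measure_lt_top (μ := volume); finiteness))
    simpa using h2
  refine tendsto_of_tendsto_of_tendsto_of_le_of_le tendsto_const_nhds hlim (fun _ => zero_le)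
    fun t => ?_
  set δ := dist (F t) (F t₀)
  have hb : ∀ x, ‖f t x - f t₀ x‖ ≤ δ := fun x => by
    by_cases hx : x ∈ K
    · have := ContinuousMap.dist_apply_le_dist (f := F t) (g := F t₀) ⟨x, hx⟩
      rwa [dist_eq_norm] at this
    · rw [hfK t x hx, hfK t₀ x hx, sub_zero, norm_zero]
      exact dist_nonneg
  have hbe : ∀ x, ‖f t x - f t₀ x‖ₑ ≤ ENNReal.ofReal δ := fun x => by
    rw [← ofReal_norm]
    exact ENNReal.ofReal_le_ofReal (hb x)
  have hsub : Continuous fun x => f t x - f t₀ x := (hft t).sub (hft t₀)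
  refine eLpNorm_le_of_two_le (fun x => ?_) ?_ hp
  · rw [← ofReal_norm]
    exact (ENNReal.ofReal_le_ofReal (norm_besselPot_le hα hb x)).trans
      (le_mul_of_one_le_right zero_le le_self_add)
  · refine (lintegral_enorm_besselPot_pow_le hα hsub.measurable two_ne_zero).trans ?_
    have hs : Function.support (fun x => ‖f t x - f t₀ x‖ₑ ^ 2) ⊆ K := by
      intro x hx
      by_contra hxK
      simp [hfK t x hxK, hfK t₀ x hxK] at hx
    rw [← setLIntegral_eq_of_support_subset hs]
    calc _ ≤ ∫⁻ _ in K, ENNReal.ofReal δ ^ 2 :=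
          lintegral_mono fun x => pow_le_pow_left₀ zero_le (hbe x) 2
      _ = ENNReal.ofReal δ ^ 2 * volume K := by simp
      _ ≤ _ := by
          rw [mul_pow]
          refine mul_le_mul_right (le_add_self.trans (le_self_pow₀ le_self_add two_ne_zero)) _

section Limit

variable {K : Set (EuclideanSpace ℝ (Fin d))} {f : ℕ+ → ℝ≥0 → EuclideanSpace ℝ (Fin d) → ℝ}
  {T : ℝ≥0}

/-- Consecutive terms are geometrically close, uniformly in time. The hypothesis is used for two
values of k: a large one, for the passage to L^∞, and k = 1, for the L² norm. -/
theorem exists_tendsto_sobolevSpace {α β : ℝ} (hβ : 0 < β) (hαβ : β < α) (hK : IsCompact K)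
    (hf : ∀ n, Continuous (Function.uncurry (f n))) (hfK : ∀ n t, ∀ x ∉ K, f n t x = 0)
    (h : ∀ k : ℕ, k ≠ 0 → ∃ M r : ℝ≥0∞, M ≠ ⊤ ∧ r < 1 ∧ ∀ n, ∀ t ≤ T,
      eLpNorm (besselPot β fun x => f (n + 1) t x - f n t x) (2 * k : ℕ) volume ≤ M * r ^ (n : ℕ))
    {p : ℝ≥0∞} [Fact (1 ≤ p)] (hp : 2 ≤ p) :
    ∃ (u : ℕ+ → C(Set.Icc (0 : ℝ≥0) T, SobolevSpace d (-2 * α) p))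
      (v : C(Set.Icc (0 : ℝ≥0) T, SobolevSpace d (-2 * α) p)),
      (∀ n t, IsFunction (u n t).toDistribution (fun x => (f n t x : ℂ))) ∧
      Tendsto u atTop (𝓝 v) := by
  have hα : 0 < α := hβ.trans hαβ
  have hft : ∀ n t, Continuous fun x => (f n t x : ℂ) := fun n t =>
    Complex.continuous_ofReal.comp ((hf n).comp (Continuous.prodMk_right t))
  have hfc : ∀ n t, HasCompactSupport fun x => (f n t x : ℂ) := fun n t =>
    HasCompactSupport.intro hK fun x hx => by simp [hfK n t x hx]
  choose w hw hwS using fun n t => exists_sobolevSpace_isFunction (p := p) hα (hft n t) (hfc n t) hp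
  choose B hB using fun n t => (hft n t).bounded_above_of_compact_support (hfc n t)
  have hdist : ∀ n m t s, dist (w n t) (w m s) =
      (eLpNorm (besselPot α fun x => (f n t x : ℂ) - (f m s x : ℂ)) p volume).toReal := fun n m t s => by
    rw [SobolevSpace.dist_eq_of_ae (hwS n t) (hwS m s)]
    congr 2
    funext x
    exact (besselPot_sub hα (hft n t) (hB n t) (hft m s) (hB m s) x).symm
  have hwc : ∀ n, Continuous (w n) := fun n => by
    refine continuous_iff_continuousAt.mpr fun t₀ => tendsto_iff_dist_tendsto_zero.mpr ?_
    simp_rw [hdist]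
    rw [← ENNReal.toReal_zero]
    refine (ENNReal.tendsto_toReal ENNReal.zero_ne_top).comp
      (tendsto_eLpNorm_besselPot_sub hα hK (f := fun t x => (f n t x : ℂ))
        (Complex.continuous_ofReal.comp (hf n)) (fun t x hx => by simp [hfK n t x hx]) t₀ hp)
  set u : ℕ+ → C(Set.Icc (0 : ℝ≥0) T, SobolevSpace d (-2 * α) p) := fun n =>
    ⟨fun t => w n t, (hwc n).comp continuous_subtype_val⟩ with hu
  -- The passage to L^∞ requires d / (4k) < α - β, which holds for large k.
  obtain ⟨k, hk, hdk⟩ : ∃ k : ℕ, k ≠ 0 ∧ (d : ℝ) / (2 * (2 * k : ℕ)) < α - β := by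
    obtain ⟨k, hk⟩ := exists_nat_gt ((d : ℝ) / (α - β))
    have hab : 0 < α - β := by linarith
    have hk0 : (0 : ℝ) < k := lt_of_le_of_lt (by positivity) hk
    refine ⟨k, by rintro rfl; simp at hk0, ?_⟩
    rw [div_lt_iff₀ hab] at hk
    rw [div_lt_iff₀ (by push_cast; positivity)]
    push_cast
    nlinarith [mul_pos hk0 hab]
  obtain ⟨C, hC, hS⟩ := exists_eLpNorm_besselPot_le (d := d) hβ hαβ hk hdk
  obtain ⟨M₁, r₁, hM₁, hr₁, h1⟩ := h k hk
  obtain ⟨M₂, r₂, hM₂, hr₂, h2⟩ := h 1 one_ne_zero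
  set M := C * M₁ + M₂ with hM
  set r := max r₁ r₂ with hr
  have hMt : M ≠ ⊤ := by finiteness
  have hr1 : r < 1 := max_lt hr₁ hr₂
  have hnorm : ∀ n t q, eLpNorm (besselPot β fun x => (f (n + 1) t x : ℂ) - (f n t x : ℂ)) q volume =
      eLpNorm (besselPot β fun x => f (n + 1) t x - f n t x) q volume := fun n t q => by
    refine eLpNorm_congr_norm_ae (ae_of_all _ fun x => ?_)
    simp_rw [← Complex.ofReal_sub]
    rw [besselPot_ofReal, Complex.norm_real]
  have hstep : ∀ n, dist (u n) (u (n + 1)) ≤ M.toReal * r.toReal ^ (n : ℕ) := fun n => by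
    rw [ContinuousMap.dist_le (by positivity)]
    intro t
    simp only [hu, ContinuousMap.coe_mk]
    rw [dist_comm, hdist, ← ENNReal.toReal_pow, ← ENNReal.toReal_mul]
    refine ENNReal.toReal_mono (ENNReal.mul_ne_top hMt (ENNReal.pow_ne_top (hr1.trans
      ENNReal.one_lt_top).ne)) ?_
    refine (hS (fun x => (f (n + 1) t x : ℂ) - (f n t x : ℂ)) (B (n + 1) t + B n t)
      ((hft _ _).sub (hft _ _)) (fun x => (norm_sub_le _ _).trans
        (add_le_add (hB _ _ x) (hB _ _ x))) p hp).trans ?_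
    rw [hnorm, hnorm, hM, add_mul, mul_assoc]
    refine add_le_add (mul_le_mul_right ((h1 n t t.2.2).trans ?_) _)
      (le_trans (by simpa using h2 n t t.2.2) ?_)
    · exact mul_le_mul_right (pow_le_pow_left₀ zero_le (le_max_left _ _) _) _
    · exact mul_le_mul_right (pow_le_pow_left₀ zero_le (le_max_right _ _) _) _
  have hcauchy : CauchySeq fun j : ℕ => u j.succPNat := by
    refine cauchySeq_of_le_geometric r.toReal (M.toReal * r.toReal) ?_ fun j => ?_
    · have := ENNReal.toReal_strict_mono ENNReal.one_ne_top hr1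
      simpa using this
    · have := hstep j.succPNat
      rw [Nat.succPNat_coe, pow_succ] at this
      calc _ ≤ _ := this
        _ = _ := by ring
  obtain ⟨v, hv⟩ := cauchySeq_tendsto_of_complete hcauchy
  refine ⟨u, v, fun n t => hw n t, ?_⟩
  have := hv.comp OrderIso.pnatIsoNat.tendsto_atTop
  refine this.congr fun n => ?_
  exact congrArg u (PNat.succPNat_natPred n)

/-- The approximating distributions do not depend on α and p, and each Sobolev topology is finer
than that of distributions. Uniqueness of limits there identifies all limits with a single one. -/
theorem exists_limit_sobolevSpace {a : ℝ} (hK : IsCompact K)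
    (hf : ∀ n, Continuous (Function.uncurry (f n))) (hfK : ∀ n t, ∀ x ∉ K, f n t x = 0)
    (h : ∀ α, a < α → ∃ β, 0 < β ∧ β < α ∧ ∀ k : ℕ, k ≠ 0 → ∃ M r : ℝ≥0∞, M ≠ ⊤ ∧ r < 1 ∧
      ∀ n, ∀ t ≤ T, eLpNorm (besselPot β fun x => f (n + 1) t x - f n t x) (2 * k : ℕ) volume ≤
        M * r ^ (n : ℕ)) :
    ∃ L : Set.Icc (0 : ℝ≥0) T → 𝓢'(EuclideanSpace ℝ (Fin d), ℂ),
      ∀ α : ℝ, a < α → ∀ (p : ℝ≥0∞) [Fact (1 ≤ p)], 2 ≤ p →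
      ∃ (u : ℕ+ → C(Set.Icc (0 : ℝ≥0) T, SobolevSpace d (-2 * α) p))
        (v : C(Set.Icc (0 : ℝ≥0) T, SobolevSpace d (-2 * α) p)),
        (∀ n t, IsFunction (u n t).toDistribution (fun x => (f n t x : ℂ))) ∧
        (∀ t, (v t).toDistribution = L t) ∧ Tendsto u atTop (𝓝 v) := by
  have key : ∀ α : ℝ, a < α → ∀ (p : ℝ≥0∞) [Fact (1 ≤ p)], 2 ≤ p →
      ∃ (u : ℕ+ → C(Set.Icc (0 : ℝ≥0) T, SobolevSpace d (-2 * α) p))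
        (v : C(Set.Icc (0 : ℝ≥0) T, SobolevSpace d (-2 * α) p)),
        (∀ n t, IsFunction (u n t).toDistribution (fun x => (f n t x : ℂ))) ∧
        Tendsto u atTop (𝓝 v) := fun α hα p _ hp => by
    obtain ⟨β, hβ, hβα, hk⟩ := h α hα
    exact exists_tendsto_sobolevSpace hβ hβα hK hf hfK hk hp
  have hlim : ∀ {α : ℝ} {p : ℝ≥0∞} [Fact (1 ≤ p)]
      {u : ℕ+ → C(Set.Icc (0 : ℝ≥0) T, SobolevSpace d (-2 * α) p)}
      {v : C(Set.Icc (0 : ℝ≥0) T, SobolevSpace d (-2 * α) p)}, Tendsto u atTop (𝓝 v) → ∀ t,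
      Tendsto (fun n => (u n t).toDistribution) atTop (𝓝 (v t).toDistribution) := fun hu t =>
    (SobolevSpace.continuous_toDistribution.tendsto _).comp
      (((continuous_eval_const t).tendsto _).comp hu)
  -- An arbitrary admissible pair of exponents serves to define the limit.
  obtain ⟨u₀, v₀, hu₀, hv₀⟩ := key (a + 1) (by linarith) 2 le_rfl
  refine ⟨fun t => (v₀ t).toDistribution, fun α hα p _ hp => ?_⟩
  obtain ⟨u, v, hu, hv⟩ := key α hα p hp
  refine ⟨u, v, hu, fun t => ?_, hv⟩
  refine tendsto_nhds_unique (hlim hv t) ((hlim hv₀ t).congr fun n => ?_)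
  exact (hu₀ n t).unique (hu n t)

end Limit

end

end WickSchrodinger

theorem proposition1p4 {d : ℕ} (hd : 1 ≤ d) (H : Fin (d + 1) → ℝ)
    (hH : ∀ j, H j ∈ Set.Ioo (0 : ℝ) 1)
    (hlow : (d : ℝ) + 3 / 4 < 2 * H 0 + ∑ i : Fin d, H i.succ)
    (hup : 2 * H 0 + ∑ i : Fin d, H i.succ ≤ (d : ℝ) + 1)
    {Ω : Type*} [MeasurableSpace Ω] (P : Measure Ω) [IsProbabilityMeasure P]
    (Ψ : ℕ+ → ℝ≥0 → EuclideanSpace ℝ (Fin d) → Ω → ℂ)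
    (hΨ : WickSchrodinger.IsLinearSolution H P Ψ)
    (hcont : ∀ n, ∀ᵐ ω ∂P, Continuous
      (fun z : ℝ≥0 × EuclideanSpace ℝ (Fin d) => Ψ n z.1 z.2 ω))
    (T : ℝ≥0) (χ : EuclideanSpace ℝ (Fin d) → ℝ)
    (hχ : ContDiff ℝ (⊤ : ℕ∞) χ) (hχc : HasCompactSupport χ) :
    ∀ᵐ ω ∂P, ∃ L : Set.Icc (0 : ℝ≥0) T → 𝓢'(EuclideanSpace ℝ (Fin d), ℂ),
      ∀ α : ℝ, (d : ℝ) + 1 - (2 * H 0 + ∑ i : Fin d, H i.succ) < α →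
      ∀ (p : ℝ≥0∞) [Fact (1 ≤ p)], 2 ≤ p →
      ∃ (u : ℕ+ → C(Set.Icc (0 : ℝ≥0) T, WickSchrodinger.SobolevSpace d (-2 * α) p))
        (v : C(Set.Icc (0 : ℝ≥0) T, WickSchrodinger.SobolevSpace d (-2 * α) p)),
        (∀ n t, WickSchrodinger.IsFunction (u n t).toDistribution
          (fun x => ((χ x ^ 2 * WickSchrodinger.wickSquare P Ψ n t x ω : ℝ) : ℂ))) ∧
        (∀ t, (v t).toDistribution = L t) ∧
        Tendsto u atTop (𝓝 v) := by
  open WickSchrodinger in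
  obtain ⟨Φ, hΦ, hΦc, hΦm, hΦΨ⟩ := hΨ.exists_continuous_version hcont
  set a := (d : ℝ) + 1 - (2 * H 0 + ∑ i : Fin d, H i.succ) with ha
  have hχ2 : Continuous fun x => χ x ^ 2 := hχ.continuous.pow 2
  have hχ2c : HasCompactSupport fun x => χ x ^ 2 := by
    simp_rw [sq]
    exact hχc.mul_right
  -- Only rational smoothing exponents and integer k are considered, so one null set serves all real
  -- α and all p.
  have hdecay : ∀ᵐ ω ∂P, ∀ q : ℚ, a < q → (q : ℝ) < 1 / 4 → ∀ k : ℕ, k ≠ 0 →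
      ∃ M r : ℝ≥0∞, M ≠ ⊤ ∧ r < 1 ∧ ∀ n, ∀ t ≤ T, eLpNorm (fun x =>
        fieldPot (besselMeasure _ q) (fun x => χ x ^ 2) (wickIncr P Φ n t) x ω)
        (2 * k : ℕ) volume ≤ M * r ^ (n : ℕ) := by
    refine ae_all_iff.mpr fun q => ?_
    by_cases hq : a < q ∧ (q : ℝ) < 1 / 4
    · refine Filter.Eventually.mono (ae_all_iff.mpr fun k : ℕ => ?_) fun ω h _ _ => h
      rcases eq_or_ne k 0 with rfl | hk
      · exact ae_of_all _ fun ω h => absurd rfl h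
      · filter_upwards [ae_exists_eLpNorm_fieldPot_le hd hH hup hq.1 hq.2 hΦ hΦm hΦc T hχ2 hχ2c hk]
          with ω hω _ using hω
    · exact ae_of_all _ fun ω h1 h2 => absurd ⟨h1, h2⟩ hq
  filter_upwards [hdecay, hΦΨ] with ω hω hωΨ
  -- This is the lower bound on 2H₀ + ∑ Hᵢ: it makes room for exponents between a and 1/4.
  have ha4 : a < 1 / 4 := by linarith
  have hf : ∀ n, Continuous (Function.uncurry fun (t : ℝ≥0) x =>
      χ x ^ 2 * wickSquare P Φ n t x ω) := fun n => by
    have h1 := continuous_wickSquare hd hH hup (α := (a + 1 / 4) / 2) (by linarith) (by linarith) hΦ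
      (hΦc n ω)
    have h2 : Continuous fun z : ℝ≥0 × EuclideanSpace ℝ (Fin d) => χ z.2 ^ 2 :=
      hχ2.comp continuous_snd
    exact h2.mul h1
  obtain ⟨L, hL⟩ := exists_limit_sobolevSpace (T := T) (a := a) (K := tsupport χ)
    (f := fun n t x => χ x ^ 2 * wickSquare P Φ n t x ω) hχc
    hf
    (fun n t x hx => by simp [image_eq_zero_of_notMem_tsupport hx])
    (fun α hα => by
      -- A rational exponent above a, below 1/4 for the energy estimate, and strictly below α so
      -- that some smoothing is left. It is positive since a ≥ 0 by `hup`.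
      obtain ⟨q, hq1, hq2⟩ := exists_rat_btwn (lt_min hα ha4)
      refine ⟨q, by linarith, hq2.trans_le (min_le_left _ _), fun k hk => ?_⟩
      obtain ⟨M, r, hM, hr, h⟩ := hω q hq1 (hq2.trans_le (min_le_right _ _)) k hk
      refine ⟨M, r, hM, hr, fun n t ht => le_trans (le_of_eq ?_) (h n t ht)⟩
      congr 1
      funext x
      unfold besselPot fieldPot wickIncr
      simp_rw [mul_sub])
  refine ⟨L, fun α hα p _ hp => ?_⟩
  obtain ⟨u, v, hu, hv, huv⟩ := hL α hα p hp
  refine ⟨u, v, fun n t => ?_, hv, huv⟩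
  have := hu n t
  simpa only [hωΨ] using this
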